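/- Let $n\ge 1$, $R=\lfloor n/2\rfloor$, $G=GL(n,\mathbb R)$, $\mathfrak{gl}=\mathfrak{gl}(n,\mathbb R)$ with the form $(X,Y)=\operatorname{Tr}XY$. Let $\mathfrak b_\pm$ (resp. $\mathfrak n_\pm$) be the upper/lower (resp. strictly upper/lower) triangular matrices, $\epsilon=\sum_i e_{i,i+1}$, $\mathcal H=\epsilon+\mathfrak b_-$ the lower Hessenberg matrices, $B\subset G$ the group of upper triangular matrices with positive diagonal, $N\subset B$ the unipotent ones. For $0\le r\le R$ let $P_r\subset G$ be the parabolic subgroup of the invertible matrices whose entries below the diagonal in the first $r$ columns and left of the diagonal in the last $r$ rows vanish, $\mathfrak p_r$ its Lie algebra, $\mathfrak p_{r-}$ the transpose of $\mathfrak p_r$, and $\tau_r$ the sum of those $e_{i,i+1}$ with $e_{i+1,i}\notin\mathfrak p_r$. For a subalgebra $\mathfrak p$ among $\mathfrak{gl},\mathfrak p_r,\mathfrak b_+$ (so $\tau=0,\tau_r,\epsilon$) the dual $\mathfrak p^*$ is identified with $\tau+\mathfrak p^{T}$; the coadjoint action is $Ad^*_pX=\tau+\pi_{\mathfrak p^T}\big(p^{-1}(X-\tau)p\big)$,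 and the Lie–Poisson bracket is $\{f,g\}(X)=(X,[\pi_{\mathfrak p}\nabla f(X),\pi_{\mathfrak p}\nabla g(X)])$, where $\nabla$ is the gradient with respect to the trace form and $\pi$ keeps the matrix entries in the given subspace. A Casimir is a function that Poisson commutes with all functions. Similarly $N$ acts on $\mathfrak n_-\simeq\mathfrak n_+^*$ by $L\mapsto \pi_{\mathfrak n_-}(u^{-1}Lu)$. Let $(X-\eta\mathbb I)_{(r)}$ be $X-\eta\mathbb I$ with the first $r$ rows and last $r$ columns removed, and write $\det(X-\eta\mathbb I)_{(r)}=E_{0,r}\eta^{n-2r}+\cdots+E_{n-2r,r}$, $I_{m,r}=E_{m,r}/E_{0,r}$. Put $$\mathcal H_{gen}=\{X\in\mathcal H: E_{0,r}(X)\ne0,\ 1\le r\le[\tfrac{n-1}2]\},\qquad \mathcal X=\{X\in\mathcal H: E_{0,r}(X)\ne0,\ 1\le r\le R\}.$$ **Proposition.** For $0\le r\le R$ and $0\le m\le n-2r$, $E_{m,r}$ is a semi-invariant of the coadjoint action of $P_r$ on $\mathfrak p_r^*=\tau_r+\mathfrak p_{r-}$: $E_{m,r}(Ad^*_pX)=\chi_r(p)E_{m,r}(X)$,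 with the character $$\chi_r(p)=\frac{p_{1,1}\cdots p_{r,r}}{p_{n-r+1,n-r+1}\cdots p_{n,n}}.$$ (i) The $E_{m,0}$, $0\le m\le n$, are invariant under conjugation by $G$. They generate the algebra of all polynomial Casimirs on $\mathfrak{gl}^*$, and so do $\operatorname{Tr}X^m$, $1\le m\le n$. Restricted to $\mathcal H$ they are in involution, but for $n\ge2$ they are not all Casimirs. On $\mathcal H$ the Hamiltonian vector field of $\tfrac12\operatorname{Tr}X^2$ is the full Kostant Toda vector field $\dot X=[X,\pi_{\mathfrak n_-}X]$. (ii) For $1\le r\le[\frac{n-1}2]$ and $0\le m\le n-2r$, $I_{m,r}$ is a rational function of the coordinates on $\mathfrak p_{r-}$, and on $\{X\in\mathfrak p_r^*:E_{0,r}(X)\neq0\}$ (which $P_r$ preserves) it is invariant under the coadjoint action of $P_r$ and a Casimir. $\mathcal H_{gen}$ and $\mathcal X$ are nonempty Zariski open subsets of $\mathcal H$. The family $$\mathcal F=\{\operatorname{Tr}X^m\ (1\le m\le n),\ I_{m,r}\ (1\le r\le[\tfrac{n-1}2],\ 1\le m\le n-2r)\}$$ is in involution on $\mathcal H_{gen}$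 and is maximal: there is a nonempty set $V\subset\mathcal X$, Zariski open in $\mathcal H$, such that at every $X\in V$ the differentials (on $\mathcal H$) of the members of $\mathcal F$ are linearly independent, and the differential of any function that Poisson commutes at $X$ with all members of $\mathcal F$ is a linear combination of them. The full Kostant Toda lattice is completely integrable on the generic coadjoint orbits: for $X\in V$, the Hamiltonian vectors at $X$ of the members of $\mathcal F$ span a space of half the dimension of the span of all Hamiltonian vectors at $X$ (the tangent space of the orbit $B\cdot X$), and $V\cap B\cdot X$ is dense in $B\cdot X$. Every solution of $\dot X=[X,\pi_{\mathfrak n_-}X]$ on a compact interval $[a,b]$ that starts in $\mathcal H_{gen}$ stays in it, and all members of $\mathcal F$ are constant along it. For $n\ge2$ the members of $\mathcal F$ are not all $B$-invariant. (iii) For $1\le r\le R$, $E_{0,r}$ is invariant under the coadjoint action of $N$ on $\mathfrak n_-$. (iv) The $[\frac{n+1}2]$ functions $\operatorname{Tr}X$ and $I_{1,r}$, $1\le r\le[\frac{n-1}2]$, are Casimirs of the bracket on $\mathcal H$ (where they are defined). They are a complete family of Casimirs: their differentials on $\mathcal H$ are linearly independent at every point of $\mathcal H_{gen}$, and the differential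 of any $C^1$ Casimir on an open subset of $\mathcal H_{gen}$ is at each point a linear combination of theirs. Let $X\in\mathcal X$ and let $L_X\subset\mathcal X$ be the level set in $\mathcal X$ of these Casimirs through $X$. Then the connected component of $L_X$ containing $X$ is the coadjoint orbit $B\cdot X$ and also the symplectic leaf through $X$ (the set of points joined to $X$ by piecewise Hamiltonian curves in $\mathcal H$), while $L_X$ itself is the orbit of $X$ under the group of all real invertible upper triangular matrices. The rank of the bracket at $X$, which is the dimension of this leaf, is $\frac{n(n+1)}2-[\frac{n+1}2]$, the maximum over all points of $\mathcal H$. -/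

import Mathlib

open scoped ContDiff

attribute [local instance] Matrix.normedAddCommGroup Matrix.normedSpace

namespace KostantToda

/-- `gl(n, ℝ)`. Indices are 0-based: the usual row `i` is the row `i - 1 : Fin n`.
(The norm that the local instances put on it only serves to speak of `C^k` functions.) -/
abbrev Mat (n : ℕ) := Matrix (Fin n) (Fin n) ℝ

/-! ### Chops -/

section Chop

variable {R : Type*} [CommRing R]

/-- The `r`-chop of `A - η I`, where the indeterminate `η` is `Polynomial.X`:
the first `r` rows and the last `r` columns are removed. -/
noncomputable def chop {n : ℕ} (r : ℕ) (A : Matrix (Fin n) (Fin n) R) :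
    Matrix (Fin (n - r)) (Fin (n - r)) (Polynomial R) :=
  (A.map Polynomial.C - Matrix.scalar (Fin n) (Polynomial.X : Polynomial R)).submatrix
    (fun i => ⟨r + i.1, by have := i.2; omega⟩) (fun j => ⟨j.1, by have := j.2; omega⟩)

/-- `E_{m,r}(A)`, where
`det (A - η I)_{(r)} = E_{0,r} η^(n-2r) + E_{1,r} η^(n-2r-1) + ⋯ + E_{n-2r,r}`
(it is only used for `2 r ≤ n` and `m ≤ n - 2 r`). -/
noncomputable def E {n : ℕ} (m r : ℕ) (A : Matrix (Fin n) (Fin n) R) : R :=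
  (chop r A).det.coeff (n - 2 * r - m)

end Chop

/-- `I_{m,r} = E_{m,r} / E_{0,r}`. -/
noncomputable def I {n : ℕ} (m r : ℕ) (X : Mat n) : ℝ := E m r X / E 0 r X

/-- The value at the matrix `X` of a polynomial in the `n²` matrix entries. -/
noncomputable def evalAt {n : ℕ} (f : MvPolynomial (Fin n × Fin n) ℝ) (X : Mat n) : ℝ :=
  MvPolynomial.eval (fun ij => X ij.1 ij.2) f

/-- `E_{m,r}` as a polynomial in the `n²` matrix entries. -/
noncomputable def EPoly (n m r : ℕ) : MvPolynomial (Fin n × Fin n) ℝ :=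
  E m r (Matrix.mvPolynomialX (Fin n) (Fin n) ℝ)

/-- `Tr X^m` as a polynomial in the `n²` matrix entries. -/
noncomputable def trPoly (n m : ℕ) : MvPolynomial (Fin n × Fin n) ℝ :=
  ((Matrix.mvPolynomialX (Fin n) (Fin n) ℝ) ^ m).trace

/-! ### Lie-Poisson brackets and coadjoint actions

A relation `S` on the indices stands for the space `𝔭_S` of the matrices whose entries outside `S`
vanish: `True` for `gl`, `· ≤ ·` for `𝔟₊`, `InPar n r` for the parabolic subalgebra `𝔭_r`.
By means of the trace form the dual of `𝔭_S` is represented by a translate of the transpose of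
`𝔭_S`. -/

open Classical in
/-- The projection that keeps the entries in `S` and puts `0` elsewhere. -/
noncomputable def entryProj {n : ℕ} (S : Fin n → Fin n → Prop) (M : Mat n) : Mat n :=
  Matrix.of fun i j => if S i j then M i j else 0

/-- The gradient with respect to the trace form:
`df_X(Y) = Tr (grad f X * Y)` wherever `f` is differentiable. -/
noncomputable def grad {n : ℕ} (f : Mat n → ℝ) (X : Mat n) : Mat n :=
  Matrix.of fun i j => fderiv ℝ f X (Matrix.single j i 1)

/-- The Lie-Poisson bracket on the dual of `𝔭_S`:
`{f, g}(X) = (X, [π_S ∇f(X), π_S ∇g(X)])` with `(A, B) = Tr (A B)`.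
It only depends on the restrictions of `f` and `g` to the translate of the transpose of `𝔭_S`
through `X`. -/
noncomputable def bracket {n : ℕ} (S : Fin n → Fin n → Prop) (f g : Mat n → ℝ) (X : Mat n) : ℝ :=
  Matrix.trace (X * (entryProj S (grad f X) * entryProj S (grad g X)
    - entryProj S (grad g X) * entryProj S (grad f X)))

/-- `f` is differentiable at the points of `U` and Poisson commutes there with every function. -/
def IsCasimirOn {n : ℕ} (S : Fin n → Fin n → Prop) (U : Set (Mat n)) (f : Mat n → ℝ) : Prop :=
  ∀ X ∈ U, DifferentiableAt ℝ f X ∧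
    ∀ g : Mat n → ℝ, DifferentiableAt ℝ g X → bracket S f g X = 0

/-- `f` and `g` are differentiable at the points of `U` and Poisson commute there. -/
def InInvolutionOn {n : ℕ} (S : Fin n → Fin n → Prop) (U : Set (Mat n)) (f g : Mat n → ℝ) : Prop :=
  ∀ X ∈ U, DifferentiableAt ℝ f X ∧ DifferentiableAt ℝ g X ∧ bracket S f g X = 0

/-- The coadjoint action on the translate by `τ` of the transpose of `𝔭_S`:
`Ad*_p X = τ + π (p⁻¹ (X - τ) p)`, `π` being the projection to the transpose of `𝔭_S`. -/
noncomputable def coad {n : ℕ} (S : Fin n → Fin n → Prop) (τ : Mat n) (p : GL (Fin n) ℝ)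
    (X : Mat n) : Mat n :=
  τ + entryProj (fun i j => S j i)
    (((p⁻¹ : GL (Fin n) ℝ) : Mat n) * (X - τ) * (p : Mat n))

/-! ### The parabolics `P_r` -/

/-- The positions of the entries of `𝔭_r`: everything except the positions below the diagonal
that are in the first `r` columns or in the last `r` rows. -/
def InPar (n r : ℕ) (i j : Fin n) : Prop :=
  ¬ (j < i ∧ (j.1 < r ∨ n ≤ i.1 + r))

/-- Auxiliary grading of the indices by the diagonal blocks of `𝔭_r`. -/
def parBlock (n r : ℕ) (i : Fin n) : ℕ :=
  if i.1 < r then i.1 else if i.1 + r < n then r else i.1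

theorem parBlock_lt_iff (n r : ℕ) (i j : Fin n) :
    parBlock n r j < parBlock n r i ↔ ¬ InPar n r i j := by
  have hi := i.2
  have hj := j.2
  simp only [InPar, not_not, parBlock, Fin.lt_def]
  split_ifs <;> omega

theorem blockTriangular_iff (n r : ℕ) (M : Mat n) :
    M.BlockTriangular (parBlock n r) ↔ ∀ i j, ¬ InPar n r i j → M i j = 0 := by
  constructor
  · intro h i j hij
    exact h ((parBlock_lt_iff n r i j).2 hij)
  · intro h i j hij
    exact h i j ((parBlock_lt_iff n r i j).1 hij)

/-- The parabolic subgroup `P_r` of `GL(n, ℝ)`: the entries below the diagonal in the first `r`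
columns and to the left of the diagonal in the last `r` rows vanish. -/
def P (n r : ℕ) : Subgroup (GL (Fin n) ℝ) where
  carrier := {p | ∀ i j, ¬ InPar n r i j → (p : Mat n) i j = 0}
  one_mem' := by
    refine (blockTriangular_iff n r _).1 ?_
    rw [Units.val_one]
    exact Matrix.blockTriangular_one
  mul_mem' := by
    intro a b ha hb
    refine (blockTriangular_iff n r _).1 ?_
    rw [Units.val_mul]
    exact ((blockTriangular_iff n r _).2 ha).mul ((blockTriangular_iff n r _).2 hb)
  inv_mem' := by
    intro a ha
    refine (blockTriangular_iff n r _).1 ?_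
    have h := (blockTriangular_iff n r _).2 ha
    have : Invertible (a : Mat n) := a.invertible
    rw [Matrix.coe_units_inv]
    exact Matrix.blockTriangular_inv_of_blockTriangular h

open Classical in
/-- `τ_r`, the sum of the root vectors of those positive simple roots whose negatives do not
belong to `𝔭_r`. -/
noncomputable def tau (n r : ℕ) : Mat n :=
  Matrix.of fun i j => if i.1 + 1 = j.1 ∧ ¬ InPar n r j i then 1 else 0

/-- The model `τ_r + 𝔭_{r-}` of the dual of `𝔭_r`, `𝔭_{r-}` being the transpose of `𝔭_r`. -/
def dualPar (n r : ℕ) : Set (Mat n) :=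
  {X | ∀ i j, ¬ InPar n r j i → X i j = tau n r i j}

/-- `f` is a semi-invariant of weight `χ` of the coadjoint action of `P_r` on the dual
of `𝔭_r`. -/
def IsSemiInvariant {n : ℕ} (r : ℕ) (f : Mat n → ℝ) (χ : P n r →* ℝˣ) : Prop :=
  ∀ p : P n r, ∀ X ∈ dualPar n r,
    f (coad (InPar n r) (tau n r) (p : GL (Fin n) ℝ) X) = (χ p : ℝ) * f X

/-! ### Hessenberg matrices and the Borel subgroup -/

/-- The principal nilpotent element. -/
noncomputable def eps (n : ℕ) : Mat n :=
  Matrix.of fun i j => if i.1 + 1 = j.1 then 1 else 0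

/-- The space `ℋ = ε + 𝔟₋` of lower Hessenberg matrices. -/
def hess (n : ℕ) : Set (Mat n) := {X | ∀ i j, i < j → X i j = eps n i j}

/-- The Hessenberg matrices with `E_{0,r}(X) ≠ 0` for `1 ≤ r ≤ K`. -/
def genericUpTo (n K : ℕ) : Set (Mat n) :=
  {X | X ∈ hess n ∧ ∀ r, 1 ≤ r → r ≤ K → E 0 r X ≠ 0}

/-- `ℋ_gen`: `E_{0,r}(X) ≠ 0` for `1 ≤ r ≤ [(n-1)/2]`. -/
def hessGen (n : ℕ) : Set (Mat n) := genericUpTo n ((n - 1) / 2)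

/-- `𝒳`: `E_{0,r}(X) ≠ 0` for `1 ≤ r ≤ R = [n/2]`. -/
def hessReg (n : ℕ) : Set (Mat n) := genericUpTo n (n / 2)

/-- The invertible upper triangular matrices. -/
def IsUpper {n : ℕ} (b : GL (Fin n) ℝ) : Prop := ∀ i j, j < i → (b : Mat n) i j = 0

/-- The group `B`: upper triangular with positive diagonal, the connected component of the
identity in the invertible upper triangular matrices. -/
def IsBorel {n : ℕ} (b : GL (Fin n) ℝ) : Prop := IsUpper b ∧ ∀ i, 0 < (b : Mat n) i i

/-- The group `N`: upper triangular with unit diagonal. -/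
def IsUnipotentUpper {n : ℕ} (b : GL (Fin n) ℝ) : Prop := IsUpper b ∧ ∀ i, (b : Mat n) i i = 1

/-- The Lie-Poisson bracket on `ℋ = 𝔟₊*`. -/
noncomputable def bracketH {n : ℕ} (f g : Mat n → ℝ) (X : Mat n) : ℝ := bracket (· ≤ ·) f g X

/-- The coadjoint action on `ℋ`. -/
noncomputable def coadH {n : ℕ} (b : GL (Fin n) ℝ) (X : Mat n) : Mat n :=
  coad (· ≤ ·) (eps n) b X

/-- The coadjoint orbit of `X ∈ ℋ` under `B`. -/
def orbitB {n : ℕ} (X : Mat n) : Set (Mat n) := {Y | ∃ b, IsBorel b ∧ Y = coadH b X}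

/-- The differential at `X` of the restriction of `f` to `ℋ`. The cotangent space of `ℋ` at `X` is
identified with `𝔟₊` by the trace form. -/
noncomputable def diffH {n : ℕ} (f : Mat n → ℝ) (X : Mat n) : Mat n :=
  entryProj (· ≤ ·) (grad f X)

/-- The Hamiltonian vector field of `h` on `ℋ`, the vector of `𝔟₋` that represents the derivation
`g ↦ {g, h}(X)`. -/
noncomputable def hamVec {n : ℕ} (h : Mat n → ℝ) (X : Mat n) : Mat n :=
  entryProj (fun i j => j ≤ i) (diffH h X * X - X * diffH h X)

/-- The characteristic space of the Poisson structure at `X ∈ ℋ`, spanned by all Hamiltonian vector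
fields: the tangent space of the symplectic leaf through `X`. Its dimension is the rank of the
Poisson structure. -/
noncomputable def charSpace {n : ℕ} (X : Mat n) : Submodule ℝ (Mat n) :=
  Submodule.span ℝ {V | ∃ h : Mat n → ℝ, DifferentiableAt ℝ h X ∧ V = hamVec h X}

/-- `Y` is reached from `X` in time one along an integral curve in `ℋ` of the Hamiltonian vector
field of a smooth function. -/
def HamStep {n : ℕ} (X Y : Mat n) : Prop :=
  ∃ (h : Mat n → ℝ) (γ : ℝ → Mat n), ContDiff ℝ ∞ h ∧ γ 0 = X ∧ γ 1 = Y ∧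
    ∀ t ∈ Set.Icc (0 : ℝ) 1, γ t ∈ hess n ∧
      HasDerivWithinAt γ (hamVec h (γ t)) (Set.Icc 0 1) t

/-- The symplectic leaf of `ℋ` through `X`: the points that piecewise Hamiltonian curves join
to `X`. -/
def sympLeaf {n : ℕ} (X : Mat n) : Set (Mat n) := {Y | Relation.EqvGen HamStep X Y}

/-- The full Kostant Toda vector field `[X, π₋ X]`, `π₋` being the projection to the strictly lower
triangular matrices along the upper triangular ones. -/
noncomputable def todaField {n : ℕ} (X : Mat n) : Mat n :=
  X * entryProj (fun i j => j < i) X - entryProj (fun i j => j < i) X * X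

/-- Indices `(r, m)` of the involutive family, `0 ≤ r ≤ [(n-1)/2]` and `1 ≤ m ≤ n - 2 r`
(the second component of the pair is `m - 1`). -/
abbrev FamIdx (n : ℕ) := (r : Fin ((n + 1) / 2)) × Fin (n - 2 * r.1)

/-- The family `{Tr X^m, I_{m,r}}`, the traces of powers being listed under `r = 0`. -/
noncomputable def fam {n : ℕ} (k : FamIdx n) (X : Mat n) : ℝ :=
  if k.1.1 = 0 then (X ^ (k.2.1 + 1)).trace else I (k.2.1 + 1) k.1.1 X

/-- The family `{Tr X, I_{1,r}}`, `1 ≤ r ≤ [(n-1)/2]`, with `Tr X` listed under `r = 0`. -/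
noncomputable def cas {n : ℕ} (r : Fin ((n + 1) / 2)) (X : Mat n) : ℝ :=
  if r.1 = 0 then X.trace else I 1 r.1 X

/-- The level set in `𝒳` of `{Tr X, I_{1,r}}` through `X`. -/
def levelSet {n : ℕ} (X : Mat n) : Set (Mat n) :=
  {Y | Y ∈ hessReg n ∧ ∀ r : Fin ((n + 1) / 2), cas r Y = cas r X}

end KostantToda

namespace KostantToda

/-! ### Calculus on matrices -/

section Calculus

variable {n : ℕ}

/-! Everything rests on one factorization. If `p` lies in `P_r`, the rows of `p⁻¹` from `r` on and
the columns of `p` before `n - r` are supported on those same rows and columns, so the `r`-chop of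
`p⁻¹(X - η)p` is a product of three square matrices whose middle factor is the chop of `X - η`.
Taking determinants, `E_{m,r}` is multiplied by a character of `P_r` that does not depend on `m`
(`E_conj`); hence the quotients `I_{m,r}` are invariant, and differentiating at `p = 1` gives the
infinitesimal form (`fderiv_E_comm`). The same chop can be read as a block matrix: `E_{0,r}` is, up
to a constant, the lower left `r × r` minor, and the `I_{m,r}` are coefficients of the
characteristic polynomial of a Schur complement (`exists_E_eq`, `I_eq_coeff`).

Involution is an Adler–Kostant–Symes argument (`bracket_eq_zero_of_parInvariantAt`). For `r ≤ r'`
the algebras are nested, `𝔟₊ ⊆ 𝔭_{r'} ⊆ 𝔭_r`. Splitting the two gradients into upper and strictly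
lower parts, `[A₊, B₊] = [A₊, B] - [A, B₋] + [A₋, B₋]`; the first two terms pair to zero with `X` by
invariance, the last because `X` is Hessenberg.

Polynomial Casimirs on `gl`: such a function is constant along conjugations that can be joined to
the identity. Near the nilpotent shift, the Krylov matrix of `X` is close to `1` and conjugates `X`
to the companion matrix of its characteristic polynomial. So the Casimir is a polynomial in the
coefficients on an open set, hence everywhere; Newton's identities pass to traces.

The geometry of `𝒳` comes from a normal form (`exists_coadH_eq_nf`): upper triangular matrices
reduce `X` to a matrix with a diagonal `D` supported in the first half and an antidiagonal `σ` below
it. The Casimirs are, up to sign, tail sums of `D`, and the signs of `σ` are encoded in the signs of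
the `E_{0,r}`. Therefore level sets are orbits of the full triangular group, and the `B`-orbits
inside them are separated by signs of nonvanishing continuous functions, so they are the connected
components. Hamiltonian curves multiply `E_{0,r}` by positive factors and fix the Casimirs;
conversely `B` is generated by one-parameter groups acting by flows of linear Hamiltonians. Hence
leaves are orbits. At a normal form the kernel of the Poisson tensor is determined by half of a
diagonal, and the Casimirs fill it, which gives the rank.

For maximality, the gradients of the family are in triangular position at the point `seed n`
(`grad_fam_seed_eq_zero`), so one minor is a nonzero polynomial. The number of members is half of
dimension plus corank, so wherever they are independent on `𝒳` they span their own orthogonal for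
the Poisson form. Density in orbits is the identity theorem along analytic curves. -/

theorem hasDerivAt_congr {f g : ℝ → ℝ} {a b t : ℝ} (h : HasDerivAt f a t)
    (hfg : ∀ s, g s = f s) (hab : b = a) : HasDerivAt g b t := by
  have : g = f := funext hfg
  rw [this, hab]; exact h

theorem hasDerivAt_matrix {A : ℝ → Mat n} {A' : Mat n} {t : ℝ} :
    HasDerivAt A A' t ↔ ∀ i j, HasDerivAt (fun s => A s i j) (A' i j) t := by
  refine (hasDerivAt_pi (φ := A) (φ' := A')).trans (forall_congr' fun i => ?_)
  exact hasDerivAt_pi (φ := fun s => A s i) (φ' := A' i)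

theorem hasDerivAt_matrix_mul {A B : ℝ → Mat n} {A' B' : Mat n} {t : ℝ}
    (hA : HasDerivAt A A' t) (hB : HasDerivAt B B' t) :
    HasDerivAt (fun s => A s * B s) (A' * B t + A t * B') t := by
  rw [hasDerivAt_matrix] at *
  intro i j
  simp only [Matrix.mul_apply, Matrix.add_apply, ← Finset.sum_add_distrib]
  exact HasDerivAt.fun_sum fun k _ => (hA i k).mul (hB k j)

/-- By the resolvent identity the difference quotient of the inverse is `-(A s)⁻¹ Q(s) (A t)⁻¹`,
with `Q` the difference quotient of `A`; continuity of the inverse, from the adjugate formula, lets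
it converge. -/
theorem hasDerivAt_matrix_inv {A : ℝ → Mat n} {A' : Mat n} {t : ℝ}
    (hA : HasDerivAt A A' t) (hdet : (A t).det ≠ 0) :
    HasDerivAt (fun s => (A s)⁻¹) (-((A t)⁻¹ * A' * (A t)⁻¹)) t := by
  have hcd : ContinuousAt (fun s => (A s).det) t :=
    (Continuous.matrix_det continuous_id).continuousAt.comp hA.continuousAt
  have hci : ContinuousAt (fun s => (A s)⁻¹) t := by
    have h1 : (fun s => (A s)⁻¹) = fun s => ((A s).det)⁻¹ • (A s).adjugate := by
      funext s
      rw [Matrix.inv_def, Ring.inverse_eq_inv']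
    rw [h1]
    exact (hcd.inv₀ hdet).smul
      ((Continuous.matrix_adjugate continuous_id).continuousAt.comp hA.continuousAt)
  set Q : ℝ → Mat n := fun s => (s - t)⁻¹ • (A s - A t) with hQ
  have hQlim : Filter.Tendsto Q (nhdsWithin t {t}ᶜ) (nhds A') := by
    refine tendsto_pi_nhds.2 fun i => tendsto_pi_nhds.2 fun j => ?_
    exact hasDerivAt_iff_tendsto_slope.1 (hasDerivAt_matrix.1 hA i j)
  have hev : ∀ᶠ s in nhdsWithin t {t}ᶜ, (A s).det ≠ 0 :=
    (hcd.eventually_ne hdet).filter_mono nhdsWithin_le_nhds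
  have hlim : Filter.Tendsto (fun s => -((fun s => (A s)⁻¹) s * Q s * (A t)⁻¹)) (nhdsWithin t {t}ᶜ)
      (nhds (-((A t)⁻¹ * A' * (A t)⁻¹))) := by
    have hinv : Filter.Tendsto (fun s => (A s)⁻¹) (nhdsWithin t {t}ᶜ) (nhds (A t)⁻¹) :=
      Filter.Tendsto.mono_left hci nhdsWithin_le_nhds
    generalize (fun s => (A s)⁻¹) = P at hinv ⊢
    generalize (A t)⁻¹ = B at hinv ⊢
    have hmul : Continuous fun p : Mat n × Mat n => -(p.1 * p.2 * B) :=
      ((continuous_fst.matrix_mul continuous_snd).matrix_mul continuous_const).neg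
    have h := (hmul.tendsto (B, A')).comp (hinv.prodMk_nhds hQlim)
    exact h
  rw [hasDerivAt_matrix]
  intro i j
  refine hasDerivAt_iff_tendsto_slope.2
    ((tendsto_pi_nhds.1 (tendsto_pi_nhds.1 hlim i) j).congr' ?_)
  filter_upwards [hev] with s hs
  have h1 : (A s)⁻¹ * A s = 1 := Matrix.nonsing_inv_mul _ (isUnit_iff_ne_zero.2 hs)
  have h2 : A t * (A t)⁻¹ = 1 := Matrix.mul_nonsing_inv _ (isUnit_iff_ne_zero.2 hdet)
  have h3 : -((A s)⁻¹ * Q s * (A t)⁻¹) = (s - t)⁻¹ • ((A s)⁻¹ - (A t)⁻¹) := by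
    simp only [hQ, Matrix.mul_smul, Matrix.smul_mul, ← smul_neg]
    congr 1
    rw [Matrix.mul_sub, Matrix.sub_mul, h1, Matrix.mul_assoc (A s)⁻¹ (A t), h2]
    simp
  rw [h3]
  rfl

/-- The derivative of a curve of conjugates. -/
theorem hasDerivAt_matrix_conj {p : ℝ → Mat n} {p' : Mat n} {t : ℝ} (X : Mat n)
    (hp : HasDerivAt p p' t) (hdet : (p t).det ≠ 0) :
    HasDerivAt (fun s => (p s)⁻¹ * X * p s)
      (((p t)⁻¹ * X * p t) * ((p t)⁻¹ * p') - ((p t)⁻¹ * p') * ((p t)⁻¹ * X * p t)) t := by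
  have h2 : p t * (p t)⁻¹ = 1 := Matrix.mul_nonsing_inv _ (isUnit_iff_ne_zero.2 hdet)
  have hX : HasDerivAt (fun _ : ℝ => X) 0 t := hasDerivAt_const t X
  have h := hasDerivAt_matrix_mul (hasDerivAt_matrix_mul (hasDerivAt_matrix_inv hp hdet) hX) hp
  refine h.congr_deriv ?_
  have e1 : (p t)⁻¹ * X * p t * ((p t)⁻¹ * p') = (p t)⁻¹ * X * (p t * (p t)⁻¹) * p' := by
    simp only [Matrix.mul_assoc]
  rw [e1, h2]
  simp only [Matrix.mul_one, Matrix.mul_zero, add_zero, Matrix.neg_mul, Matrix.mul_assoc]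
  abel

theorem hasDerivAt_line (X Y : Mat n) (t : ℝ) :
    HasDerivAt (fun s : ℝ => X + s • Y) Y t := by
  rw [hasDerivAt_matrix]
  intro i j
  simpa using ((hasDerivAt_id t).mul_const (Y i j)).const_add (X i j)

theorem hasDerivAt_one_add_smul (Y : Mat n) (t : ℝ) :
    HasDerivAt (fun s : ℝ => 1 + s • Y) Y t :=
  hasDerivAt_line 1 Y t

theorem hasDerivAt_comp_line {f : Mat n → ℝ} {X : Mat n} (hf : DifferentiableAt ℝ f X)
    (V : Mat n) : HasDerivAt (fun t : ℝ => f (X + t • V)) (fderiv ℝ f X V) 0 := by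
  have h := hasDerivAt_line X V 0
  have hf' : HasFDerivAt f (fderiv ℝ f X) (X + (0 : ℝ) • V) := by
    simpa using hf.hasFDerivAt
  exact hf'.comp_hasDerivAt (0 : ℝ) h

theorem fderiv_eq_of_line {f : Mat n → ℝ} {X : Mat n} (hf : DifferentiableAt ℝ f X) {V : Mat n}
    {c : ℝ} (h : HasDerivAt (fun t : ℝ => f (X + t • V)) c 0) : fderiv ℝ f X V = c :=
  (hasDerivAt_comp_line hf V).unique h

/-- A positive factor transports the solutions of a scalar linear differential equation. -/
theorem exists_factor_of_linear_ode {a b : ℝ} (hab : a ≤ b) {c : ℝ → ℝ}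
    (hc : ContinuousOn c (Set.Icc a b)) :
    ∃ e : ℝ → ℝ, (∀ t, 0 < e t) ∧ ∀ F : ℝ → ℝ,
      (∀ t ∈ Set.Icc a b, HasDerivWithinAt F (c t * F t) (Set.Icc a b) t) →
      ∀ t ∈ Set.Icc a b, F t = e t * F a := by
  -- The coefficient is continuous only on the interval. Its constant extension makes the primitive
  -- differentiable at the end points too, and `exp (-C)` is then an integrating factor.
  set g : ℝ → ℝ := Set.IccExtend hab ((Set.Icc a b).domRestrict c) with hg
  have hgc : Continuous g := (continuousOn_iff_continuous_domRestrict.1 hc).Icc_extend'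
  set C : ℝ → ℝ := fun t => ∫ s in a..t, g s with hC
  have hCd : ∀ t, HasDerivAt C (g t) t := fun t =>
    intervalIntegral.integral_hasDerivAt_right (hgc.intervalIntegrable _ _)
      (hgc.stronglyMeasurableAtFilter _ _) hgc.continuousAt
  have hCa : C a = 0 := by simp [hC]
  refine ⟨fun t => Real.exp (C t), fun t => Real.exp_pos _, fun F hF t ht => ?_⟩
  have hder : ∀ s ∈ Set.Icc a b,
      HasDerivWithinAt (fun s => F s * Real.exp (-C s)) 0 (Set.Icc a b) s := by
    intro s hs
    have h1 := (hF s hs).mul ((hCd s).neg.exp.hasDerivWithinAt (s := Set.Icc a b))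
    have hgs : g s = c s := by
      rw [hg, Set.IccExtend_of_mem hab _ hs]; rfl
    have h2 : c s * F s * Real.exp (-C s) + F s * (Real.exp (-C s) * -g s) = 0 := by
      rw [hgs]; ring
    exact h2 ▸ h1
  have hconst := constant_of_derivWithin_zero
    (f := fun s => F s * Real.exp (-C s)) (a := a) (b := b)
    (fun s hs => (hder s hs).differentiableWithinAt)
    (fun s hs => (hder s ⟨hs.1, hs.2.le⟩).derivWithin
      ((uniqueDiffOn_Icc (lt_of_le_of_lt hs.1 hs.2)) s ⟨hs.1, hs.2.le⟩)) t ht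
  simp only [hCa, neg_zero, Real.exp_zero, mul_one] at hconst
  rw [← hconst, mul_comm, mul_assoc, ← Real.exp_add]
  simp

end Calculus

/-! ### Gradients and entry projections -/

section Gradient

variable {n : ℕ}

theorem fderiv_eq_trace (f : Mat n → ℝ) (X V : Mat n) :
    fderiv ℝ f X V = (grad f X * V).trace := by
  conv_lhs => rw [Matrix.matrix_eq_sum_single V]
  simp only [map_sum, Matrix.trace, Matrix.diag_apply, Matrix.mul_apply, grad, Matrix.of_apply]
  rw [Finset.sum_comm]
  refine Finset.sum_congr rfl fun j _ => Finset.sum_congr rfl fun i _ => ?_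
  have : Matrix.single i j (V i j) = V i j • Matrix.single i j (1 : ℝ) := by
    rw [Matrix.smul_single, smul_eq_mul, mul_one]
  rw [this, map_smul, smul_eq_mul, mul_comm]

/-- The linear function `Z ↦ Tr (A Z)`. -/
noncomputable def trLin (A : Mat n) : Mat n →L[ℝ] ℝ :=
  LinearMap.toContinuousLinearMap ((Matrix.traceLinearMap (Fin n) ℝ ℝ).comp
    (LinearMap.mulLeft ℝ A))

theorem trLin_apply (A Z : Mat n) : trLin A Z = (A * Z).trace := rfl

theorem trace_mul_single (A : Mat n) (i j : Fin n) :
    (A * Matrix.single j i 1).trace = A i j := by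
  rw [Matrix.trace_mul_single]; simp

theorem grad_trLin (A X : Mat n) : grad (trLin A) X = A := by
  ext i j
  rw [grad, Matrix.of_apply, ContinuousLinearMap.fderiv, trLin_apply, trace_mul_single]

theorem ext_trace {A B : Mat n} (h : ∀ V : Mat n, (A * V).trace = (B * V).trace) : A = B := by
  ext i j
  rw [← trace_mul_single A, ← trace_mul_single B, h]

theorem entryProj_apply (S : Fin n → Fin n → Prop) (M : Mat n) (i j : Fin n) [Decidable (S i j)] :
    entryProj S M i j = if S i j then M i j else 0 := by
  simp only [entryProj, Matrix.of_apply]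
  congr

theorem entryProj_of {S : Fin n → Fin n → Prop} {i j : Fin n} (h : S i j) (M : Mat n) :
    entryProj S M i j = M i j := by
  classical
  rw [entryProj_apply, if_pos h]

theorem entryProj_of_not {S : Fin n → Fin n → Prop} {i j : Fin n} (h : ¬ S i j) (M : Mat n) :
    entryProj S M i j = 0 := by
  classical
  rw [entryProj_apply, if_neg h]

/-- `entryProj` as a linear map. -/
noncomputable def entryProjₗ (S : Fin n → Fin n → Prop) : Mat n →ₗ[ℝ] Mat n where
  toFun := entryProj S
  map_add' A B := by
    classical
    ext i j
    simp only [entryProj_apply, Matrix.add_apply]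
    split_ifs <;> simp
  map_smul' c A := by
    classical
    ext i j
    simp only [entryProj_apply, Matrix.smul_apply, RingHom.id_apply]
    split_ifs <;> simp

theorem entryProjₗ_apply (S : Fin n → Fin n → Prop) (M : Mat n) :
    entryProjₗ S M = entryProj S M := rfl

theorem entryProj_eq_self {S : Fin n → Fin n → Prop} {M : Mat n}
    (h : ∀ i j, ¬ S i j → M i j = 0) : entryProj S M = M := by
  classical
  ext i j
  rw [entryProj_apply]
  split_ifs with hs
  · rfl
  · rw [h i j hs]

theorem entryProj_true (M : Mat n) : entryProj (fun _ _ => True) M = M :=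
  entryProj_eq_self fun _ _ h => (h trivial).elim

theorem trace_entryProj_mul (S : Fin n → Fin n → Prop) (A B : Mat n) :
    (entryProj S A * B).trace = (A * entryProj (fun i j => S j i) B).trace := by
  classical
  simp only [Matrix.trace, Matrix.diag_apply, Matrix.mul_apply, entryProj_apply]
  refine Finset.sum_congr rfl fun i _ => Finset.sum_congr rfl fun j _ => ?_
  split_ifs <;> simp

/-- `Tr (X [A, Y]) = Tr (A [Y, X])`. -/
theorem trace_mul_comm_cycle (X A Y : Mat n) :
    (X * (A * Y - Y * A)).trace = (A * (Y * X - X * Y)).trace := by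
  simp only [Matrix.mul_sub, Matrix.trace_sub]
  rw [Matrix.trace_mul_comm X (A * Y), Matrix.mul_assoc, ← Matrix.mul_assoc X Y A,
    Matrix.trace_mul_comm (X * Y) A]

theorem bracket_eq_trace (S : Fin n → Fin n → Prop) (f g : Mat n → ℝ) (X : Mat n) :
    bracket S f g X = (entryProj S (grad f X) *
      (entryProj S (grad g X) * X - X * entryProj S (grad g X))).trace := by
  rw [bracket, trace_mul_comm_cycle]

theorem bracket_antisymm (S : Fin n → Fin n → Prop) (f g : Mat n → ℝ) (X : Mat n) :
    bracket S f g X = - bracket S g f X := by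
  rw [bracket, bracket, ← Matrix.trace_neg, ← Matrix.mul_neg, neg_sub]

end Gradient

/-! ### Triangular matrices -/

section Triangular

variable {n : ℕ}

/-- Upper triangular matrices. -/
def UT (A : Mat n) : Prop := ∀ i j, j < i → A i j = 0

/-- Strictly upper triangular matrices. -/
def SUT (A : Mat n) : Prop := ∀ i j, j ≤ i → A i j = 0

theorem UT.blockTriangular {A : Mat n} (h : UT A) : A.BlockTriangular id := fun i j hij => h i j hij

theorem UT.mul {A B : Mat n} (hA : UT A) (hB : UT B) : UT (A * B) :=
  fun _ _ hij => (hA.blockTriangular.mul hB.blockTriangular) hij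

theorem UT.inv {A : Mat n} (hA : UT A) (h : A.det ≠ 0) : UT A⁻¹ := by
  have : Invertible A := A.invertibleOfIsUnitDet (isUnit_iff_ne_zero.2 h)
  exact fun _ _ hij => (Matrix.blockTriangular_inv_of_blockTriangular hA.blockTriangular) hij

theorem UT.mul_apply_self {A B : Mat n} (hA : UT A) (hB : UT B) (i : Fin n) :
    (A * B) i i = A i i * B i i := by
  rw [Matrix.mul_apply]
  refine Finset.sum_eq_single i (fun k _ hk => ?_) (fun h => absurd (Finset.mem_univ i) h)
  rcases lt_or_gt_of_ne hk with h | h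
  · rw [hA i k h, zero_mul]
  · rw [hB k i h, mul_zero]

theorem UT.det {A : Mat n} (hA : UT A) : A.det = ∏ i, A i i :=
  Matrix.det_of_isUpperTriangular hA.blockTriangular

theorem UT.one : UT (1 : Mat n) := fun _ _ h => Matrix.one_apply_ne (ne_of_gt h)

theorem UT.add {A B : Mat n} (hA : UT A) (hB : UT B) : UT (A + B) := fun i j h => by
  rw [Matrix.add_apply, hA i j h, hB i j h, add_zero]

theorem UT.smul {A : Mat n} (c : ℝ) (hA : UT A) : UT (c • A) := fun i j h => by
  rw [Matrix.smul_apply, hA i j h, smul_zero]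

theorem UT.sub {A B : Mat n} (hA : UT A) (hB : UT B) : UT (A - B) := fun i j h => by
  rw [Matrix.sub_apply, hA i j h, hB i j h, sub_zero]

theorem SUT.ut {A : Mat n} (hA : SUT A) : UT A := fun i j h => hA i j h.le

theorem SUT.add {A B : Mat n} (hA : SUT A) (hB : SUT B) : SUT (A + B) := fun i j h => by
  rw [Matrix.add_apply, hA i j h, hB i j h, add_zero]

theorem SUT.sub {A B : Mat n} (hA : SUT A) (hB : SUT B) : SUT (A - B) := fun i j h => by
  rw [Matrix.sub_apply, hA i j h, hB i j h, sub_zero]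

theorem UT.mul_sut {A B : Mat n} (hA : UT A) (hB : SUT B) : SUT (A * B) := by
  intro i j hij
  rw [Matrix.mul_apply]
  refine Finset.sum_eq_zero fun k _ => ?_
  rcases lt_or_ge k i with h | h
  · rw [hA i k h, zero_mul]
  · rw [hB k j (hij.trans h), mul_zero]

theorem SUT.mul_ut {A B : Mat n} (hA : SUT A) (hB : UT B) : SUT (A * B) := by
  intro i j hij
  rw [Matrix.mul_apply]
  refine Finset.sum_eq_zero fun k _ => ?_
  rcases le_or_gt k i with h | h
  · rw [hA i k h, zero_mul]
  · rw [hB k j (lt_of_le_of_lt hij h), mul_zero]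

theorem entryProj_le_ut (A : Mat n) : UT (entryProj (· ≤ ·) A) :=
  fun _ _ h => entryProj_of_not (not_le.2 h) A

theorem eps_sut : SUT (eps n) := by
  intro i j hij
  simp only [eps, Matrix.of_apply]
  rw [if_neg]
  have := Fin.le_def.1 hij
  omega

end Triangular

/-! ### Polynomial functions of the entries -/

section PolynomialFunctions

variable {n : ℕ}

theorem evalAt_mul (f g : MvPolynomial (Fin n × Fin n) ℝ) (X : Mat n) :
    evalAt (f * g) X = evalAt f X * evalAt g X := map_mul _ _ _

theorem evalAt_add (f g : MvPolynomial (Fin n × Fin n) ℝ) (X : Mat n) :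
    evalAt (f + g) X = evalAt f X + evalAt g X := map_add _ _ _

theorem evalAt_sub (f g : MvPolynomial (Fin n × Fin n) ℝ) (X : Mat n) :
    evalAt (f - g) X = evalAt f X - evalAt g X := map_sub _ _ _

theorem evalAt_C (c : ℝ) (X : Mat n) : evalAt (MvPolynomial.C c) X = c := MvPolynomial.eval_C _

theorem evalAt_contDiff (f : MvPolynomial (Fin n × Fin n) ℝ) {k : WithTop ℕ∞} :
    ContDiff ℝ k (evalAt f) := by
  have hent : ∀ p : Fin n × Fin n, ContDiff ℝ k fun X : Mat n => X p.1 p.2 := fun p =>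
    (contDiff_apply_apply ℝ ℝ p.1 p.2)
  induction f using MvPolynomial.induction_on with
  | C a =>
    have : (evalAt (MvPolynomial.C a) : Mat n → ℝ) = fun _ => a := by
      funext X; simp [evalAt]
    rw [this]; exact contDiff_const
  | add p q hp hq =>
    have : (evalAt (p + q) : Mat n → ℝ) = fun X => evalAt p X + evalAt q X := by
      funext X; simp [evalAt]
    rw [this]; exact hp.add hq
  | mul_X p i hp =>
    have : (evalAt (p * MvPolynomial.X i) : Mat n → ℝ) = fun X => evalAt p X * X i.1 i.2 := by
      funext X; simp [evalAt]
    rw [this]; exact hp.mul (hent i)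

theorem evalAt_differentiable (f : MvPolynomial (Fin n × Fin n) ℝ) :
    Differentiable ℝ (evalAt f) := (evalAt_contDiff f (k := 1)).differentiable one_ne_zero

theorem fderiv_evalAt (f : MvPolynomial (Fin n × Fin n) ℝ) (X : Mat n) (i j : Fin n) :
    fderiv ℝ (evalAt f) X (Matrix.single i j 1) = evalAt (MvPolynomial.pderiv (i, j) f) X := by
  refine fderiv_eq_of_line (evalAt_differentiable f X) ?_
  induction f using MvPolynomial.induction_on with
  | C a => simpa [evalAt] using hasDerivAt_const (0 : ℝ) a
  | add p q hp hq => exact hasDerivAt_congr (hp.add hq) (fun t => by simp [evalAt]) (by simp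
      [evalAt])
  | mul_X p k hp =>
    have hk := (hasDerivAt_matrix.1 (hasDerivAt_line X (Matrix.single i j 1) 0)) k.1 k.2
    have h := hp.mul hk
    have e1 : Matrix.single i j (1 : ℝ) k.1 k.2 =
        MvPolynomial.eval (fun ij : Fin n × Fin n => X ij.1 ij.2)
          (MvPolynomial.pderiv (i, j) (MvPolynomial.X k)) := by
      rw [MvPolynomial.pderiv_X]
      obtain ⟨a, b⟩ := k
      by_cases h : i = a ∧ j = b
      · obtain ⟨rfl, rfl⟩ := h
        simp
      · rw [Matrix.single_apply_of_ne _ _ _ _ _ h, Pi.single_eq_of_ne, map_zero]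
        intro h'
        exact h ⟨(Prod.ext_iff.1 h').1.symm, (Prod.ext_iff.1 h').2.symm⟩
    refine hasDerivAt_congr h (fun t => ?_) ?_
    · simp [evalAt]
    · simp only [evalAt, Derivation.leibniz, smul_eq_mul, map_add, map_mul, MvPolynomial.eval_X,
        zero_smul, add_zero, e1]
      ring

/-- The identity theorem for real analytic functions, followed by the fact that a polynomial over an
infinite field is determined by its values. -/
theorem evalAt_eq_zero_of_eventually {f : MvPolynomial (Fin n × Fin n) ℝ} {X₀ : Mat n}
    (h : ∀ᶠ X in nhds X₀, evalAt f X = 0) : f = 0 := by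
  have han : AnalyticOnNhd ℝ (evalAt f) Set.univ := fun X _ =>
    (evalAt_contDiff f (k := ω)).contDiffAt.analyticAt
  have h0 : evalAt f = fun _ => 0 :=
    han.eq_of_eventuallyEq analyticOnNhd_const h
  refine MvPolynomial.funext fun x => ?_
  have := congrFun h0 (Matrix.of fun i j => x (i, j))
  simpa [evalAt] using this

theorem map_eval_mvPolynomialX (X : Mat n) :
    (Matrix.mvPolynomialX (Fin n) (Fin n) ℝ).map
      (MvPolynomial.eval (fun ij : Fin n × Fin n => X ij.1 ij.2)) = X := by
  ext i j
  simp [Matrix.mvPolynomialX]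

end PolynomialFunctions


/-! ### The functions `E_{m,r}` -/

section Chops

variable {n : ℕ}

theorem E_map {R R' : Type*} [CommRing R] [CommRing R'] (φ : R →+* R') (m r : ℕ)
    (A : Matrix (Fin n) (Fin n) R) : E m r (A.map φ) = φ (E m r A) := by
  have h : chop r (A.map φ) = (Polynomial.mapRingHom φ).mapMatrix (chop r A) := by
    ext1 i j
    simp only [chop, Matrix.submatrix_apply, Matrix.sub_apply, Matrix.map_apply,
      RingHom.mapMatrix_apply, Matrix.scalar_apply, Matrix.diagonal_apply,
      Polynomial.coe_mapRingHom]
    split_ifs <;> simp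
  rw [E, h, ← RingHom.map_det, Polynomial.coe_mapRingHom, Polynomial.coeff_map, E]

theorem E_eq_evalAt (m r : ℕ) (X : Mat n) : E m r X = evalAt (EPoly n m r) X := by
  rw [evalAt, EPoly, ← E_map, map_eval_mvPolynomialX]

theorem E_eq_evalAt_fun (m r : ℕ) : (E m r : Mat n → ℝ) = evalAt (EPoly n m r) :=
  funext (E_eq_evalAt m r)

theorem E_differentiable (m r : ℕ) : Differentiable ℝ (E m r : Mat n → ℝ) := by
  rw [E_eq_evalAt_fun]; exact evalAt_differentiable _

theorem E_continuous (m r : ℕ) : Continuous (E m r : Mat n → ℝ) := (E_differentiable m r).continuous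

/-- The chop forgets the first `r` rows and the last `r` columns. This is what makes `τ_r` and the
projections of the coadjoint action invisible to `E_{m,r}`. -/
theorem E_congr {R : Type*} [CommRing R] (m : ℕ) {r : ℕ} {A B : Matrix (Fin n) (Fin n) R}
    (h : ∀ i j : Fin n, r ≤ i.1 → j.1 + r < n → A i j = B i j) : E m r A = E m r B := by
  have : chop r A = chop r B := by
    ext1 i j
    simp only [chop, Matrix.submatrix_apply, Matrix.sub_apply, Matrix.map_apply]
    rw [h _ _ (by simp) (by have := j.2; simp only; omega)]
  rw [E, E, this]

/-- The weight of the first `r` diagonal entries. -/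
noncomputable def loProd (r : ℕ) (p : Mat n) : ℝ := ∏ i : Fin n with i.1 < r, p i i

/-- The weight of the last `r` diagonal entries. -/
noncomputable def hiProd (r : ℕ) (p : Mat n) : ℝ := ∏ i : Fin n with n ≤ i.1 + r, p i i

/-- The matrices in the parabolic subalgebra `𝔭_r`. -/
def InParAlg (r : ℕ) (p : Mat n) : Prop := ∀ i j, ¬ InPar n r i j → p i j = 0

theorem UT.inParAlg {A : Mat n} (h : UT A) (r : ℕ) : InParAlg r A := fun i j hij => by
  simp only [InPar, not_not] at hij
  exact h i j hij.1

theorem InParAlg.inv {r : ℕ} {A : Mat n} (hA : InParAlg r A) (h : A.det ≠ 0) :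
    InParAlg r A⁻¹ := by
  have : Invertible A := A.invertibleOfIsUnitDet (isUnit_iff_ne_zero.2 h)
  exact (blockTriangular_iff n r _).1
    (Matrix.blockTriangular_inv_of_blockTriangular ((blockTriangular_iff n r _).2 hA))

/-- Outside the middle block the diagonal blocks of `𝔭_r` have size one, so diagonal entries
multiply there; hence `loProd` and `hiProd` are multiplicative. -/
theorem InParAlg.mul_apply_self {r : ℕ} {A B : Mat n} (hA : InParAlg r A) (hB : InParAlg r B)
    {i : Fin n} (hi : i.1 < r ∨ n ≤ i.1 + r) : (A * B) i i = A i i * B i i := by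
  rw [Matrix.mul_apply]
  refine Finset.sum_eq_single i (fun k _ hk => ?_) (fun h => absurd (Finset.mem_univ i) h)
  have hne : k.1 ≠ i.1 := fun h => hk (Fin.ext h)
  by_cases h1 : InPar n r i k
  · by_cases h2 : InPar n r k i
    · exfalso
      simp only [InPar, Fin.lt_def] at h1 h2
      omega
    · rw [hB k i h2, mul_zero]
  · rw [hA i k h1, zero_mul]

theorem loProd_mul {r : ℕ} {A B : Mat n} (hA : InParAlg r A) (hB : InParAlg r B) :
    loProd r (A * B) = loProd r A * loProd r B := by
  rw [loProd, loProd, loProd, ← Finset.prod_mul_distrib]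
  exact Finset.prod_congr rfl fun i hi => hA.mul_apply_self hB (Or.inl (Finset.mem_filter.1 hi).2)

theorem hiProd_mul {r : ℕ} {A B : Mat n} (hA : InParAlg r A) (hB : InParAlg r B) :
    hiProd r (A * B) = hiProd r A * hiProd r B := by
  rw [hiProd, hiProd, hiProd, ← Finset.prod_mul_distrib]
  exact Finset.prod_congr rfl fun i hi => hA.mul_apply_self hB (Or.inr (Finset.mem_filter.1 hi).2)

theorem loProd_one (r : ℕ) : loProd r (1 : Mat n) = 1 := by simp [loProd]

theorem hiProd_one (r : ℕ) : hiProd r (1 : Mat n) = 1 := by simp [hiProd]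

/-- The rows of the `r`-chop. -/
def rowIx (n r : ℕ) (i : Fin (n - r)) : Fin n := ⟨r + i.1, by have := i.2; omega⟩

/-- The columns of the `r`-chop. -/
def colIx (n r : ℕ) (j : Fin (n - r)) : Fin n := ⟨j.1, by have := j.2; omega⟩

theorem rowIx_injective (n r : ℕ) : Function.Injective (rowIx n r) := fun i j h => by
  have := Fin.ext_iff.1 h
  simp only [rowIx] at this
  exact Fin.ext (by omega)

theorem colIx_injective (n r : ℕ) : Function.Injective (colIx n r) := fun i j h => by
  have := Fin.ext_iff.1 h
  simp only [colIx] at this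
  exact Fin.ext (by omega)

theorem mem_range_rowIx {r : ℕ} {k : Fin n} : k ∈ Set.range (rowIx n r) ↔ r ≤ k.1 := by
  constructor
  · rintro ⟨i, rfl⟩; simp [rowIx]
  · intro h
    exact ⟨⟨k.1 - r, by have := k.2; omega⟩, Fin.ext (by simp only [rowIx]; omega)⟩

theorem mem_range_colIx {r : ℕ} {k : Fin n} : k ∈ Set.range (colIx n r) ↔ k.1 + r < n := by
  constructor
  · rintro ⟨i, rfl⟩; have := i.2; simp only [colIx]; omega
  · intro h
    exact ⟨⟨k.1, by omega⟩, rfl⟩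

/-- When the selected rows of `A` are supported on the selected indices, the inner sum can be
restricted to them. -/
theorem submatrix_mul_left {R α β γ : Type*} [CommRing R] [Fintype α] [Fintype β]
    {A B : Matrix β β R} {e : α → β} (he : Function.Injective e) (f : γ → β)
    (h : ∀ i, ∀ k ∉ Set.range e, A (e i) k = 0) :
    (A * B).submatrix e f = A.submatrix e e * B.submatrix e f := by
  ext i j
  simp only [Matrix.submatrix_apply, Matrix.mul_apply]
  exact (Fintype.sum_of_injective e he _ _ (fun k hk => by rw [h i k hk, zero_mul])
    (fun _ => rfl)).symm

theorem submatrix_mul_right {R α β γ : Type*} [CommRing R] [Fintype α] [Fintype β]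
    {A B : Matrix β β R} {e : α → β} (he : Function.Injective e) (f : γ → β)
    (h : ∀ j, ∀ k ∉ Set.range e, B k (e j) = 0) :
    (A * B).submatrix f e = A.submatrix f e * B.submatrix e e := by
  ext i j
  simp only [Matrix.submatrix_apply, Matrix.mul_apply]
  exact (Fintype.sum_of_injective e he _ _ (fun k hk => by rw [h j k hk, mul_zero])
    (fun _ => rfl)).symm

theorem inParAlg_row {r : ℕ} {p : Mat n} (hp : InParAlg r p) (i : Fin (n - r)) (k : Fin n)
    (hk : k ∉ Set.range (rowIx n r)) : p (rowIx n r i) k = 0 := by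
  rw [mem_range_rowIx] at hk
  refine hp _ _ ?_
  simp only [InPar, rowIx, Fin.lt_def]
  omega

theorem inParAlg_col {r : ℕ} {p : Mat n} (hp : InParAlg r p) (j : Fin (n - r)) (k : Fin n)
    (hk : k ∉ Set.range (colIx n r)) : p k (colIx n r j) = 0 := by
  rw [mem_range_colIx] at hk
  refine hp _ _ ?_
  have := j.2
  simp only [InPar, colIx, Fin.lt_def]
  omega

/-- Split the indices at `n - r`: `p` is block triangular and its last diagonal block is itself
triangular. Together with the splitting at `r` in `det_eq_loProd_row` this compares the determinants
of the column block and of the row block, which overlap but differ. -/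
theorem det_eq_col_hiProd {r : ℕ} {p : Mat n} (hp : InParAlg r p) :
    p.det = (p.submatrix (colIx n r) (colIx n r)).det * hiProd r p := by
  classical
  rw [Matrix.twoBlockTriangular_det p (fun i => i.1 + r < n) fun i hi j hj =>
    hp i j (by simp only [InPar, Fin.lt_def]; omega)]
  congr 1
  · let e : Fin (n - r) ≃ {i : Fin n // i.1 + r < n} :=
      Equiv.ofBijective (fun k => ⟨colIx n r k, mem_range_colIx.1 ⟨k, rfl⟩⟩)
        ⟨fun a b h => colIx_injective n r (Subtype.ext_iff.1 h), fun ⟨k, hk⟩ => by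
          obtain ⟨i, hi⟩ := mem_range_colIx.2 hk
          exact ⟨i, Subtype.ext hi⟩⟩
    rw [← Matrix.det_submatrix_equiv_self e]
    rfl
  · rw [Matrix.det_of_isUpperTriangular]
    · rw [hiProd]
      refine (Finset.prod_subtype _ (p := fun i : Fin n => ¬ i.1 + r < n) (fun i => ?_)
        (fun i => p i i)).symm
      simp
    · intro i j hij
      have hi := i.2
      refine hp _ _ ?_
      have : j.1.1 < i.1.1 := hij
      simp only [InPar, Fin.lt_def]
      omega

theorem det_eq_loProd_row {r : ℕ} {p : Mat n} (hp : InParAlg r p) :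
    p.det = loProd r p * (p.submatrix (rowIx n r) (rowIx n r)).det := by
  classical
  rw [Matrix.twoBlockTriangular_det p (fun i => i.1 < r) fun i hi j hj =>
    hp i j (by simp only [InPar, Fin.lt_def]; omega)]
  congr 1
  · rw [Matrix.det_of_isUpperTriangular]
    · rw [loProd]
      refine (Finset.prod_subtype _ (p := fun i : Fin n => i.1 < r) (fun i => ?_)
        (fun i => p i i)).symm
      simp
    · intro i j hij
      have hi := i.2
      refine hp _ _ ?_
      have : j.1.1 < i.1.1 := hij
      simp only [InPar, Fin.lt_def]
      omega
  · let e : Fin (n - r) ≃ {i : Fin n // ¬ i.1 < r} :=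
      Equiv.ofBijective (fun k => ⟨rowIx n r k, not_lt.2 (mem_range_rowIx.1 ⟨k, rfl⟩)⟩)
        ⟨fun a b h => rowIx_injective n r (Subtype.ext_iff.1 h), fun ⟨k, hk⟩ => by
          obtain ⟨i, hi⟩ := mem_range_rowIx.2 (not_lt.1 hk)
          exact ⟨i, Subtype.ext hi⟩⟩
    rw [← Matrix.det_submatrix_equiv_self e]
    rfl

theorem hiProd_ne_zero {r : ℕ} {p : Mat n} (hp : InParAlg r p) (hdet : p.det ≠ 0) :
    hiProd r p ≠ 0 := fun h => hdet (by rw [det_eq_col_hiProd hp, h, mul_zero])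

theorem loProd_ne_zero {r : ℕ} {p : Mat n} (hp : InParAlg r p) (hdet : p.det ≠ 0) :
    loProd r p ≠ 0 := fun h => hdet (by rw [det_eq_loProd_row hp, h, zero_mul])

/-- The functions `E_{m,r}` are semi-invariant under conjugation by `P_r`. -/
theorem E_conj {r : ℕ} (m : ℕ) {p : Mat n} (hp : InParAlg r p) (hdet : p.det ≠ 0) (X : Mat n) :
    E m r (p⁻¹ * X * p) = loProd r p / hiProd r p * E m r X := by
  have hq := hp.inv hdet
  have hu : IsUnit p.det := isUnit_iff_ne_zero.2 hdet
  set c : ℝ →+* Polynomial ℝ := Polynomial.C with hc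
  have hconj : (p⁻¹ * X * p).map c - Matrix.scalar (Fin n) (Polynomial.X : Polynomial ℝ) =
      p⁻¹.map c * ((X.map c - Matrix.scalar (Fin n) (Polynomial.X : Polynomial ℝ)) * p.map c) := by
    have h1 : p⁻¹.map c * p.map c = 1 := by
      rw [← Matrix.map_mul, Matrix.nonsing_inv_mul _ hu]; simp
    rw [Matrix.sub_mul, Matrix.mul_sub, Matrix.scalar_apply, ← Matrix.smul_eq_diagonal_mul,
      Matrix.mul_smul, h1, Matrix.map_mul, Matrix.map_mul, Matrix.mul_assoc,
      Matrix.smul_one_eq_diagonal]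
  -- Rows `≥ r` of `p⁻¹` and columns `< n - r` of `p` are supported on those same indices, so
  -- removing rows and columns commutes with the outer multiplications.
  have hchop : chop r (p⁻¹ * X * p) = (p⁻¹.submatrix (rowIx n r) (rowIx n r)).map c * chop r X *
      (p.submatrix (colIx n r) (colIx n r)).map c := by
    change ((p⁻¹ * X * p).map c -
      Matrix.scalar (Fin n) (Polynomial.X : Polynomial ℝ)).submatrix (rowIx n r) (colIx n r) = _
    rw [hconj, submatrix_mul_left (rowIx_injective n r), submatrix_mul_right (colIx_injective n r),
      ← Matrix.mul_assoc]
    · rfl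
    · intro j k hk
      rw [Matrix.map_apply, inParAlg_col hp j k hk, map_zero]
    · intro i k hk
      rw [Matrix.map_apply, inParAlg_row hq i k hk, map_zero]
  have hone : (p⁻¹.submatrix (rowIx n r) (rowIx n r)).det *
      (p.submatrix (rowIx n r) (rowIx n r)).det = 1 := by
    rw [← Matrix.det_mul, ← submatrix_mul_left (rowIx_injective n r) _ (inParAlg_row hq),
      Matrix.nonsing_inv_mul _ hu, Matrix.submatrix_one _ (rowIx_injective n r), Matrix.det_one]
  have hdets : (p.submatrix (colIx n r) (colIx n r)).det * hiProd r p =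
      loProd r p * (p.submatrix (rowIx n r) (rowIx n r)).det := by
    rw [← det_eq_col_hiProd hp, ← det_eq_loProd_row hp]
  have hhi := hiProd_ne_zero hp hdet
  have hval : E m r (p⁻¹ * X * p) = (p⁻¹.submatrix (rowIx n r) (rowIx n r)).det * E m r X *
      (p.submatrix (colIx n r) (colIx n r)).det := by
    rw [E, hchop, Matrix.det_mul, Matrix.det_mul]
    have e1 : ∀ M : Matrix (Fin (n - r)) (Fin (n - r)) ℝ, (M.map c).det = Polynomial.C M.det :=
      fun M => (RingHom.map_det c M).symm
    rw [e1, e1, Polynomial.coeff_mul_C, Polynomial.coeff_C_mul, E]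
  rw [hval]
  set u := (p⁻¹.submatrix (rowIx n r) (rowIx n r)).det
  set v := (p.submatrix (rowIx n r) (rowIx n r)).det
  set w := (p.submatrix (colIx n r) (colIx n r)).det
  field_simp
  calc u * E m r X * w * hiProd r p = u * E m r X * (w * hiProd r p) := by ring
    _ = E m r X * loProd r p * (u * v) := by rw [hdets]; ring
    _ = E m r X * loProd r p := by rw [hone]; ring

theorem hasDerivAt_prod_one_add (s : Finset (Fin n)) (Y : Mat n) :
    HasDerivAt (fun t : ℝ => ∏ i ∈ s, (1 + t • Y) i i) (∑ i ∈ s, Y i i) 0 := by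
  classical
  have h := HasDerivAt.finsetProd (u := s) (x := (0 : ℝ))
    (f := fun i (t : ℝ) => (1 + t • Y) i i) (f' := fun i => Y i i)
    (fun i _ => hasDerivAt_matrix.1 (hasDerivAt_one_add_smul Y 0) i i)
  refine hasDerivAt_congr h (fun t => by simp) ?_
  simp

theorem eventually_det_ne_zero (Y : Mat n) : ∀ᶠ t : ℝ in nhds 0, (1 + t • Y).det ≠ 0 := by
  have hc : Continuous fun t : ℝ => (1 + t • Y).det :=
    Continuous.matrix_det (continuous_const.add (continuous_id.smul continuous_const))
  exact hc.continuousAt.eventually_ne (by simp)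

/-- The infinitesimal form of the semi-invariance of `E_{m,r}`. -/
theorem fderiv_E_comm {r : ℕ} (m : ℕ) {Y : Mat n} (hY : InParAlg r Y) (X : Mat n) :
    fderiv ℝ (E m r : Mat n → ℝ) X (X * Y - Y * X) =
      ((∑ i : Fin n with i.1 < r, Y i i) - ∑ i : Fin n with n ≤ i.1 + r, Y i i) * E m r X := by
  have hZ := hasDerivAt_matrix_conj X (hasDerivAt_one_add_smul Y 0) (by simp)
  have hZ0 : (fun s : ℝ => (1 + s • Y)⁻¹ * X * (1 + s • Y)) 0 = X := by simp
  have hE : HasFDerivAt (E m r : Mat n → ℝ) (fderiv ℝ (E m r : Mat n → ℝ) X)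
      ((fun s : ℝ => (1 + s • Y)⁻¹ * X * (1 + s • Y)) 0) := by
    rw [hZ0]; exact (E_differentiable m r X).hasFDerivAt
  have hF := hE.comp_hasDerivAt (0 : ℝ) hZ
  have hL := hF.mul (hasDerivAt_prod_one_add (Finset.univ.filter fun i : Fin n => n ≤ i.1 + r) Y)
  have hR := (hasDerivAt_prod_one_add (Finset.univ.filter fun i : Fin n => i.1 < r) Y).mul_const
    (E m r X)
  have hpar : ∀ t : ℝ, InParAlg r (1 + t • Y) := fun t i j hij => by
    have : (1 : Mat n) i j = 0 := (UT.one.inParAlg r) i j hij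
    rw [Matrix.add_apply, this, Matrix.smul_apply, hY i j hij]; simp
  -- Semi-invariance along `p = 1 + tY`, cleared of its denominator `hiProd`; both sides are then
  -- differentiated at `t = 0`.
  have hev : (fun t : ℝ => (∏ i ∈ Finset.univ.filter fun i : Fin n => i.1 < r, (1 + t • Y) i i) *
        E m r X) =ᶠ[nhds 0]
      ((fun t : ℝ => E m r ((1 + t • Y)⁻¹ * X * (1 + t • Y))) *
        fun t : ℝ => ∏ i ∈ Finset.univ.filter fun i : Fin n => n ≤ i.1 + r, (1 + t • Y) i i) := by
    filter_upwards [eventually_det_ne_zero Y] with t ht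
    have h1 := E_conj m (hpar t) ht X
    have h2 := hiProd_ne_zero (hpar t) ht
    rw [Pi.mul_apply, h1]
    rw [loProd, hiProd] at *
    field_simp
  have huniq := (hL.congr_of_eventuallyEq hev).unique hR
  simp only [zero_smul, add_zero, inv_one, Matrix.one_mul, Function.comp,
    Matrix.one_apply_eq, Finset.prod_const_one, mul_one] at huniq
  rw [sub_mul, mul_comm (∑ i : Fin n with n ≤ i.1 + r, Y i i)]
  exact eq_sub_of_add_eq huniq

end Chops

/-! ### Schur complements -/

section Schur

variable {n r : ℕ}

/-- The first `r` indices. -/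
def loIx (h : 2 * r ≤ n) (k : Fin r) : Fin n := ⟨k.1, by have := k.2; omega⟩

/-- The indices in the middle block. -/
def midIx (h : 2 * r ≤ n) (k : Fin (n - 2 * r)) : Fin n := ⟨r + k.1, by have := k.2; omega⟩

/-- The last `r` indices. -/
def hiIx (h : 2 * r ≤ n) (k : Fin r) : Fin n := ⟨n - r + k.1, by have := k.2; omega⟩

/-- The lower left `r × r` block. -/
def corner (h : 2 * r ≤ n) (X : Mat n) : Matrix (Fin r) (Fin r) ℝ :=
  X.submatrix (hiIx h) (loIx h)

/-- The Schur complement of the lower left block in the chop. -/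
noncomputable def schur (h : 2 * r ≤ n) (X : Mat n) :
    Matrix (Fin (n - 2 * r)) (Fin (n - 2 * r)) ℝ :=
  X.submatrix (midIx h) (midIx h) -
    X.submatrix (midIx h) (loIx h) * (corner h X)⁻¹ * X.submatrix (hiIx h) (midIx h)

/-- Moving the first `r` columns of the chop behind the middle ones puts the corner in the last
diagonal block and confines the indeterminate to the middle block. The permutation depends only on
`n` and `r`, so a single sign serves all `X`. -/
theorem exists_sign_det_chop (h : 2 * r ≤ n) : ∃ s : ℤˣ, ∀ X : Mat n,
    (chop r X).det = ((s : ℤ) : Polynomial ℝ) * (Matrix.fromBlocks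
      ((X.submatrix (midIx h) (midIx h)).map Polynomial.C -
        Matrix.scalar _ (Polynomial.X : Polynomial ℝ))
      ((X.submatrix (midIx h) (loIx h)).map Polynomial.C)
      ((X.submatrix (hiIx h) (midIx h)).map Polynomial.C)
      ((corner h X).map Polynomial.C)).det := by
  classical
  let eR : Fin (n - 2 * r) ⊕ Fin r ≃ Fin (n - r) := Equiv.ofBijective
    (Sum.elim (fun k => ⟨k.1, by have := k.2; omega⟩)
      (fun k => ⟨n - 2 * r + k.1, by have := k.2; omega⟩)) (by
    rw [Fintype.bijective_iff_injective_and_card]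
    constructor
    · rintro (a | a) (b | b) hab
      all_goals
        have ha := a.2
        have hb := b.2
        simp only [Sum.elim_inl, Sum.elim_inr, Fin.mk.injEq] at hab
      · exact congrArg Sum.inl (Fin.ext hab)
      · omega
      · omega
      · exact congrArg Sum.inr (Fin.ext (by omega))
    · simp only [Fintype.card_sum, Fintype.card_fin]; omega)
  let eC : Fin (n - 2 * r) ⊕ Fin r ≃ Fin (n - r) := Equiv.ofBijective
    (Sum.elim (fun k => ⟨r + k.1, by have := k.2; omega⟩)
      (fun k => ⟨k.1, by have := k.2; omega⟩)) (by
    rw [Fintype.bijective_iff_injective_and_card]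
    constructor
    · rintro (a | a) (b | b) hab
      all_goals
        have ha := a.2
        have hb := b.2
        simp only [Sum.elim_inl, Sum.elim_inr, Fin.mk.injEq] at hab
      · exact congrArg Sum.inl (Fin.ext (by omega))
      · omega
      · omega
      · exact congrArg Sum.inr (Fin.ext hab)
    · simp only [Fintype.card_sum, Fintype.card_fin]; omega)
  let σ : Equiv.Perm (Fin (n - r)) := eR.symm.trans eC
  refine ⟨Equiv.Perm.sign σ, fun X => ?_⟩
  have hblocks : Matrix.fromBlocks
      ((X.submatrix (midIx h) (midIx h)).map Polynomial.C -
        Matrix.scalar _ (Polynomial.X : Polynomial ℝ))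
      ((X.submatrix (midIx h) (loIx h)).map Polynomial.C)
      ((X.submatrix (hiIx h) (midIx h)).map Polynomial.C)
      ((corner h X).map Polynomial.C) = ((chop r X).submatrix id σ).submatrix eR eR := by
    have hσ : ∀ x, σ (eR x) = eC x := fun x => by simp [σ]
    have hR1 : ∀ a : Fin (n - 2 * r), rowIx n r (eR (Sum.inl a)) = midIx h a := fun a => rfl
    have hR2 : ∀ a : Fin r, rowIx n r (eR (Sum.inr a)) = hiIx h a := fun a => by
      refine Fin.ext ?_
      change r + (n - 2 * r + a.1) = n - r + a.1
      omega
    have hC1 : ∀ a : Fin (n - 2 * r), colIx n r (eC (Sum.inl a)) = midIx h a := fun a => rfl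
    have hC2 : ∀ a : Fin r, colIx n r (eC (Sum.inr a)) = loIx h a := fun a => rfl
    have hchop : ∀ a b, ((chop r X).submatrix id σ).submatrix eR eR a b =
        (X.map Polynomial.C - Matrix.scalar (Fin n) (Polynomial.X : Polynomial ℝ))
          (rowIx n r (eR a)) (colIx n r (eC b)) := fun a b => by
      rw [← hσ]; rfl
    ext1 a b
    rw [hchop]
    rcases a with a | a <;> rcases b with b | b
    · rw [hR1, hC1, Matrix.fromBlocks_apply₁₁]
      simp only [Matrix.sub_apply, Matrix.map_apply, Matrix.submatrix_apply, Matrix.scalar_apply,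
        Matrix.diagonal_apply]
      have : midIx h a = midIx h b ↔ a = b :=
        ⟨fun hh => Fin.ext (by have := Fin.ext_iff.1 hh; simp only [midIx] at this; omega),
          fun hh => by rw [hh]⟩
      simp only [this]
    · rw [hR1, hC2, Matrix.fromBlocks_apply₁₂]
      simp only [Matrix.sub_apply, Matrix.map_apply, Matrix.submatrix_apply, Matrix.scalar_apply]
      rw [Matrix.diagonal_apply_ne, sub_zero]
      intro hh
      have h1 := Fin.ext_iff.1 hh
      have := b.2
      simp only [midIx, loIx] at h1
      omega
    · rw [hR2, hC1, Matrix.fromBlocks_apply₂₁]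
      simp only [Matrix.sub_apply, Matrix.map_apply, Matrix.submatrix_apply, Matrix.scalar_apply]
      rw [Matrix.diagonal_apply_ne, sub_zero]
      intro hh
      have h1 := Fin.ext_iff.1 hh
      have := b.2
      simp only [midIx, hiIx] at h1
      omega
    · rw [hR2, hC2, Matrix.fromBlocks_apply₂₂]
      simp only [corner, Matrix.sub_apply, Matrix.map_apply, Matrix.submatrix_apply,
        Matrix.scalar_apply]
      rw [Matrix.diagonal_apply_ne, sub_zero]
      intro hh
      have h1 := Fin.ext_iff.1 hh
      have := b.2
      simp only [loIx, hiIx] at h1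
      omega
  rw [hblocks, Matrix.det_submatrix_equiv_self, Matrix.det_permute', ← mul_assoc]
  have : ((Equiv.Perm.sign σ : ℤ) : Polynomial ℝ) * ((Equiv.Perm.sign σ : ℤ) : Polynomial ℝ) = 1 :=
      by
    rw [← Int.cast_mul, ← Units.val_mul, Int.units_mul_self]; simp
  rw [this, one_mul]

/-- The Schur complement formula with respect to the corner, a constant matrix: what remains is
`schur h X - η`, whose determinant is the characteristic polynomial up to sign. -/
theorem exists_E_eq_of_corner (h : 2 * r ≤ n) : ∃ s : ℝ, s ≠ 0 ∧ ∀ X : Mat n,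
    (corner h X).det ≠ 0 → ∀ m, E m r X =
      s * (corner h X).det * (schur h X).charpoly.coeff (n - 2 * r - m) := by
  obtain ⟨s, hs⟩ := exists_sign_det_chop h
  refine ⟨(s : ℤ) * (-1) ^ (n - 2 * r), ?_, fun X hX m => ?_⟩
  · rcases Int.units_eq_one_or s with h1 | h1 <;> simp [h1]
  have hu : IsUnit (corner h X).det := isUnit_iff_ne_zero.2 hX
  let c : ℝ →+* Polynomial ℝ := Polynomial.C
  have hinv : (corner h X).map Polynomial.C * (corner h X)⁻¹.map Polynomial.C = 1 := by
    rw [← Matrix.map_mul, Matrix.mul_nonsing_inv _ hu]; simp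
  have hinv' : (corner h X)⁻¹.map Polynomial.C * (corner h X).map Polynomial.C = 1 := by
    rw [← Matrix.map_mul, Matrix.nonsing_inv_mul _ hu]; simp
  let iD : Invertible ((corner h X).map Polynomial.C) := ⟨_, hinv', hinv⟩
  have hdet : (chop r X).det = Polynomial.C ((s : ℤ) * (-1) ^ (n - 2 * r) * (corner h X).det) *
      (schur h X).charpoly := by
    rw [hs, Matrix.det_fromBlocks₂₂]
    have e1 : ((corner h X).map Polynomial.C).det = Polynomial.C (corner h X).det :=
      (RingHom.map_det c _).symm
    have e2 : (X.submatrix (midIx h) (midIx h)).map Polynomial.C -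
        Matrix.scalar _ (Polynomial.X : Polynomial ℝ) -
        (X.submatrix (midIx h) (loIx h)).map Polynomial.C * ⅟((corner h X).map Polynomial.C) *
          (X.submatrix (hiIx h) (midIx h)).map Polynomial.C = - (schur h X).charmatrix := by
      rw [invOf_eq_left_inv hinv', ← Matrix.map_mul, ← Matrix.map_mul, Matrix.charmatrix, schur]
      ext1 i j
      simp only [Matrix.sub_apply, Matrix.neg_apply, Matrix.map_apply, RingHom.mapMatrix_apply,
        map_sub]
      ring
    rw [e1, e2, Matrix.det_neg, Matrix.charpoly]
    simp only [Fintype.card_fin, map_mul, map_pow, map_neg, map_one, map_intCast]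
    ring
  rw [E, hdet, Polynomial.coeff_C_mul]

theorem coeff_charpoly_top {N : ℕ} (A : Matrix (Fin N) (Fin N) ℝ) : A.charpoly.coeff N = 1 := by
  have h1 := A.charpoly_monic.coeff_natDegree
  rwa [A.charpoly_natDegree_eq_dim, Fintype.card_fin] at h1

/-- `E_{0,r}` is a multiple of the lower left minor. -/
theorem exists_E_eq (h : 2 * r ≤ n) : ∃ s : ℝ, s ≠ 0 ∧
    (∀ X : Mat n, E 0 r X = s * (corner h X).det) ∧
    ∀ X : Mat n, (corner h X).det ≠ 0 → ∀ m, E m r X =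
      s * (corner h X).det * (schur h X).charpoly.coeff (n - 2 * r - m) := by
  obtain ⟨s, hs0, hs⟩ := exists_E_eq_of_corner h
  refine ⟨s, hs0, ?_, hs⟩
  let Q : MvPolynomial (Fin n × Fin n) ℝ :=
    ((Matrix.mvPolynomialX (Fin n) (Fin n) ℝ).submatrix (hiIx h) (loIx h)).det
  have hQ : ∀ X : Mat n, evalAt Q X = (corner h X).det := fun X => by
    rw [evalAt, RingHom.map_det]
    congr 1
    ext i j
    simp [corner, Matrix.mvPolynomialX]
  have hne : Q ≠ 0 := by
    intro h0
    let X : Mat n := Matrix.of fun i j => if i.1 = n - r + j.1 then 1 else 0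
    have h1 := hQ X
    have h2 : corner h X = 1 := by
      ext i j
      simp only [corner, X, Matrix.submatrix_apply, Matrix.of_apply, hiIx, loIx, Matrix.one_apply,
        Fin.ext_iff]
      congr 1
      simp
    rw [h0, h2, Matrix.det_one] at h1
    simp [evalAt] at h1
  -- After multiplication by `Q` the identity also holds at singular corners, where both sides
  -- vanish; elsewhere it follows from the leading coefficient `1` of the characteristic polynomial.
  -- Cancelling `Q` in the polynomial ring extends the formula to all matrices.
  have key : EPoly n 0 r * Q = MvPolynomial.C s * Q * Q := by
    refine MvPolynomial.funext fun x => ?_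
    have h1 : ∀ f : MvPolynomial (Fin n × Fin n) ℝ, MvPolynomial.eval x f =
        evalAt f (Matrix.of fun i j => x (i, j)) := fun f => by simp [evalAt]
    rw [h1, h1, evalAt_mul, evalAt_mul, evalAt_mul, evalAt_C, hQ, ← E_eq_evalAt]
    by_cases hc : (corner h (Matrix.of fun i j => x (i, j))).det = 0
    · rw [hc]; simp
    · rw [hs _ hc 0, Nat.sub_zero, coeff_charpoly_top]
      ring
  have key' := mul_right_cancel₀ hne key
  intro X
  rw [E_eq_evalAt, key', ← hQ, evalAt_mul, evalAt_C]

theorem corner_det_ne_zero (h : 2 * r ≤ n) {X : Mat n} (hX : E 0 r X ≠ 0) :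
    (corner h X).det ≠ 0 := by
  obtain ⟨s, hs0, hs, -⟩ := exists_E_eq h
  intro h0
  exact hX (by rw [hs, h0, mul_zero])

theorem I_eq_coeff (h : 2 * r ≤ n) {X : Mat n} (hX : E 0 r X ≠ 0) (m : ℕ) :
    I m r X = (schur h X).charpoly.coeff (n - 2 * r - m) := by
  obtain ⟨s, hs0, hs, hs'⟩ := exists_E_eq h
  have hc := corner_det_ne_zero h hX
  rw [I, hs, hs' X hc]
  field_simp

theorem I_one_eq (h : 2 * r < n) {X : Mat n} (hX : E 0 r X ≠ 0) :
    I 1 r X = - (schur h.le X).trace := by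
  have : Nonempty (Fin (n - 2 * r)) := ⟨⟨0, by omega⟩⟩
  rw [I_eq_coeff h.le hX, Matrix.trace_eq_neg_charpoly_coeff, Fintype.card_fin, neg_neg]

/-- `E_{0,r}` only depends on the lower left corner. -/
theorem E_zero_congr (h : 2 * r ≤ n) {X Y : Mat n}
    (hXY : ∀ i j : Fin n, n ≤ i.1 + r → j.1 < r → X i j = Y i j) : E 0 r X = E 0 r Y := by
  obtain ⟨s, hs0, hs, -⟩ := exists_E_eq h
  rw [hs, hs]
  congr 2
  ext i j
  exact hXY _ _ (by simp only [hiIx]; omega) (by simp [loIx])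

theorem E_zero_congr_low (h : 2 * r ≤ n) {X Y : Mat n}
    (hXY : ∀ i j : Fin n, j ≤ i → X i j = Y i j) : E 0 r X = E 0 r Y :=
  E_zero_congr h fun i j hi hj => hXY i j (Fin.le_def.2 (by omega))

/-- `I_{1,r}` only depends on the entries on and below the diagonal. -/
theorem I_one_congr_low (h : 2 * r < n) {X Y : Mat n} (hX : E 0 r X ≠ 0)
    (hXY : ∀ i j : Fin n, j ≤ i → X i j = Y i j) : I 1 r X = I 1 r Y := by
  have hY : E 0 r Y ≠ 0 := by rwa [← E_zero_congr_low h.le hXY]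
  rw [I_one_eq h hX, I_one_eq h hY, schur, schur, Matrix.trace_sub, Matrix.trace_sub]
  have e1 : corner h.le X = corner h.le Y := by
    ext i j
    exact hXY _ _ (Fin.le_def.2 (by simp only [hiIx, loIx]; omega))
  have e2 : X.submatrix (midIx h.le) (loIx h.le) = Y.submatrix (midIx h.le) (loIx h.le) := by
    ext i j
    exact hXY _ _ (Fin.le_def.2 (by simp only [midIx, loIx]; omega))
  have e3 : X.submatrix (hiIx h.le) (midIx h.le) = Y.submatrix (hiIx h.le) (midIx h.le) := by
    ext i j
    exact hXY _ _ (Fin.le_def.2 (by simp only [hiIx, midIx]; omega))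
  have e4 : (X.submatrix (midIx h.le) (midIx h.le)).trace =
      (Y.submatrix (midIx h.le) (midIx h.le)).trace :=
    Finset.sum_congr rfl fun i _ => hXY _ _ le_rfl
  rw [e1, e2, e3, e4]

end Schur


/-! ### Coadjoint actions and semi-invariants -/

section Coadjoint

variable {n : ℕ}

theorem gl_det_ne_zero (p : GL (Fin n) ℝ) : (p : Mat n).det ≠ 0 :=
  (Matrix.isUnit_iff_isUnit_det _).1 p.isUnit |>.ne_zero

theorem tau_eq_zero {r : ℕ} {i j : Fin n} (h : InPar n r j i) : tau n r i j = 0 := by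
  simp only [tau, Matrix.of_apply]
  rw [if_neg]
  exact fun h' => h'.2 h

/-- At the positions kept by the chop `τ_r` vanishes and the projection to the transpose of `𝔭_r` is
the identity, so the coadjoint action is seen there as conjugation. -/
theorem E_coad {r : ℕ} (m : ℕ) {p : GL (Fin n) ℝ} (hp : InParAlg r (p : Mat n)) (X : Mat n) :
    E m r (coad (InPar n r) (tau n r) p X) =
      loProd r (p : Mat n) / hiProd r (p : Mat n) * E m r X := by
  have hpar : ∀ i j : Fin n, r ≤ i.1 → j.1 + r < n → InPar n r j i := fun i j hi hj => by
    simp only [InPar]; omega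
  have h1 : E m r X = E m r (X - tau n r) := E_congr m fun i j hi hj => by
    rw [Matrix.sub_apply, tau_eq_zero (hpar i j hi hj), sub_zero]
  rw [h1, ← E_conj m hp (gl_det_ne_zero p)]
  refine E_congr m fun i j hi hj => ?_
  rw [coad, Matrix.add_apply, tau_eq_zero (hpar i j hi hj), zero_add,
    entryProj_of (S := fun i j => InPar n r j i) (hpar i j hi hj), Matrix.coe_units_inv]

/-- The character `χ_r` of `P_r`. -/
noncomputable def parChar (n r : ℕ) : P n r →* ℝˣ :=
  MonoidHom.toHomUnits
    { toFun := fun p => loProd r ((p : GL (Fin n) ℝ) : Mat n) / hiProd r ((p : GL (Fin n) ℝ) : Mat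
      n)
      map_one' := by simp [loProd_one, hiProd_one]
      map_mul' := fun p q => by
        simp only [Subgroup.coe_mul, Units.val_mul]
        rw [loProd_mul p.2 q.2, hiProd_mul p.2 q.2, mul_div_mul_comm] }

theorem parChar_apply (n r : ℕ) (p : P n r) : ((parChar n r p : ℝˣ) : ℝ) =
    loProd r ((p : GL (Fin n) ℝ) : Mat n) / hiProd r ((p : GL (Fin n) ℝ) : Mat n) := rfl

theorem isSemiInvariant_E (r m : ℕ) : IsSemiInvariant r (E m r : Mat n → ℝ) (parChar n r) :=
  fun p X _ => by rw [E_coad m p.2, parChar_apply]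

theorem E_zero_index_conj (m : ℕ) (g : GL (Fin n) ℝ) (X : Mat n) :
    E m 0 ((g : Mat n) * X * ((g⁻¹ : GL (Fin n) ℝ) : Mat n)) = E m 0 X := by
  have h := E_conj (r := 0) m (p := ((g⁻¹ : GL (Fin n) ℝ) : Mat n))
    (fun i j h => by simp only [InPar] at h; omega) (gl_det_ne_zero _) X
  rw [← Matrix.coe_units_inv, inv_inv] at h
  rw [h]
  have h1 : loProd 0 ((g⁻¹ : GL (Fin n) ℝ) : Mat n) = 1 := by simp [loProd]
  have h2 : hiProd 0 ((g⁻¹ : GL (Fin n) ℝ) : Mat n) = 1 := by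
    rw [hiProd]
    refine Finset.prod_eq_one fun i hi => ?_
    have h1 := (Finset.mem_filter.1 hi).2
    have h2 := i.2
    omega
  rw [h1, h2]; simp

/-- Since `2 r ≤ n` the corner lies strictly below the diagonal, so the projection to `𝔫₋` does not
touch it, and the weight of a unipotent matrix is `1`. -/
theorem E_zero_coad_strict {r : ℕ} (h : 2 * r ≤ n) {u : GL (Fin n) ℝ} (hu : IsUnipotentUpper u)
    (L : Mat n) : E 0 r (coad (· < ·) 0 u L) = E 0 r L := by
  have hut : UT (u : Mat n) := hu.1
  have h1 : E 0 r (coad (· < ·) 0 u L) = E 0 r ((u : Mat n)⁻¹ * L * (u : Mat n)) :=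
    E_zero_congr h fun i j hi hj => by
      rw [coad, zero_add, sub_zero,
        entryProj_of (S := fun i j : Fin n => j < i) (Fin.lt_def.2 (by omega)),
        Matrix.coe_units_inv]
  rw [h1, E_conj 0 (hut.inParAlg r) (gl_det_ne_zero u)]
  have h2 : loProd r (u : Mat n) = 1 := Finset.prod_eq_one fun i _ => hu.2 i
  have h3 : hiProd r (u : Mat n) = 1 := Finset.prod_eq_one fun i _ => hu.2 i
  rw [h2, h3]; simp

theorem hess_subset_dualPar (r : ℕ) {X : Mat n} (hX : X ∈ hess n) : X ∈ dualPar n r := by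
  intro i j hij
  have hlt : i < j := by
    simp only [InPar, not_not] at hij; exact hij.1
  rw [hX i j hlt, eps, tau, Matrix.of_apply, Matrix.of_apply]
  simp [hij]

/-- The polynomials are the values of `E` at the generic point of `τ_r + 𝔭_{r-}`, with variables in
the free positions and constants elsewhere. -/
theorem exists_polynomials_on_dualPar (m r : ℕ)
    (hne : ∃ X ∈ dualPar n r, E 0 r X ≠ 0) :
    ∃ p q : MvPolynomial {ij : Fin n × Fin n // InPar n r ij.2 ij.1} ℝ, q ≠ 0 ∧
      ∀ X ∈ dualPar n r,
        E m r X = MvPolynomial.eval (fun ij => X ij.1.1 ij.1.2) p ∧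
        E 0 r X = MvPolynomial.eval (fun ij => X ij.1.1 ij.1.2) q := by
  classical
  let M : Matrix (Fin n) (Fin n) (MvPolynomial {ij : Fin n × Fin n // InPar n r ij.2 ij.1} ℝ) :=
    Matrix.of fun i j => if h : InPar n r j i then MvPolynomial.X ⟨(i, j), h⟩
      else MvPolynomial.C (tau n r i j)
  have hM : ∀ k, ∀ X ∈ dualPar n r,
      E k r X = MvPolynomial.eval (fun ij => X ij.1.1 ij.1.2) (E k r M) := fun k X hX => by
    rw [← E_map]
    congr 1
    ext i j
    simp only [M, Matrix.map_apply, Matrix.of_apply]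
    split_ifs with h
    · rw [MvPolynomial.eval_X]
    · rw [MvPolynomial.eval_C, hX i j h]
  refine ⟨E m r M, E 0 r M, ?_, fun X hX => ⟨hM m X hX, hM 0 X hX⟩⟩
  obtain ⟨X, hX, hX0⟩ := hne
  intro h
  rw [hM 0 X hX, h, map_zero] at hX0
  exact hX0 rfl

end Coadjoint

/-! ### Invariants of the parabolic subalgebras and involution -/

section Involution

variable {n : ℕ}

theorem I_differentiableAt {m r : ℕ} {X : Mat n} (hX : E 0 r X ≠ 0) :
    DifferentiableAt ℝ (I m r : Mat n → ℝ) X :=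
  ((E_differentiable m r X).mul
    ((differentiableAt_inv hX).comp X (E_differentiable 0 r X))).congr_of_eventuallyEq
      (Filter.Eventually.of_forall fun Z => div_eq_mul_inv (E m r Z) (E 0 r Z))

theorem fderiv_I_comm {m r : ℕ} {X Y : Mat n} (hX : E 0 r X ≠ 0) (hY : InParAlg r Y) :
    fderiv ℝ (I m r : Mat n → ℝ) X (X * Y - Y * X) = 0 := by
  refine fderiv_eq_of_line (I_differentiableAt hX) ?_
  have h1 := hasDerivAt_comp_line (E_differentiable m r X) (X * Y - Y * X)
  have h2 := hasDerivAt_comp_line (E_differentiable 0 r X) (X * Y - Y * X)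
  refine hasDerivAt_congr (h1.div h2 (by simpa using hX)) (fun t => rfl) ?_
  rw [fderiv_E_comm m hY, fderiv_E_comm 0 hY]
  simp only [zero_smul, add_zero]
  ring

/-- A function whose differential at `X` is infinitesimally invariant under `𝔭_r`. -/
structure ParInvariantAt (r : ℕ) (f : Mat n → ℝ) (X : Mat n) : Prop where
  differentiableAt : DifferentiableAt ℝ f X
  grad_mem : InParAlg r (grad f X)
  comm : ∀ Y, InParAlg r Y → fderiv ℝ f X (X * Y - Y * X) = 0

theorem ParInvariantAt.trace_eq_zero {r : ℕ} {f : Mat n → ℝ} {X Y : Mat n}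
    (h : ParInvariantAt r f X) (hY : InParAlg r Y) :
    (X * (grad f X * Y - Y * grad f X)).trace = 0 := by
  rw [trace_mul_comm_cycle, ← neg_sub, Matrix.mul_neg, Matrix.trace_neg, ← fderiv_eq_trace,
    h.comm Y hY, neg_zero]

theorem grad_eq_zero_of_line {f : Mat n → ℝ} {X : Mat n} (hf : DifferentiableAt ℝ f X)
    {i j : Fin n} (h : ∀ᶠ t : ℝ in nhds 0, f (X + t • Matrix.single j i 1) = f X) :
    grad f X i j = 0 := by
  rw [grad, Matrix.of_apply]
  refine fderiv_eq_of_line hf ?_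
  exact (hasDerivAt_const (0 : ℝ) (f X)).congr_of_eventuallyEq h

theorem line_apply_of_ne (X : Mat n) (t : ℝ) {i j a b : Fin n} (h : ¬ (i = a ∧ j = b)) :
    (X + t • Matrix.single i j (1 : ℝ) : Mat n) a b = X a b := by
  rw [Matrix.add_apply, Matrix.smul_apply, Matrix.single_apply_of_ne _ _ _ _ _ h]; simp

theorem parInvariantAt_I (m : ℕ) {r : ℕ} {X : Mat n} (hX : E 0 r X ≠ 0) :
    ParInvariantAt r (I m r) X where
  differentiableAt := I_differentiableAt hX
  comm Y hY := fderiv_I_comm hX hY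
  grad_mem i j hij := by
    refine grad_eq_zero_of_line (I_differentiableAt hX) (Filter.Eventually.of_forall fun t => ?_)
    -- `grad` transposes positions: for `(i, j)` outside `𝔭_r` the varied entry `(j, i)` lies in one
    -- of the first `r` rows or last `r` columns, which the chop removes.
    have h : ∀ k, E k r (X + t • Matrix.single j i 1) = E k r X := fun k =>
      E_congr k fun a b ha hb => line_apply_of_ne X t (by
        rintro ⟨rfl, rfl⟩
        exact hij (by simp only [InPar]; omega))
    rw [I, h, h, I]

theorem fderiv_comm_of_conj {f : Mat n → ℝ} {X : Mat n} (hf : DifferentiableAt ℝ f X)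
    (h : ∀ p : Mat n, p.det ≠ 0 → f (p⁻¹ * X * p) = f X) (Y : Mat n) :
    fderiv ℝ f X (X * Y - Y * X) = 0 := by
  have hZ := hasDerivAt_matrix_conj X (hasDerivAt_one_add_smul Y 0) (by simp)
  have hZ0 : (fun s : ℝ => (1 + s • Y)⁻¹ * X * (1 + s • Y)) 0 = X := by simp
  have hE : HasFDerivAt f (fderiv ℝ f X) ((fun s : ℝ => (1 + s • Y)⁻¹ * X * (1 + s • Y)) 0) := by
    rw [hZ0]; exact hf.hasFDerivAt
  have hF := hE.comp_hasDerivAt (0 : ℝ) hZ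
  have hc : HasDerivAt (f ∘ fun s : ℝ => (1 + s • Y)⁻¹ * X * (1 + s • Y)) 0 0 := by
    refine (hasDerivAt_const (0 : ℝ) (f X)).congr_of_eventuallyEq ?_
    filter_upwards [eventually_det_ne_zero Y] with t ht
    exact h _ ht
  have h := hF.unique hc
  simp only [zero_smul, add_zero, inv_one, Matrix.one_mul, Matrix.mul_one] at h
  exact h

theorem inParAlg_zero (Y : Mat n) : InParAlg 0 Y := fun i j h => by
  simp only [InPar] at h
  omega

theorem parInvariantAt_of_conj {f : Mat n → ℝ} (hf : Differentiable ℝ f)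
    (h : ∀ X p : Mat n, p.det ≠ 0 → f (p⁻¹ * X * p) = f X) (X : Mat n) :
    ParInvariantAt 0 f X where
  differentiableAt := hf X
  grad_mem := inParAlg_zero _
  comm Y _ := fderiv_comm_of_conj (hf X) (h X) Y

theorem E_zero_index_conj' (m : ℕ) (X p : Mat n) (hp : p.det ≠ 0) :
    E m 0 (p⁻¹ * X * p) = E m 0 X := by
  have h := E_zero_index_conj m (Matrix.GeneralLinearGroup.mkOfDetNeZero p hp)⁻¹ X
  rw [inv_inv, Matrix.coe_units_inv] at h
  exact h

theorem parInvariantAt_E_zero (m : ℕ) (X : Mat n) : ParInvariantAt 0 (E m 0 : Mat n → ℝ) X :=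
  parInvariantAt_of_conj (E_differentiable m 0) (E_zero_index_conj' m) X

theorem trace_pow_eq_evalAt (m : ℕ) (X : Mat n) : (X ^ m).trace = evalAt (trPoly n m) X := by
  rw [evalAt, trPoly]
  have h1 : ((Matrix.mvPolynomialX (Fin n) (Fin n) ℝ) ^ m).map
      (MvPolynomial.eval (fun ij : Fin n × Fin n => X ij.1 ij.2)) = X ^ m := by
    rw [Matrix.map_pow, map_eval_mvPolynomialX]
  conv_lhs => rw [← h1]
  simp [Matrix.trace]

theorem trace_pow_eq_evalAt_fun (m : ℕ) :
    (fun X : Mat n => (X ^ m).trace) = evalAt (trPoly n m) := funext (trace_pow_eq_evalAt m)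

theorem trace_pow_differentiable (m : ℕ) :
    Differentiable ℝ (fun X : Mat n => (X ^ m).trace) := by
  rw [trace_pow_eq_evalAt_fun]; exact evalAt_differentiable _

theorem conj_pow (X p : Mat n) (hp : p.det ≠ 0) (m : ℕ) :
    (p⁻¹ * X * p) ^ m = p⁻¹ * X ^ m * p := by
  have hu := isUnit_iff_ne_zero.2 hp
  induction m with
  | zero => simp [Matrix.nonsing_inv_mul _ hu]
  | succ m ih =>
    rw [pow_succ, ih, pow_succ]
    calc p⁻¹ * X ^ m * p * (p⁻¹ * X * p) = p⁻¹ * X ^ m * (p * p⁻¹) * X * p := by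
          simp only [Matrix.mul_assoc]
      _ = _ := by rw [Matrix.mul_nonsing_inv _ hu]; simp only [Matrix.mul_one, Matrix.mul_assoc]

theorem trace_conj_pow (m : ℕ) (X p : Mat n) (hp : p.det ≠ 0) :
    ((p⁻¹ * X * p) ^ m).trace = (X ^ m).trace := by
  rw [conj_pow X p hp, Matrix.trace_mul_comm, ← Matrix.mul_assoc,
    Matrix.mul_nonsing_inv _ (isUnit_iff_ne_zero.2 hp), Matrix.one_mul]

theorem parInvariantAt_trace_pow (m : ℕ) (X : Mat n) :
    ParInvariantAt 0 (fun X : Mat n => (X ^ m).trace) X :=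
  parInvariantAt_of_conj (trace_pow_differentiable m) (trace_conj_pow m) X

theorem fam_of_eq_zero {k : FamIdx n} (h : k.1.1 = 0) :
    (fam k : Mat n → ℝ) = fun X => (X ^ (k.2.1 + 1)).trace := funext fun X => by
  rw [fam, if_pos h]

theorem fam_of_ne_zero {k : FamIdx n} (h : k.1.1 ≠ 0) :
    (fam k : Mat n → ℝ) = I (k.2.1 + 1) k.1.1 := funext fun X => by
  rw [fam, if_neg h]

theorem parInvariantAt_fam (k : FamIdx n) {X : Mat n} (hX : k.1.1 ≠ 0 → E 0 k.1.1 X ≠ 0) :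
    ParInvariantAt k.1.1 (fam k) X := by
  by_cases h : k.1.1 = 0
  · rw [fam_of_eq_zero h]
    have h1 := parInvariantAt_trace_pow (n := n) (k.2.1 + 1) X
    generalize k.2.1 + 1 = m at h1 ⊢
    rw [h]
    exact h1
  · rw [fam_of_ne_zero h]
    exact parInvariantAt_I _ (hX h)

theorem hessGen_E_ne_zero {X : Mat n} (hX : X ∈ hessGen n) {r : ℕ} (h : r < (n + 1) / 2)
    (h0 : r ≠ 0) : E 0 r X ≠ 0 := hX.2 r (by omega) (by omega)

theorem hessGen_fam {X : Mat n} (hX : X ∈ hessGen n) (k : FamIdx n) :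
    ParInvariantAt k.1.1 (fam k) X :=
  parInvariantAt_fam k fun h => hessGen_E_ne_zero hX k.1.2 h

theorem InParAlg.mono {r r' : ℕ} (h : r ≤ r') {A : Mat n} (hA : InParAlg r' A) : InParAlg r A :=
  fun i j hij => hA i j (by simp only [InPar] at *; omega)

theorem InParAlg.sub {r : ℕ} {A B : Mat n} (hA : InParAlg r A) (hB : InParAlg r B) :
    InParAlg r (A - B) := fun i j h => by rw [Matrix.sub_apply, hA i j h, hB i j h, sub_zero]

/-- A product of two strictly lower matrices lives at least two steps below the diagonal, and the
trace pairs it with entries of `X` at least two steps above it. -/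
theorem trace_hess_mul_strictLower {X A B : Mat n} (hX : X ∈ hess n)
    (hA : ∀ i j, i ≤ j → A i j = 0) (hB : ∀ i j, i ≤ j → B i j = 0) : (X * (A * B)).trace = 0 := by
  refine Finset.sum_eq_zero fun i _ => ?_
  rw [Matrix.diag_apply, Matrix.mul_apply]
  refine Finset.sum_eq_zero fun j _ => ?_
  rw [Matrix.mul_apply, Finset.mul_sum]
  refine Finset.sum_eq_zero fun k _ => ?_
  by_cases h1 : j ≤ k
  · rw [hA j k h1]; ring
  by_cases h2 : k ≤ i
  · rw [hB k i h2]; ring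
  have h3 : X i j = 0 := by
    rw [not_le, Fin.lt_def] at h1 h2
    rw [hX i j (Fin.lt_def.2 (by omega)), eps, Matrix.of_apply, if_neg (by omega)]
  rw [h3, zero_mul]

/-- Write `A`, `B` for the gradients of `f`, `g` and split them into upper and strictly lower parts.
In `[A₊, B₊] = [A₊, B] - [A, B₋] + [A₋, B₋]` the first term pairs to zero with `X` because `A₊ ∈ 𝔟₊
⊆ 𝔭_{r'}` and `g` is `𝔭_{r'}`-invariant. The second does because `B₋ = B - B₊ ∈ 𝔭_{r'} ⊆ 𝔭_r` and
`f` is `𝔭_r`-invariant, the third because `X` is Hessenberg. -/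
theorem bracket_eq_zero_of_parInvariantAt {r r' : ℕ} (hr : r ≤ r') {f g : Mat n → ℝ} {X : Mat n}
    (hX : X ∈ hess n) (hf : ParInvariantAt r f X) (hg : ParInvariantAt r' g X) :
    bracket (· ≤ ·) f g X = 0 := by
  rw [bracket]
  have hApu := entryProj_le_ut (grad f X)
  have hBpu := entryProj_le_ut (grad g X)
  have hTA := fun Y hY => hf.trace_eq_zero (Y := Y) hY
  have hTB := fun Y hY => hg.trace_eq_zero (Y := Y) hY
  have hlow : ∀ (M : Mat n) (i j : Fin n), i ≤ j → (M - entryProj (· ≤ ·) M) i j = 0 :=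
    fun M i j hij => by
      rw [Matrix.sub_apply, entryProj_of (S := fun i j : Fin n => i ≤ j) hij, sub_self]
  have hA1 := hlow (grad f X)
  have hB1 := hlow (grad g X)
  have hBm : InParAlg r' (grad g X - entryProj (· ≤ ·) (grad g X)) :=
    hg.grad_mem.sub (hBpu.inParAlg r')
  have h1 := hTB _ (hApu.inParAlg r')
  have h2 := hTA _ (hBm.mono hr)
  have h3 := trace_hess_mul_strictLower hX hA1 hB1
  have h4 := trace_hess_mul_strictLower hX hB1 hA1
  generalize entryProj (· ≤ ·) (grad f X) = Ap at *
  generalize entryProj (· ≤ ·) (grad g X) = Bp at *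
  generalize grad f X = A at *
  generalize grad g X = B at *
  simp only [Matrix.mul_sub, Matrix.sub_mul, Matrix.trace_sub] at *
  linarith

theorem bracket_fam_eq_zero (k l : FamIdx n) {X : Mat n} (hX : X ∈ hessGen n) :
    bracket (· ≤ ·) (fam k) (fam l) X = 0 := by
  rcases le_total k.1.1 l.1.1 with h | h
  · exact bracket_eq_zero_of_parInvariantAt h hX.1 (hessGen_fam hX k) (hessGen_fam hX l)
  · rw [bracket_antisymm, bracket_eq_zero_of_parInvariantAt h hX.1 (hessGen_fam hX l)
      (hessGen_fam hX k), neg_zero]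

theorem inInvolutionOn_fam (k l : FamIdx n) : InInvolutionOn (· ≤ ·) (hessGen n) (fam k) (fam l) :=
  fun _ hX => ⟨(hessGen_fam hX k).differentiableAt, (hessGen_fam hX l).differentiableAt,
    bracket_fam_eq_zero k l hX⟩

theorem inInvolutionOn_E_zero (m m' : ℕ) :
    InInvolutionOn (· ≤ ·) (hess n) (E m 0 : Mat n → ℝ) (E m' 0) :=
  fun X hX => ⟨E_differentiable m 0 X, E_differentiable m' 0 X,
    bracket_eq_zero_of_parInvariantAt le_rfl hX (parInvariantAt_E_zero m X)
      (parInvariantAt_E_zero m' X)⟩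

theorem inParAlg_entryProj (r : ℕ) (A : Mat n) : InParAlg r (entryProj (InPar n r) A) :=
  fun _ _ h => entryProj_of_not h A

theorem isCasimirOn_I (m r : ℕ) :
    IsCasimirOn (InPar n r) {X | X ∈ dualPar n r ∧ E 0 r X ≠ 0} (I m r) := fun X hX =>
  ⟨I_differentiableAt hX.2, fun g _ => by
    have h := parInvariantAt_I m hX.2
    rw [bracket, entryProj_eq_self h.grad_mem, h.trace_eq_zero (inParAlg_entryProj r _)]⟩

end Involution

/-! ### The Toda flow -/

section Toda

variable {n : ℕ}

/-- The test matrix `W` is there for the induction, which replaces `W` by `X * W`; the trace of a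
power needs only `W = 1`. -/
theorem hasDerivAt_pow_line (X V : Mat n) (m : ℕ) : ∃ D : Mat n,
    HasDerivAt (fun t : ℝ => (X + t • V) ^ m) D 0 ∧
      ∀ W : Mat n, Commute W X → (W * D).trace = m * (W * X ^ (m - 1) * V).trace := by
  induction m with
  | zero => exact ⟨0, by simp only [pow_zero]; exact hasDerivAt_const (0 : ℝ) (1 : Mat n), by simp⟩
  | succ m ih =>
    obtain ⟨D, hD, hW⟩ := ih
    have h := hasDerivAt_matrix_mul hD (hasDerivAt_line X V 0)
    simp only [zero_smul, add_zero] at h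
    refine ⟨D * X + X ^ m * V, ?_, fun W hWX => ?_⟩
    · simpa only [pow_succ] using h
    · rw [Matrix.mul_add, Matrix.trace_add, ← Matrix.mul_assoc, Matrix.trace_mul_comm,
        ← Matrix.mul_assoc]
      have hc : Commute (X * W) X := by
        have := (Commute.refl X).mul_left hWX
        exact this
      rw [hW _ hc, Nat.add_sub_cancel, ← Matrix.mul_assoc W]
      rcases Nat.eq_zero_or_pos m with rfl | hm
      · simp
      · have e : X * W * X ^ (m - 1) = W * X ^ m := by
          rw [← hWX.eq, Matrix.mul_assoc, ← pow_succ', Nat.sub_add_cancel hm]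
        rw [e]; push_cast; ring

theorem fderiv_trace_pow (m : ℕ) (X V : Mat n) :
    fderiv ℝ (fun X : Mat n => (X ^ m).trace) X V = m * (X ^ (m - 1) * V).trace := by
  obtain ⟨D, hD, hW⟩ := hasDerivAt_pow_line X V m
  refine fderiv_eq_of_line (trace_pow_differentiable m X) ?_
  have h1 : HasDerivAt (fun t : ℝ => ((X + t • V) ^ m).trace) D.trace 0 :=
    HasDerivAt.fun_sum fun i _ => hasDerivAt_matrix.1 hD i i
  have h2 := hW 1 (Commute.one_left X)
  rw [Matrix.one_mul, Matrix.one_mul] at h2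
  rwa [h2] at h1

theorem grad_trace_pow (m : ℕ) (X : Mat n) :
    grad (fun X : Mat n => (X ^ m).trace) X = (m : ℝ) • X ^ (m - 1) := by
  refine ext_trace fun V => ?_
  rw [← fderiv_eq_trace, fderiv_trace_pow, Matrix.smul_mul, Matrix.trace_smul, smul_eq_mul]

theorem grad_half_trace_sq (X : Mat n) : grad (fun Y : Mat n => (Y ^ 2).trace / 2) X = X := by
  have hd : DifferentiableAt ℝ (fun Y : Mat n => (Y ^ 2).trace / 2) X :=
    (trace_pow_differentiable 2 X).mul_const (2 : ℝ)⁻¹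
  refine ext_trace fun V => ?_
  rw [← fderiv_eq_trace]
  refine fderiv_eq_of_line hd ?_
  have h := (hasDerivAt_comp_line (trace_pow_differentiable 2 X) V).div_const 2
  refine hasDerivAt_congr h (fun t => rfl) ?_
  rw [fderiv_trace_pow]
  simp

theorem upper_add_lower (X : Mat n) :
    entryProj (· ≤ ·) X + entryProj (fun i j => j < i) X = X := by
  ext i j
  rw [Matrix.add_apply]
  rcases le_or_gt i j with h | h
  · rw [entryProj_of (S := fun i j : Fin n => i ≤ j) h,
      entryProj_of_not (S := fun i j : Fin n => j < i) (not_lt.2 h), add_zero]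
  · rw [entryProj_of_not (S := fun i j : Fin n => i ≤ j) (not_le.2 h),
      entryProj_of (S := fun i j : Fin n => j < i) h, zero_add]

/-- The two parts of `X` add up to `X`, which commutes with itself. In this form the field is an
infinitesimal conjugation by an element of `𝔟₊`, contained in every `𝔭_r`, so the parabolic
invariance applies. -/
theorem todaField_eq (X : Mat n) :
    todaField X = -(X * entryProj (· ≤ ·) X - entryProj (· ≤ ·) X * X) := by
  have h := upper_add_lower X
  have h' : entryProj (fun i j => j < i) X = X - entryProj (· ≤ ·) X := eq_sub_of_add_eq' h
  rw [todaField, h']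
  noncomm_ring

theorem todaField_lower {X : Mat n} (hX : X ∈ hess n) {i j : Fin n} (hij : i < j) :
    todaField X i j = 0 := by
  have hLz : ∀ a b : Fin n, a ≤ b → entryProj (fun i j => j < i) X a b = 0 := fun a b h =>
    entryProj_of_not (S := fun i j : Fin n => j < i) (not_lt.2 h) X
  have hX0 : ∀ a b : Fin n, a.1 + 1 < b.1 → X a b = 0 := fun a b h => by
    rw [hX a b (Fin.lt_def.2 (by omega)), eps, Matrix.of_apply, if_neg (by omega)]
  rw [Fin.lt_def] at hij
  rw [todaField]
  generalize entryProj (fun i j => j < i) X = L at hLz ⊢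
  rw [Matrix.sub_apply, Matrix.mul_apply, Matrix.mul_apply, Finset.sum_eq_zero, Finset.sum_eq_zero,
    sub_zero]
  · intro k _
    by_cases h : i ≤ k
    · rw [hLz i k h, zero_mul]
    · rw [not_le, Fin.lt_def] at h
      rw [hX0 k j (by omega), mul_zero]
  · intro k _
    by_cases h : k ≤ j
    · rw [hLz k j h, mul_zero]
    · rw [not_le, Fin.lt_def] at h
      rw [hX0 i k (by omega), zero_mul]

theorem hamVec_half_trace_sq {X : Mat n} (hX : X ∈ hess n) :
    hamVec (fun Y : Mat n => (Y ^ 2).trace / 2) X = todaField X := by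
  rw [hamVec, diffH, grad_half_trace_sq]
  have h : entryProj (· ≤ ·) X * X - X * entryProj (· ≤ ·) X = todaField X := by
    rw [todaField_eq, neg_sub]
  rw [h]
  exact entryProj_eq_self fun i j hij => todaField_lower hX (not_le.1 hij)

theorem comp_hasDerivWithinAt {f : Mat n → ℝ} {γ : ℝ → Mat n} {V : Mat n} {s : Set ℝ} {t : ℝ}
    (hf : DifferentiableAt ℝ f (γ t)) (hγ : HasDerivWithinAt γ V s t) :
    HasDerivWithinAt (fun t => f (γ t)) (fderiv ℝ f (γ t) V) s t :=
  hf.hasFDerivAt.comp_hasDerivWithinAt t hγ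

theorem eq_of_hasDerivWithinAt_zero {a b : ℝ} {F : ℝ → ℝ}
    (hF : ∀ t ∈ Set.Icc a b, HasDerivWithinAt F 0 (Set.Icc a b) t) {t : ℝ}
    (ht : t ∈ Set.Icc a b) : F t = F a :=
  constant_of_derivWithin_zero (fun s hs => (hF s hs).differentiableWithinAt)
    (fun s hs => (hF s ⟨hs.1, hs.2.le⟩).derivWithin
      ((uniqueDiffOn_Icc (lt_of_le_of_lt hs.1 hs.2)) s ⟨hs.1, hs.2.le⟩)) t ht

theorem continuousOn_entry {γ : ℝ → Mat n} {s : Set ℝ} (h : ContinuousOn γ s) (i j : Fin n) :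
    ContinuousOn (fun t => γ t i j) s :=
  ((continuous_apply_apply i j : Continuous fun X : Mat n => X i j)).comp_continuousOn h

theorem toda_flow_conserves {a b : ℝ} {γ : ℝ → Mat n}
    (hγ : ∀ t ∈ Set.Icc a b, γ t ∈ hess n ∧
      HasDerivWithinAt γ (todaField (γ t)) (Set.Icc a b) t)
    (ha : γ a ∈ hessGen n) : ∀ t ∈ Set.Icc a b, γ t ∈ hessGen n ∧
      ∀ k : FamIdx n, fam k (γ t) = fam k (γ a) := by
  intro t ht
  have hab : a ≤ b := ht.1.trans ht.2
  have hcont : ContinuousOn γ (Set.Icc a b) := fun s hs => (hγ s hs).2.continuousWithinAt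
  have hgen : ∀ s ∈ Set.Icc a b, γ s ∈ hessGen n := by
    intro s hs
    refine ⟨(hγ s hs).1, fun r h1 h2 => ?_⟩
    -- Along the flow `E_{0,r}` solves a scalar linear equation with this coefficient, the negative
    -- of its infinitesimal weight. A nonzero initial value therefore never reaches zero.
    set c : ℝ → ℝ := fun s => (∑ i : Fin n with n ≤ i.1 + r, γ s i i) -
      ∑ i : Fin n with i.1 < r, γ s i i with hc
    have hcc : ContinuousOn c (Set.Icc a b) :=
      (continuousOn_finsetSum _ fun i _ => continuousOn_entry hcont i i).sub
        (continuousOn_finsetSum _ fun i _ => continuousOn_entry hcont i i)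
    obtain ⟨e, he, hF⟩ := exists_factor_of_linear_ode hab hcc
    rw [hF (fun s => E 0 r (γ s)) (fun s hs => ?_) s hs]
    · exact mul_ne_zero (he s).ne' (ha.2 r h1 h2)
    · have h3 := comp_hasDerivWithinAt (E_differentiable 0 r (γ s)) (hγ s hs).2
      rw [todaField_eq, map_neg, fderiv_E_comm 0 ((entryProj_le_ut (γ s)).inParAlg r)] at h3
      refine h3.congr_deriv ?_
      have h4 : ∀ i : Fin n, entryProj (· ≤ ·) (γ s) i i = γ s i i := fun i =>
        entryProj_of (S := fun i j : Fin n => i ≤ j) le_rfl _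
      simp only [h4, hc]
      ring
  refine ⟨hgen t ht, fun k => ?_⟩
  refine eq_of_hasDerivWithinAt_zero (F := fun s => fam k (γ s)) (fun s hs => ?_) ht
  have h1 := hessGen_fam (hgen s hs) k
  have h2 := comp_hasDerivWithinAt h1.differentiableAt (hγ s hs).2
  rwa [todaField_eq, map_neg, h1.comm _ ((entryProj_le_ut (γ s)).inParAlg _), neg_zero] at h2

end Toda


/-! ### Newton's identities for the characteristic polynomial -/

section Newton

variable {N : ℕ} {R : Type*} [CommRing R]

theorem derivative_det_eq_sum (A : Matrix (Fin N) (Fin N) (Polynomial R)) :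
    Polynomial.derivative A.det =
      ∑ i, (A.updateRow i fun k => Polynomial.derivative (A i k)).det := by
  classical
  have hdet : ∀ B : Matrix (Fin N) (Fin N) (Polynomial R),
      B.det = ∑ σ : Equiv.Perm (Fin N), Equiv.Perm.sign σ • ∏ i, B i (σ i) := fun B => by
    rw [← Matrix.det_transpose, Matrix.det_apply]; rfl
  simp only [hdet, Polynomial.derivative_sum]
  rw [Finset.sum_comm]
  refine Finset.sum_congr rfl fun σ _ => ?_
  rw [← Finset.smul_sum]
  have h1 : ∀ p : Polynomial R, Polynomial.derivative (Equiv.Perm.sign σ • p) =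
      Equiv.Perm.sign σ • Polynomial.derivative p := fun p => by
    rcases Int.units_eq_one_or (Equiv.Perm.sign σ) with h | h <;> rw [h] <;> simp
  rw [h1, Polynomial.derivative_prod_finset]
  congr 1
  refine Finset.sum_congr rfl fun i _ => ?_
  rw [← Finset.prod_erase_mul _ _ (Finset.mem_univ i)]
  congr 1
  · refine Finset.prod_congr rfl fun j hj => ?_
    rw [Matrix.updateRow_ne (Finset.ne_of_mem_erase hj)]
  · rw [Matrix.updateRow_self]

/-- Jacobi's formula: the derivative of row `i` of the characteristic matrix is the `i`-th unit
vector. -/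
theorem trace_adjugate_charmatrix (M : Matrix (Fin N) (Fin N) R) :
    M.charmatrix.adjugate.trace = Polynomial.derivative M.charpoly := by
  rw [Matrix.charpoly, derivative_det_eq_sum, Matrix.trace]
  refine Finset.sum_congr rfl fun i _ => ?_
  rw [Matrix.diag_apply, Matrix.adjugate_apply]
  congr 2
  funext k
  rcases eq_or_ne k i with rfl | h
  · simp
  · simp [Matrix.charmatrix_apply, h, Matrix.diagonal_apply_ne _ h.symm]

/-- The matrix of the coefficients of `X ^ k`. -/
def coeffMat (k : ℕ) (A : Matrix (Fin N) (Fin N) (Polynomial R)) : Matrix (Fin N) (Fin N) R :=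
  A.map fun p => p.coeff k

theorem mul_charmatrix_apply (A : Matrix (Fin N) (Fin N) (Polynomial R))
    (M : Matrix (Fin N) (Fin N) R) (i j : Fin N) :
    (A * M.charmatrix) i j = A i j * Polynomial.X - ∑ k, A i k * Polynomial.C (M k j) := by
  simp only [Matrix.mul_apply, Matrix.charmatrix_apply, mul_sub, Finset.sum_sub_distrib]
  congr 1
  rw [Finset.sum_eq_single j]
  · rw [Matrix.diagonal_apply_eq]
  · intro b _ hb
    rw [Matrix.diagonal_apply_ne _ hb, mul_zero]
  · simp

theorem coeffMat_succ_mul_charmatrix (A : Matrix (Fin N) (Fin N) (Polynomial R))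
    (M : Matrix (Fin N) (Fin N) R) (k : ℕ) :
    coeffMat (k + 1) (A * M.charmatrix) = coeffMat k A - coeffMat (k + 1) A * M := by
  ext i j
  rw [coeffMat, Matrix.map_apply, mul_charmatrix_apply]
  simp only [coeffMat, Matrix.map_apply, Matrix.sub_apply, Matrix.mul_apply, Polynomial.coeff_sub,
    Polynomial.coeff_mul_X, Polynomial.finsetSum_coeff,
    Polynomial.coeff_mul_C]

theorem coeffMat_zero_mul_charmatrix (A : Matrix (Fin N) (Fin N) (Polynomial R))
    (M : Matrix (Fin N) (Fin N) R) :
    coeffMat 0 (A * M.charmatrix) = - (coeffMat 0 A * M) := by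
  ext i j
  rw [coeffMat, Matrix.map_apply, mul_charmatrix_apply]
  simp only [coeffMat, Matrix.map_apply, Matrix.neg_apply, Matrix.mul_apply, Polynomial.coeff_sub,
    Polynomial.coeff_mul_X_zero, Polynomial.finsetSum_coeff,
    Polynomial.coeff_mul_C, zero_sub]

theorem coeffMat_adjugate_mul (M : Matrix (Fin N) (Fin N) R) (k : ℕ) :
    coeffMat k (M.charmatrix.adjugate * M.charmatrix) = M.charpoly.coeff k • 1 := by
  rw [Matrix.adjugate_mul]
  ext i j
  simp only [coeffMat, Matrix.map_apply, Matrix.smul_apply, Matrix.one_apply, smul_eq_mul]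
  split_ifs <;> simp [Matrix.charpoly]

theorem exists_coeffMat_eq_zero (A : Matrix (Fin N) (Fin N) (Polynomial R)) :
    ∃ K, ∀ k, K ≤ k → coeffMat k A = 0 := by
  refine ⟨(Finset.univ.sup fun p : Fin N × Fin N => (A p.1 p.2).natDegree) + 1, fun k hk => ?_⟩
  ext i j
  simp only [coeffMat, Matrix.map_apply, Matrix.zero_apply]
  refine Polynomial.coeff_eq_zero_of_natDegree_lt (lt_of_lt_of_le ?_ hk)
  exact Nat.lt_succ_of_le (Finset.le_sup (f := fun p : Fin N × Fin N => (A p.1 p.2).natDegree)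
    (Finset.mem_univ (i, j)))

/-- With `B_k` the coefficient matrices of the adjugate and `χ_k` those of the characteristic
polynomial, comparing coefficients in `adj(X - M) (X - M) = χ` gives `B_k = χ_{k+1} + B_{k+1} M`. It
is solved downwards from degrees in which the `B_k` vanish. -/
theorem coeffMat_adjugate_eq (M : Matrix (Fin N) (Fin N) R) (k : ℕ) :
    coeffMat k M.charmatrix.adjugate =
      ∑ j ∈ Finset.Icc (k + 1) N, M.charpoly.coeff j • M ^ (j - (k + 1)) := by
  nontriviality R
  obtain ⟨K, hK⟩ := exists_coeffMat_eq_zero M.charmatrix.adjugate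
  have hrec : ∀ k, coeffMat k M.charmatrix.adjugate =
      M.charpoly.coeff (k + 1) • 1 + coeffMat (k + 1) M.charmatrix.adjugate * M := fun k => by
    rw [← coeffMat_adjugate_mul, coeffMat_succ_mul_charmatrix, sub_add_cancel]
  have hbig : ∀ j, N < j → M.charpoly.coeff j = 0 := fun j hj => by
    refine Polynomial.coeff_eq_zero_of_natDegree_lt ?_
    rwa [M.charpoly_natDegree_eq_dim, Fintype.card_fin]
  have main : ∀ d k, K ≤ k + d → coeffMat k M.charmatrix.adjugate =
      ∑ j ∈ Finset.Icc (k + 1) N, M.charpoly.coeff j • M ^ (j - (k + 1)) := by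
    intro d
    induction d with
    | zero =>
      intro k hk
      have h0 : ∀ d, coeffMat (k + d) M.charmatrix.adjugate = 0 := fun d => hK _ (by omega)
      rw [hK k (by omega)]
      symm
      refine Finset.sum_eq_zero fun j hj => ?_
      obtain ⟨d, rfl⟩ := Nat.exists_eq_add_of_le (Finset.mem_Icc.1 hj).1
      have h1 := hrec (k + d)
      rw [h0, add_assoc, h0, Matrix.zero_mul, add_zero] at h1
      have h2 : M.charpoly.coeff (k + 1 + d) • (1 : Matrix (Fin N) (Fin N) R) = 0 := by
        rw [h1]; congr 2; omega
      rw [← Matrix.one_mul (M ^ _), ← Matrix.smul_mul, h2, Matrix.zero_mul]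
    | succ d ih =>
      intro k hk
      rw [hrec, ih (k + 1) (by omega)]
      rcases le_or_gt (k + 1) N with h | h
      · rw [← Finset.insert_Icc_succ_left_eq_Icc h, Finset.sum_insert (by simp), Finset.sum_mul]
        congr 1
        · simp
        · refine Finset.sum_congr rfl fun j hj => ?_
          have := (Finset.mem_Icc.1 hj).1
          rw [Nat.succ_eq_succ, Nat.succ_eq_add_one] at this
          rw [Matrix.smul_mul, ← pow_succ]
          congr 2; omega
      · rw [hbig _ h, Finset.Icc_eq_empty (by omega), Finset.Icc_eq_empty (by omega)]
        simp
  exact main K k (by omega)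

/-- Newton's identities. -/
theorem charpoly_newton (M : Matrix (Fin N) (Fin N) R) (l : ℕ) (hl : l ≤ N) :
    (l : R) * M.charpoly.coeff l =
      N * M.charpoly.coeff l +
        ∑ j ∈ Finset.Icc (l + 1) N, M.charpoly.coeff j * (M ^ (j - l)).trace := by
  -- For `l = 0` the identity is the trace of the constant coefficient of `adj(X - M) (X - M) = χ`;
  -- for `l = k + 1` two expressions for the trace of `B_k` are compared, one of them from the
  -- derivative of `χ`.
  rcases l with _ | k
  · have h1 := congrArg Matrix.trace (coeffMat_adjugate_mul M 0)
    rw [coeffMat_zero_mul_charmatrix, coeffMat_adjugate_eq, Finset.sum_mul] at h1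
    simp only [Matrix.smul_mul, ← pow_succ, Matrix.trace_neg, Matrix.trace_sum,
      Matrix.trace_smul, smul_eq_mul, Matrix.trace_one, Fintype.card_fin] at h1
    rw [mul_comm (N : R), ← h1]
    rw [Nat.cast_zero, zero_mul, eq_comm, neg_add_eq_zero]
    refine Finset.sum_congr rfl fun j hj => ?_
    have := (Finset.mem_Icc.1 hj).1
    congr 3; omega
  · have h1 := congrArg Matrix.trace (coeffMat_adjugate_eq M k)
    have h2 : (coeffMat k M.charmatrix.adjugate).trace = M.charpoly.coeff (k + 1) * (k + 1) := by
      rw [← Polynomial.coeff_derivative, ← trace_adjugate_charmatrix, Matrix.trace, Matrix.trace,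
        Polynomial.finsetSum_coeff]
      rfl
    rw [h2, ← Finset.insert_Icc_succ_left_eq_Icc hl, Finset.sum_insert (by simp)] at h1
    simp only [Matrix.trace_add, Matrix.trace_sum, Matrix.trace_smul, smul_eq_mul,
      Nat.sub_self, pow_zero, Matrix.trace_one, Fintype.card_fin] at h1
    rw [mul_comm (N : R), mul_comm, Nat.cast_add, Nat.cast_one, h1]
    rfl

end Newton

/-! ### Polynomial Casimirs on the dual of `gl` -/

section PolynomialCasimirs

variable {n : ℕ}

theorem chop_zero_eq {R : Type*} [CommRing R] (A : Matrix (Fin n) (Fin n) R) :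
    chop 0 A = -A.charmatrix := by
  ext1 i j
  have hi : (⟨0 + i.1, by have := i.2; omega⟩ : Fin n) = i := Fin.ext (Nat.zero_add _)
  change (A.map Polynomial.C - Matrix.scalar (Fin n) (Polynomial.X : Polynomial R))
    (⟨0 + i.1, by have := i.2; omega⟩ : Fin n) j = _
  rw [hi, Matrix.neg_apply, Matrix.charmatrix_apply, neg_sub]
  rfl

theorem E_zero_index_eq {R : Type*} [CommRing R] (m : ℕ) (A : Matrix (Fin n) (Fin n) R) :
    E m 0 A = (-1) ^ n * A.charpoly.coeff (n - m) := by
  have h : (chop 0 A).det = Polynomial.C ((-1) ^ n) * A.charpoly := by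
    rw [chop_zero_eq]
    change (-A.charmatrix : Matrix (Fin n) (Fin n) _).det = _
    rw [Matrix.det_neg, Fintype.card_fin, Matrix.charpoly]
    simp
  rw [E, h, Polynomial.coeff_C_mul]
  rfl

/-- The algebra generated by the `E_{m,0}`. -/
noncomputable def coeffAlg (n : ℕ) : Subalgebra ℝ (MvPolynomial (Fin n × Fin n) ℝ) :=
  Algebra.adjoin ℝ {q | ∃ m ≤ n, q = EPoly n m 0}

/-- The algebra generated by the traces of powers. -/
noncomputable def traceAlg (n : ℕ) : Subalgebra ℝ (MvPolynomial (Fin n × Fin n) ℝ) :=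
  Algebra.adjoin ℝ {q | ∃ m, 1 ≤ m ∧ m ≤ n ∧ q = trPoly n m}

theorem neg_one_pow_mem {A : Subalgebra ℝ (MvPolynomial (Fin n × Fin n) ℝ)} (k : ℕ) :
    (-1) ^ k ∈ A := A.pow_mem (A.neg_mem A.one_mem) k

theorem charpoly_coeff_mem_coeffAlg (i : ℕ) (hi : i ≤ n) :
    (Matrix.mvPolynomialX (Fin n) (Fin n) ℝ).charpoly.coeff i ∈ coeffAlg n := by
  have h1 : EPoly n (n - i) 0 ∈ coeffAlg n := Algebra.subset_adjoin ⟨n - i, by omega, rfl⟩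
  have h2 : (Matrix.mvPolynomialX (Fin n) (Fin n) ℝ).charpoly.coeff i =
      (-1) ^ n * EPoly n (n - i) 0 := by
    rw [EPoly, E_zero_index_eq, ← mul_assoc, ← mul_pow, neg_one_mul, neg_neg, one_pow, one_mul,
      Nat.sub_sub_self hi]
  rw [h2]
  exact (coeffAlg n).mul_mem (neg_one_pow_mem n) h1

/-- Newton's identities are solved downwards from the leading coefficient; the divisor `i - n` is
nonzero below the top degree. -/
theorem charpoly_coeff_mem_traceAlg (d : ℕ) : ∀ i ≤ n, n ≤ i + d →
    (Matrix.mvPolynomialX (Fin n) (Fin n) ℝ).charpoly.coeff i ∈ traceAlg n := by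
  have htop : (Matrix.mvPolynomialX (Fin n) (Fin n) ℝ).charpoly.coeff n = 1 := by
    have h1 := (Matrix.mvPolynomialX (Fin n) (Fin n) ℝ).charpoly_monic.coeff_natDegree
    rwa [Matrix.charpoly_natDegree_eq_dim, Fintype.card_fin] at h1
  induction d with
  | zero =>
    intro i hi hn
    obtain rfl : i = n := by omega
    rw [htop]; exact (traceAlg i).one_mem
  | succ d ih =>
    intro i hi hn
    rcases eq_or_lt_of_le hi with rfl | hlt
    · rw [htop]; exact (traceAlg i).one_mem
    set M := Matrix.mvPolynomialX (Fin n) (Fin n) ℝ with hM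
    have hnewton := charpoly_newton M i hi
    have hsum : ∑ j ∈ Finset.Icc (i + 1) n, M.charpoly.coeff j * (M ^ (j - i)).trace ∈
        traceAlg n := by
      refine Subalgebra.sum_mem _ fun j hj => ?_
      obtain ⟨h1, h2⟩ := Finset.mem_Icc.1 hj
      exact (traceAlg n).mul_mem (ih j h2 (by omega))
        (Algebra.subset_adjoin ⟨j - i, by omega, by omega, rfl⟩)
    have hne : ((i : ℝ) - n) ≠ 0 := sub_ne_zero.2 (by exact_mod_cast hlt.ne)
    have hval : M.charpoly.coeff i = MvPolynomial.C ((i : ℝ) - n)⁻¹ *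
        ∑ j ∈ Finset.Icc (i + 1) n, M.charpoly.coeff j * (M ^ (j - i)).trace := by
      have h3 : ∑ j ∈ Finset.Icc (i + 1) n, M.charpoly.coeff j * (M ^ (j - i)).trace =
          MvPolynomial.C ((i : ℝ) - n) * M.charpoly.coeff i := by
        rw [map_sub, map_natCast, map_natCast, sub_mul, hnewton]; ring
      rw [h3, ← mul_assoc, ← map_mul, inv_mul_cancel₀ hne, map_one, one_mul]
    rw [hval]
    exact (traceAlg n).mul_mem ((traceAlg n).algebraMap_mem _) hsum

theorem coeffAlg_le_traceAlg : coeffAlg n ≤ traceAlg n := by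
  refine Algebra.adjoin_le ?_
  rintro q ⟨m, hm, rfl⟩
  rw [EPoly, E_zero_index_eq]
  exact (traceAlg n).mul_mem (neg_one_pow_mem n)
    (charpoly_coeff_mem_traceAlg n (n - m) (by omega) (by omega))

theorem grad_evalAt_apply (f : MvPolynomial (Fin n × Fin n) ℝ) (X : Mat n) (i j : Fin n) :
    grad (evalAt f) X i j = evalAt (MvPolynomial.pderiv (j, i) f) X := by
  rw [grad, Matrix.of_apply, fderiv_evalAt]

theorem grad_evalAt_add (f g : MvPolynomial (Fin n × Fin n) ℝ) (X : Mat n) :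
    grad (evalAt (f + g)) X = grad (evalAt f) X + grad (evalAt g) X := by
  ext i j
  simp only [Matrix.add_apply, grad_evalAt_apply, map_add, evalAt_add]

theorem grad_evalAt_mul (f g : MvPolynomial (Fin n × Fin n) ℝ) (X : Mat n) :
    grad (evalAt (f * g)) X = evalAt f X • grad (evalAt g) X + evalAt g X • grad (evalAt f) X := by
  ext i j
  simp only [Matrix.add_apply, Matrix.smul_apply, grad_evalAt_apply, Derivation.leibniz,
    smul_eq_mul, evalAt_add, evalAt_mul]

theorem grad_evalAt_C (c : ℝ) (X : Mat n) : grad (evalAt (MvPolynomial.C c)) X = 0 := by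
  ext i j
  rw [grad_evalAt_apply, MvPolynomial.pderiv_C]
  simp [evalAt]

/-- The bracket as a linear function of the gradient of its first argument. -/
noncomputable def bracketLin (S : Fin n → Fin n → Prop) (X B : Mat n) : Mat n →ₗ[ℝ] ℝ :=
  (Matrix.traceLinearMap (Fin n) ℝ ℝ).comp
    ((LinearMap.mulRight ℝ (entryProj S B * X - X * entryProj S B)).comp (entryProjₗ S))

theorem bracket_eq_bracketLin (S : Fin n → Fin n → Prop) (f g : Mat n → ℝ) (X : Mat n) :
    bracket S f g X = bracketLin S X (grad g X) (grad f X) := by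
  rw [bracket_eq_trace]; rfl

/-- The bracket depends on `g` only through its gradient, and linear functions realize every
gradient. -/
theorem isCasimirOn_evalAt_iff {S : Fin n → Fin n → Prop} {U : Set (Mat n)}
    {f : MvPolynomial (Fin n × Fin n) ℝ} :
    IsCasimirOn S U (evalAt f) ↔ ∀ X ∈ U, ∀ B, bracketLin S X B (grad (evalAt f) X) = 0 := by
  constructor
  · intro h X hX B
    have h1 := (h X hX).2 (trLin B) (trLin B).differentiableAt
    rwa [bracket_eq_bracketLin, grad_trLin] at h1
  · exact fun h X hX => ⟨evalAt_differentiable f X, fun g _ => by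
      rw [bracket_eq_bracketLin]; exact h X hX _⟩

/-- The algebra of polynomial Casimirs. -/
def casimirAlg (S : Fin n → Fin n → Prop) (U : Set (Mat n)) :
    Subalgebra ℝ (MvPolynomial (Fin n × Fin n) ℝ) where
  carrier := {f | IsCasimirOn S U (evalAt f)}
  mul_mem' := by
    intro f g hf hg
    rw [Set.mem_ofPred_eq, isCasimirOn_evalAt_iff] at *
    intro X hX B
    rw [grad_evalAt_mul, map_add, map_smul, map_smul, hf X hX, hg X hX]; simp
  add_mem' := by
    intro f g hf hg
    rw [Set.mem_ofPred_eq, isCasimirOn_evalAt_iff] at *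
    intro X hX B
    rw [grad_evalAt_add, map_add, hf X hX, hg X hX, add_zero]
  algebraMap_mem' := by
    intro c
    rw [Set.mem_ofPred_eq, isCasimirOn_evalAt_iff]
    intro X hX B
    rw [MvPolynomial.algebraMap_eq, grad_evalAt_C, map_zero]

theorem isCasimirOn_of_parInvariantAt {f : Mat n → ℝ} (h : ∀ X, ParInvariantAt 0 f X) :
    IsCasimirOn (fun _ _ => True) Set.univ f := fun X _ =>
  ⟨(h X).differentiableAt, fun g _ => by
    rw [bracket, entryProj_true, entryProj_true, (h X).trace_eq_zero (inParAlg_zero _)]⟩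

theorem coeffAlg_le_casimirAlg : coeffAlg n ≤ casimirAlg (fun _ _ => True) Set.univ := by
  refine Algebra.adjoin_le ?_
  rintro q ⟨m, hm, rfl⟩
  change IsCasimirOn _ _ (evalAt (EPoly n m 0))
  rw [← E_eq_evalAt_fun]
  exact isCasimirOn_of_parInvariantAt (parInvariantAt_E_zero m)

theorem trPoly_mem_casimirAlg (m : ℕ) :
    trPoly n m ∈ casimirAlg (n := n) (fun _ _ => True) Set.univ := by
  change IsCasimirOn _ _ (evalAt (trPoly n m))
  rw [← trace_pow_eq_evalAt_fun]
  exact isCasimirOn_of_parInvariantAt (parInvariantAt_trace_pow m)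

theorem fderiv_comm_of_isCasimirOn {f : MvPolynomial (Fin n × Fin n) ℝ}
    (hf : IsCasimirOn (fun _ _ => True) Set.univ (evalAt f)) (X Y : Mat n) :
    fderiv ℝ (evalAt f) X (X * Y - Y * X) = 0 := by
  have h := isCasimirOn_evalAt_iff.1 hf X (Set.mem_univ X) (-Y)
  have h1 : bracketLin (fun _ _ => True) X (-Y) (grad (evalAt f) X) =
      (grad (evalAt f) X * (-Y * X - X * -Y)).trace := by
    change (entryProj _ _ * (entryProj _ _ * X - X * entryProj _ _)).trace = _
    rw [entryProj_true, entryProj_true]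
  rw [h1] at h
  rw [fderiv_eq_trace, ← h]
  congr 2
  noncomm_ring

/-- Integration of the infinitesimal invariance along the segment from `1` to `P`, which must
consist of invertible matrices. -/
theorem conj_eq_of_fderiv_comm {f : Mat n → ℝ} (hf : Differentiable ℝ f)
    (h : ∀ X Y, fderiv ℝ f X (X * Y - Y * X) = 0) {X P : Mat n}
    (hP : ∀ t ∈ Set.Icc (0 : ℝ) 1, (1 + t • (P - 1)).det ≠ 0) : f (P⁻¹ * X * P) = f X := by
  have h1 := eq_of_hasDerivWithinAt_zero (a := 0) (b := 1)
    (F := fun t : ℝ => f ((1 + t • (P - 1))⁻¹ * X * (1 + t • (P - 1))))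
    (fun t ht => by
      have h2 := hasDerivAt_matrix_conj X (hasDerivAt_one_add_smul (P - 1) t) (hP t ht)
      have h3 := (hf _).hasFDerivAt.comp_hasDerivAt t h2
      exact (h3.congr_deriv (h _ _)).hasDerivWithinAt) (Set.right_mem_Icc.2 zero_le_one)
  simpa using h1

theorem eventually_segment_det_ne_zero :
    ∀ᶠ M in nhds (1 : Mat n), ∀ t ∈ Set.Icc (0 : ℝ) 1, (1 + t • (M - 1)).det ≠ 0 := by
  refine isCompact_Icc.eventually_forall_of_forall_eventually fun t _ => ?_
  have hc : Continuous fun z : Mat n × ℝ => (1 + z.2 • (z.1 - 1)).det :=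
    Continuous.matrix_det (continuous_const.add
      (continuous_snd.smul (continuous_fst.sub continuous_const)))
  exact hc.continuousAt.eventually_ne (by simp)

/-- The matrix of the vectors `X ^ j e₀`. -/
def krylov (z : Fin n) (X : Mat n) : Mat n := Matrix.of fun i j => (X ^ j.1) i z

/-- The companion matrix of a monic polynomial, given by its coefficients. -/
def compMat {R : Type*} [CommRing R] (c : ℕ → R) : Matrix (Fin n) (Fin n) R :=
  Matrix.of fun i j => if j.1 + 1 = n then - c i.1 else if i.1 = j.1 + 1 then 1 else 0

/-- `X` moves each Krylov column to the next one, and Cayley–Hamilton expresses the image of the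
last. So an invertible Krylov matrix conjugates `X` to its companion matrix. -/
theorem mul_krylov (z : Fin n) (X : Mat n) :
    X * krylov z X = krylov z X * compMat fun i => X.charpoly.coeff i := by
  ext i j
  have hL : (X * krylov z X) i j = (X ^ (j.1 + 1)) i z := by
    rw [pow_succ', Matrix.mul_apply, Matrix.mul_apply]; rfl
  rw [hL, Matrix.mul_apply]
  by_cases hj : j.1 + 1 = n
  · have hCH := X.aeval_self_charpoly
    rw [Polynomial.aeval_eq_sum_range, X.charpoly_natDegree_eq_dim, Fintype.card_fin,
      Finset.sum_range_succ, coeff_charpoly_top, one_smul, add_eq_zero_iff_neg_eq] at hCH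
    rw [hj, ← hCH, ← Finset.sum_neg_distrib, Matrix.sum_apply,
      ← Fin.sum_univ_eq_sum_range (fun k => (-(X.charpoly.coeff k • X ^ k)) i z) n]
    refine Finset.sum_congr rfl fun k _ => ?_
    simp [compMat, krylov, hj, mul_comm]
  · have hj' : j.1 + 1 < n := lt_of_le_of_ne j.2 hj
    rw [Finset.sum_eq_single ⟨j.1 + 1, hj'⟩]
    · simp [compMat, krylov, hj]
    · intro k _ hk
      have : ¬ k.1 = j.1 + 1 := fun h => hk (Fin.ext h)
      simp [compMat, hj, this]
    · simp

/-- The nilpotent shift `e_j ↦ e_{j+1}`. -/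
def shift (n : ℕ) : Mat n := Matrix.of fun i j => if i.1 = j.1 + 1 then 1 else 0

/-- The base point of the argument for Casimirs: for `X` near the shift the Krylov matrix is near
`1`, hence joined to `1` by a segment of invertible matrices. -/
theorem krylov_shift (z : Fin n) (hz : z.1 = 0) : krylov z (shift n) = 1 := by
  have h : ∀ (j : ℕ) (i : Fin n), (shift n ^ j) i z = if i.1 = j then 1 else 0 := by
    intro j
    induction j with
    | zero =>
      intro i
      simp [Matrix.one_apply, Fin.ext_iff, hz]
    | succ j ih =>
      intro i
      rw [pow_succ', Matrix.mul_apply]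
      simp only [ih]
      simp only [shift, Matrix.of_apply]
      by_cases hij : i.1 = j + 1
      · rw [Finset.sum_eq_single ⟨j, by have := i.2; omega⟩]
        · simp [hij]
        · intro k _ hk
          have : ¬ k.1 = j := fun h => hk (Fin.ext h)
          simp [this]
        · simp
      · rw [if_neg hij]
        refine Finset.sum_eq_zero fun k _ => ?_
        by_cases hk : k.1 = j
        · rw [hk, if_neg hij, zero_mul]
        · rw [if_neg hk, mul_zero]
  ext i j
  simp [krylov, h, Matrix.one_apply, Fin.ext_iff]

theorem continuous_krylov (z : Fin n) : Continuous (krylov z : Mat n → Mat n) := by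
  refine continuous_matrix fun i j => ?_
  exact (continuous_pow j.1).matrix_elem i z

/-- The polynomial `q`, which is `f` evaluated on the companion matrix, lies in the algebra of
coefficients by construction. Near the shift `f` agrees with `q` because `X` is conjugate to its
companion matrix by an admissible conjugation; so `f = q`. -/
theorem mem_coeffAlg_of_isCasimirOn (hn : 1 ≤ n) {f : MvPolynomial (Fin n × Fin n) ℝ}
    (hf : IsCasimirOn (fun _ _ => True) Set.univ (evalAt f)) : f ∈ coeffAlg n := by
  set z : Fin n := ⟨0, hn⟩
  set c : ℕ → MvPolynomial (Fin n × Fin n) ℝ := fun i =>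
    (Matrix.mvPolynomialX (Fin n) (Fin n) ℝ).charpoly.coeff i with hc
  set q : MvPolynomial (Fin n × Fin n) ℝ :=
    MvPolynomial.aeval (fun ij : Fin n × Fin n => (compMat c : Matrix (Fin n) (Fin n) _) ij.1 ij.2)
      f
    with hq
  have hqmem : q ∈ coeffAlg n := by
    have hent : ∀ ij : Fin n × Fin n,
        (compMat c : Matrix (Fin n) (Fin n) _) ij.1 ij.2 ∈ coeffAlg n := fun ij => by
      simp only [compMat, Matrix.of_apply]
      split_ifs
      · exact (coeffAlg n).neg_mem (charpoly_coeff_mem_coeffAlg _ ij.1.2.le)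
      · exact (coeffAlg n).one_mem
      · exact (coeffAlg n).zero_mem
    have h1 : q ∈ Algebra.adjoin ℝ (Set.range fun ij : Fin n × Fin n =>
        (compMat c : Matrix (Fin n) (Fin n) _) ij.1 ij.2) := by
      rw [Algebra.adjoin_range_eq_range_aeval]
      exact ⟨f, rfl⟩
    refine Algebra.adjoin_le ?_ h1
    rintro _ ⟨ij, rfl⟩
    exact hent ij
  have hqeval : ∀ X : Mat n, evalAt q X = evalAt f (compMat fun i => X.charpoly.coeff i) := by
    intro X
    have hcX : ∀ i, MvPolynomial.eval (fun ij : Fin n × Fin n => X ij.1 ij.2) (c i) =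
        X.charpoly.coeff i := fun i => by
      rw [hc]
      conv_rhs => rw [← map_eval_mvPolynomialX X]
      rw [Matrix.charpoly_map, Polynomial.coeff_map]
    rw [evalAt, hq, ← MvPolynomial.coe_aeval_eq_eval]
    change (MvPolynomial.aeval fun ij : Fin n × Fin n => X ij.1 ij.2)
      ((MvPolynomial.aeval fun ij : Fin n × Fin n =>
        (compMat c : Matrix (Fin n) (Fin n) _) ij.1 ij.2) f) = _
    rw [MvPolynomial.comp_aeval_apply, evalAt, ← MvPolynomial.coe_aeval_eq_eval]
    change _ = (MvPolynomial.aeval _) f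
    congr 2
    funext ij
    simp only [compMat, Matrix.of_apply]
    split_ifs
    · rw [map_neg]; exact congrArg Neg.neg (hcX _)
    · exact map_one _
    · exact map_zero _
  have hev : ∀ᶠ X in nhds (shift n), evalAt (f - q) X = 0 := by
    have h1 : Filter.Tendsto (krylov z) (nhds (shift n)) (nhds (1 : Mat n)) := by
      have := (continuous_krylov z).tendsto (shift n)
      rwa [krylov_shift z rfl] at this
    filter_upwards [h1.eventually eventually_segment_det_ne_zero] with X hX
    have hdet : (krylov z X).det ≠ 0 := by
      simpa using hX 1 (Set.right_mem_Icc.2 zero_le_one)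
    have h2 := conj_eq_of_fderiv_comm (evalAt_differentiable f) (fderiv_comm_of_isCasimirOn hf)
      (X := X) hX
    have h3 : (krylov z X)⁻¹ * X * krylov z X = compMat fun i => X.charpoly.coeff i := by
      rw [Matrix.mul_assoc, mul_krylov, ← Matrix.mul_assoc,
        Matrix.nonsing_inv_mul _ (isUnit_iff_ne_zero.2 hdet), Matrix.one_mul]
    rw [evalAt_sub, hqeval, ← h3, h2, sub_self]
  rw [sub_eq_zero.1 (evalAt_eq_zero_of_eventually hev)]
  exact hqmem

theorem isCasimirOn_iff_mem_coeffAlg (hn : 1 ≤ n) (f : MvPolynomial (Fin n × Fin n) ℝ) :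
    IsCasimirOn (fun _ _ => True) Set.univ (evalAt f) ↔ f ∈ coeffAlg n :=
  ⟨mem_coeffAlg_of_isCasimirOn hn, fun h => coeffAlg_le_casimirAlg h⟩

theorem coeffAlg_eq_traceAlg (hn : 1 ≤ n) : coeffAlg n = traceAlg n := by
  refine le_antisymm coeffAlg_le_traceAlg (Algebra.adjoin_le ?_)
  rintro q ⟨m, -, -, rfl⟩
  exact mem_coeffAlg_of_isCasimirOn hn (trPoly_mem_casimirAlg m)

/-- If all `E_{m,0}` were Casimirs on `ℋ`, the Toda field would vanish. -/
theorem exists_not_isCasimirOn_E_zero (hn : 1 ≤ n) {X : Mat n} (hX : X ∈ hess n)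
    (hne : todaField X ≠ 0) :
    ∃ m ≤ n, ¬ IsCasimirOn (· ≤ ·) (hess n) (E m 0 : Mat n → ℝ) := by
  by_contra! hall
  have h1 : coeffAlg n ≤ casimirAlg (· ≤ ·) (hess n) := by
    refine Algebra.adjoin_le ?_
    rintro q ⟨m, hm, rfl⟩
    change IsCasimirOn _ _ (evalAt (EPoly n m 0))
    rw [← E_eq_evalAt_fun]
    exact hall m hm
  have h2 : IsCasimirOn (· ≤ ·) (hess n) (evalAt (trPoly n 2)) :=
    h1 (mem_coeffAlg_of_isCasimirOn hn (trPoly_mem_casimirAlg 2))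
  refine hne (ext_trace fun V => ?_)
  have h3 := isCasimirOn_evalAt_iff.1 h2 X hX V
  rw [← trace_pow_eq_evalAt_fun, grad_trace_pow] at h3
  have h4 : bracketLin (· ≤ ·) X V (((2 : ℕ) : ℝ) • X ^ (2 - 1)) =
      2 * (entryProj (· ≤ ·) X *
        (entryProj (· ≤ ·) V * X - X * entryProj (· ≤ ·) V)).trace := by
    rw [map_smul, pow_one]; rfl
  rw [h4] at h3
  have h5 : (todaField X * V).trace = (todaField X * entryProj (· ≤ ·) V).trace := by
    have h6 : todaField X = entryProj (fun i j => j ≤ i) (todaField X) :=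
      (entryProj_eq_self fun i j hij => todaField_lower hX (not_le.1 hij)).symm
    conv_lhs => rw [h6]
    rw [trace_entryProj_mul]
  rw [h5, todaField_eq, Matrix.zero_mul, Matrix.trace_zero]
  have h7 := trace_mul_comm_cycle (entryProj (· ≤ ·) V) X (entryProj (· ≤ ·) X)
  have h8 := trace_mul_comm_cycle X (entryProj (· ≤ ·) X) (entryProj (· ≤ ·) V)
  rw [← h8] at h3
  rw [Matrix.trace_mul_comm, Matrix.mul_neg, Matrix.trace_neg, h7]
  rw [trace_mul_comm_cycle] at h3
  linarith

end PolynomialCasimirs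


/-! ### The Casimirs of the bracket on `ℋ` -/

section HessCasimirs

variable {n : ℕ}

theorem cas_of_eq_zero {r : Fin ((n + 1) / 2)} (h : r.1 = 0) :
    (cas r : Mat n → ℝ) = fun X => (X ^ 1).trace := funext fun X => by
  rw [cas, if_pos h, pow_one]

theorem cas_of_ne_zero {r : Fin ((n + 1) / 2)} (h : r.1 ≠ 0) :
    (cas r : Mat n → ℝ) = I 1 r.1 := funext fun X => by
  rw [cas, if_neg h]

theorem two_mul_lt_of_fin (r : Fin ((n + 1) / 2)) : 2 * r.1 < n := by
  have := r.2; omega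

theorem parInvariantAt_cas (r : Fin ((n + 1) / 2)) {X : Mat n} (hX : r.1 ≠ 0 → E 0 r.1 X ≠ 0) :
    ParInvariantAt r.1 (cas r) X := by
  by_cases h : r.1 = 0
  · rw [cas_of_eq_zero h, h]
    exact parInvariantAt_trace_pow _ X
  · rw [cas_of_ne_zero h]
    exact parInvariantAt_I _ (hX h)

/-- The trace and `I_{1,r}` see only entries on and below the diagonal. Their gradients thus lie in
`𝔟₊` already, no projection is needed in the bracket, and invariance under `𝔭_r ⊇ 𝔟₊` makes them
Casimirs. -/
theorem ut_grad_cas (r : Fin ((n + 1) / 2)) {X : Mat n} (hX : r.1 ≠ 0 → E 0 r.1 X ≠ 0) :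
    UT (grad (cas r) X) := by
  intro i j hij
  by_cases h : r.1 = 0
  · rw [cas_of_eq_zero h, grad_trace_pow]
    simp [Matrix.one_apply_ne (ne_of_gt hij)]
  · rw [cas_of_ne_zero h]
    refine grad_eq_zero_of_line (I_differentiableAt (hX h)) (Filter.Eventually.of_forall fun t =>
      ?_)
    refine (I_one_congr_low (two_mul_lt_of_fin r) (hX h) fun a b hab => ?_).symm
    exact (line_apply_of_ne X t (by
      rintro ⟨rfl, rfl⟩
      exact absurd hab (not_le.2 hij))).symm

theorem diffH_cas (r : Fin ((n + 1) / 2)) {X : Mat n} (hX : r.1 ≠ 0 → E 0 r.1 X ≠ 0) :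
    diffH (cas r) X = grad (cas r) X :=
  entryProj_eq_self fun i j h => ut_grad_cas r hX i j (not_le.1 h)

theorem isCasimirOn_cas (r : Fin ((n + 1) / 2)) :
    IsCasimirOn (· ≤ ·) {X | X ∈ hess n ∧ E 0 r.1 X ≠ 0} (cas r) := fun X hX => by
  have h := parInvariantAt_cas r fun _ => hX.2
  refine ⟨h.differentiableAt, fun g _ => ?_⟩
  have h1 : entryProj (· ≤ ·) (grad (cas r) X) = grad (cas r) X := diffH_cas r fun _ => hX.2
  rw [bracket, h1, h.trace_eq_zero ((entryProj_le_ut _).inParAlg _)]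

/-- For `r ≠ 0`, diagonal entries enter `I_{1,r}` only through the trace of the middle block. The
answer does not depend on `X`, so independence is uniform and coefficients can be recovered
continuously from the diagonal. -/
theorem grad_cas_diag (r : Fin ((n + 1) / 2)) {X : Mat n} (hX : r.1 ≠ 0 → E 0 r.1 X ≠ 0)
    (k : Fin n) : grad (cas r) X k k =
      if r.1 = 0 then 1 else if r.1 ≤ k.1 ∧ k.1 + r.1 < n then -1 else 0 := by
  have h2r := two_mul_lt_of_fin r
  by_cases h : r.1 = 0
  · rw [cas_of_eq_zero h, grad_trace_pow, if_pos h]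
    simp
  rw [if_neg h, cas_of_ne_zero h, grad, Matrix.of_apply]
  refine fderiv_eq_of_line (I_differentiableAt (hX h)) ?_
  set V : Mat n := Matrix.single k k 1 with hV
  have hent : ∀ (t : ℝ) (i j : Fin n), i ≠ j → (X + t • V) i j = X i j := fun t i j hij =>
    line_apply_of_ne X t (by rintro ⟨rfl, rfl⟩; exact hij rfl)
  have hE : ∀ t : ℝ, E 0 r.1 (X + t • V) = E 0 r.1 X := fun t =>
    E_zero_congr h2r.le fun i j hi hj => hent t i j (by
      intro hij; subst hij; omega)
  have hI : ∀ t : ℝ, I 1 r.1 (X + t • V) = I 1 r.1 X - t * ∑ a, V (midIx h2r.le a) (midIx h2r.le a)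
      := by
    intro t
    rw [I_one_eq h2r (by rw [hE]; exact hX h), I_one_eq h2r (hX h), schur, schur, Matrix.trace_sub,
      Matrix.trace_sub]
    have e1 : corner h2r.le (X + t • V) = corner h2r.le X := by
      ext i j
      exact hent t _ _ (fun hh => by
        have := Fin.ext_iff.1 hh
        have := i.2
        have := j.2
        simp only [hiIx, loIx] at *; omega)
    have e2 : (X + t • V).submatrix (midIx h2r.le) (loIx h2r.le) =
        X.submatrix (midIx h2r.le) (loIx h2r.le) := by
      ext i j
      exact hent t _ _ (fun hh => by
        have := Fin.ext_iff.1 hh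
        have := i.2
        have := j.2
        simp only [midIx, loIx] at *; omega)
    have e3 : (X + t • V).submatrix (hiIx h2r.le) (midIx h2r.le) =
        X.submatrix (hiIx h2r.le) (midIx h2r.le) := by
      ext i j
      exact hent t _ _ (fun hh => by
        have := Fin.ext_iff.1 hh
        have := i.2
        have := j.2
        simp only [hiIx, midIx] at *; omega)
    have e4 : ((X + t • V).submatrix (midIx h2r.le) (midIx h2r.le)).trace =
        (X.submatrix (midIx h2r.le) (midIx h2r.le)).trace +
          t * ∑ a, V (midIx h2r.le a) (midIx h2r.le a) := by
      simp only [Matrix.trace, Matrix.diag_apply, Matrix.submatrix_apply, Matrix.add_apply,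
        Matrix.smul_apply, smul_eq_mul, Finset.sum_add_distrib, Finset.mul_sum]
    rw [e1, e2, e3, e4]
    ring
  have hsum : ∑ a, V (midIx h2r.le a) (midIx h2r.le a) =
      if r.1 ≤ k.1 ∧ k.1 + r.1 < n then 1 else 0 := by
    split_ifs with hk
    · rw [Finset.sum_eq_single (⟨k.1 - r.1, by omega⟩ : Fin (n - 2 * r.1))]
      · have : midIx h2r.le (⟨k.1 - r.1, by omega⟩ : Fin (n - 2 * r.1)) = k :=
          Fin.ext (by simp only [midIx]; omega)
        rw [this, hV, Matrix.single_apply_same]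
      · intro a _ ha
        rw [hV, Matrix.single_apply_of_ne]
        rintro ⟨h1, -⟩
        refine ha (Fin.ext ?_)
        have := Fin.ext_iff.1 h1
        simp only [midIx] at this ⊢
        omega
      · simp
    · refine Finset.sum_eq_zero fun a _ => ?_
      rw [hV, Matrix.single_apply_of_ne]
      rintro ⟨h1, -⟩
      have := Fin.ext_iff.1 h1
      have h2 := a.2
      simp only [midIx] at this
      exact hk (by omega)
  have hd := ((hasDerivAt_id (0 : ℝ)).mul_const
    (∑ a, V (midIx h2r.le a) (midIx h2r.le a))).const_sub (I 1 r.1 X)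
  refine hasDerivAt_congr hd hI ?_
  rw [hsum]
  split_ifs <;> simp

/-- The diagonals of the differentials of the Casimirs are linearly independent. -/
theorem cas_diag_matrix_injective (c : Fin ((n + 1) / 2) → ℝ)
    (h : ∀ k : Fin n, ∑ r, c r *
      (if r.1 = 0 then 1 else if r.1 ≤ k.1 ∧ k.1 + r.1 < n then (-1 : ℝ) else 0) = 0) : c = 0 := by
  have main : ∀ (m : ℕ) (r : Fin ((n + 1) / 2)), r.1 = m → c r = 0 := by
    intro m
    induction m using Nat.strong_induction_on with
    | _ m ih =>
      intro r hr
      -- At the diagonal position `r` the members with larger index vanish, and those with smaller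
      -- index are removed by induction.
      obtain ⟨k, hk⟩ : ∃ k : Fin n, k.1 = r.1 :=
        ⟨⟨r.1, by have := two_mul_lt_of_fin r; omega⟩, rfl⟩
      have h1 := h k
      rw [Finset.sum_eq_single r] at h1
      · have h2 := two_mul_lt_of_fin r
        rw [mul_eq_zero] at h1
        refine h1.resolve_right ?_
        split_ifs with h3 h4
        · exact one_ne_zero
        · norm_num
        · exact absurd ⟨hk.ge, by omega⟩ h4
      · intro s _ hs
        rcases lt_trichotomy s.1 r.1 with hlt | heq | hgt
        · rw [ih s.1 (by omega) s rfl, zero_mul]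
        · exact absurd (Fin.ext heq) hs
        · rw [if_neg (by omega), if_neg (by omega), mul_zero]
      · simp
  funext r
  exact main r.1 r rfl

theorem hessGen_cas {X : Mat n} (hX : X ∈ hessGen n) (r : Fin ((n + 1) / 2)) :
    r.1 ≠ 0 → E 0 r.1 X ≠ 0 := hessGen_E_ne_zero hX r.2

theorem linearIndependent_diffH_cas {X : Mat n} (hX : X ∈ hessGen n) :
    LinearIndependent ℝ (fun r : Fin ((n + 1) / 2) => diffH (cas r) X) := by
  rw [Fintype.linearIndependent_iff]
  intro c hc
  refine congrFun (cas_diag_matrix_injective c fun k => ?_)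
  have h1 := congrFun (congrFun hc k) k
  rw [Matrix.sum_apply] at h1
  refine Eq.trans (Finset.sum_congr rfl fun r _ => ?_) h1
  rw [Matrix.smul_apply, diffH_cas r (hessGen_cas hX r), grad_cas_diag r (hessGen_cas hX r),
    smul_eq_mul]

end HessCasimirs

/-! ### The coadjoint action on `ℋ` -/

section Orbits

variable {n : ℕ}

theorem hessReg_subset_hessGen : hessReg n ⊆ hessGen n := fun _ hX =>
  ⟨hX.1, fun r h1 h2 => hX.2 r h1 (by omega)⟩

theorem coadH_mem_hess (b : GL (Fin n) ℝ) (X : Mat n) : coadH b X ∈ hess n := by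
  intro i j hij
  rw [coadH, coad, Matrix.add_apply,
    entryProj_of_not (S := fun i j : Fin n => j ≤ i) (not_le.2 hij), add_zero]

theorem sut_conj_eps {b : Mat n} (hb : UT b) (hdet : b.det ≠ 0) : SUT (b⁻¹ * eps n * b) :=
  ((hb.inv hdet).mul_sut eps_sut).mul_ut hb

/-- An upper triangular conjugate of `ε` is strictly upper, so the translation by `ε` has no effect
on and below the diagonal. -/
theorem coadH_low {b : GL (Fin n) ℝ} (hb : IsUpper b) (X : Mat n) {i j : Fin n} (hij : j ≤ i) :
    coadH b X i j = ((b : Mat n)⁻¹ * X * (b : Mat n)) i j := by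
  rw [coadH, coad, Matrix.add_apply, entryProj_of (S := fun i j : Fin n => j ≤ i) hij, eps_sut i j
    hij,
    zero_add, Matrix.coe_units_inv, Matrix.mul_sub, Matrix.sub_mul, Matrix.sub_apply,
    sut_conj_eps hb (gl_det_ne_zero b) i j hij, sub_zero]

theorem hess_ext {X Y : Mat n} (hX : X ∈ hess n) (hY : Y ∈ hess n)
    (h : ∀ i j, j ≤ i → X i j = Y i j) : X = Y := by
  ext i j
  rcases le_or_gt j i with hij | hij
  · exact h i j hij
  · rw [hX i j hij, hY i j hij]

/-- Strictly upper matrices are stable under multiplication by upper ones from both sides. Modulo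
them the action reads `X b ≡ b Y`, linear in `b`, from which the composition law and the normal form
follow. -/
theorem coadH_eq_of_sut {b : GL (Fin n) ℝ} (hb : IsUpper b) {X Y : Mat n} (hY : Y ∈ hess n)
    (h : SUT (X * (b : Mat n) - (b : Mat n) * Y)) : coadH b X = Y := by
  refine hess_ext (coadH_mem_hess b X) hY fun i j hij => ?_
  rw [coadH_low hb X hij]
  have hu := isUnit_iff_ne_zero.2 (gl_det_ne_zero b)
  have h1 := (UT.inv hb (gl_det_ne_zero b)).mul_sut h i j hij
  rw [Matrix.mul_sub, ← Matrix.mul_assoc, ← Matrix.mul_assoc, Matrix.nonsing_inv_mul _ hu,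
    Matrix.one_mul, Matrix.sub_apply, sub_eq_zero] at h1
  exact h1

theorem sut_of_coadH {b : GL (Fin n) ℝ} (hb : IsUpper b) (X : Mat n) :
    SUT (X * (b : Mat n) - (b : Mat n) * coadH b X) := by
  have hu := isUnit_iff_ne_zero.2 (gl_det_ne_zero b)
  have h1 : SUT ((b : Mat n)⁻¹ * X * (b : Mat n) - coadH b X) := fun i j hij => by
    rw [Matrix.sub_apply, coadH_low hb X hij, sub_self]
  have hb' : UT (b : Mat n) := hb
  have h2 := hb'.mul_sut h1
  rwa [Matrix.mul_sub, ← Matrix.mul_assoc, ← Matrix.mul_assoc, Matrix.mul_nonsing_inv _ hu,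
    Matrix.one_mul] at h2

theorem IsUpper.mul {a b : GL (Fin n) ℝ} (ha : IsUpper a) (hb : IsUpper b) : IsUpper (a * b) := by
  have : UT ((a : Mat n) * (b : Mat n)) := UT.mul ha hb
  exact this

theorem IsUpper.inv {a : GL (Fin n) ℝ} (ha : IsUpper a) : IsUpper a⁻¹ := by
  have : UT ((a : Mat n)⁻¹) := UT.inv ha (gl_det_ne_zero a)
  rw [← Matrix.coe_units_inv] at this
  exact this

theorem coadH_mul {a b : GL (Fin n) ℝ} (ha : IsUpper a) (hb : IsUpper b) (X : Mat n) :
    coadH (a * b) X = coadH b (coadH a X) := by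
  refine coadH_eq_of_sut (ha.mul hb) (coadH_mem_hess _ _) ?_
  have h1 := (sut_of_coadH ha X).mul_ut (B := (b : Mat n)) hb
  have h2 := UT.mul_sut (A := (a : Mat n)) ha (sut_of_coadH hb (coadH a X))
  convert h1.add h2 using 1
  rw [Units.val_mul]
  noncomm_ring

theorem coadH_one {X : Mat n} (hX : X ∈ hess n) : coadH 1 X = X :=
  coadH_eq_of_sut (fun i j h => UT.one i j h) hX (by
    intro i j _; simp)

theorem eq_coadH_of_coadH_eq {a b : GL (Fin n) ℝ} (ha : IsUpper a) (hb : IsUpper b) {X Y : Mat n}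
    (hY : Y ∈ hess n) (h : coadH a X = coadH b Y) : Y = coadH (a * b⁻¹) X := by
  rw [coadH_mul ha hb.inv, h, ← coadH_mul hb hb.inv, mul_inv_cancel, coadH_one hY]

theorem IsBorel.mul {a b : GL (Fin n) ℝ} (ha : IsBorel a) (hb : IsBorel b) : IsBorel (a * b) :=
  ⟨ha.1.mul hb.1, fun i => by
    rw [Units.val_mul, UT.mul_apply_self ha.1 hb.1]
    exact mul_pos (ha.2 i) (hb.2 i)⟩

theorem IsBorel.inv {a : GL (Fin n) ℝ} (ha : IsBorel a) : IsBorel a⁻¹ :=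
  ⟨ha.1.inv, fun i => by
    have h1 := UT.mul_apply_self ha.1 ha.1.inv i
    rw [← Units.val_mul, mul_inv_cancel, Units.val_one, Matrix.one_apply_eq] at h1
    exact (pos_iff_pos_of_mul_pos (by rw [← h1]; exact one_pos)).1 (ha.2 i)⟩

theorem E_zero_coadH {b : GL (Fin n) ℝ} (hb : IsUpper b) {r : ℕ} (h : 2 * r ≤ n) (X : Mat n) :
    E 0 r (coadH b X) = loProd r (b : Mat n) / hiProd r (b : Mat n) * E 0 r X := by
  rw [E_zero_congr_low h fun i j hij => coadH_low hb X hij,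
    E_conj 0 (UT.inParAlg hb r) (gl_det_ne_zero b)]

theorem weight_ne_zero {b : GL (Fin n) ℝ} (hb : IsUpper b) (r : ℕ) :
    loProd r (b : Mat n) / hiProd r (b : Mat n) ≠ 0 :=
  div_ne_zero (loProd_ne_zero (UT.inParAlg hb r) (gl_det_ne_zero b))
    (hiProd_ne_zero (UT.inParAlg hb r) (gl_det_ne_zero b))

theorem weight_pos {b : GL (Fin n) ℝ} (hb : IsBorel b) (r : ℕ) :
    0 < loProd r (b : Mat n) / hiProd r (b : Mat n) :=
  div_pos (Finset.prod_pos fun i _ => hb.2 i) (Finset.prod_pos fun i _ => hb.2 i)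

theorem cas_coadH {b : GL (Fin n) ℝ} (hb : IsUpper b) (r : Fin ((n + 1) / 2)) {X : Mat n}
    (hX : r.1 ≠ 0 → E 0 r.1 X ≠ 0) : cas r (coadH b X) = cas r X := by
  by_cases h : r.1 = 0
  · rw [cas_of_eq_zero h]
    have h1 : (coadH b X).trace = ((b : Mat n)⁻¹ * X * (b : Mat n)).trace :=
      Finset.sum_congr rfl fun i _ => coadH_low hb X le_rfl
    have h2 := trace_conj_pow 1 X (b : Mat n) (gl_det_ne_zero b)
    simp only [pow_one] at h2 ⊢
    rw [h1, h2]
  · have hr := two_mul_lt_of_fin r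
    have hE := hX h
    rw [cas_of_ne_zero h, I_one_congr_low hr (Y := (b : Mat n)⁻¹ * X * (b : Mat n)) _
      fun i j hij => coadH_low hb X hij]
    · rw [I, E_conj _ (UT.inParAlg hb r.1) (gl_det_ne_zero b),
        E_conj _ (UT.inParAlg hb r.1) (gl_det_ne_zero b), I,
        mul_div_mul_left _ _ (weight_ne_zero hb r.1)]
    · rw [E_zero_coadH hb hr.le]
      exact mul_ne_zero (weight_ne_zero hb r.1) hE

theorem coadH_mem_hessReg {b : GL (Fin n) ℝ} (hb : IsUpper b) {X : Mat n} (hX : X ∈ hessReg n) :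
    coadH b X ∈ hessReg n :=
  ⟨coadH_mem_hess b X, fun r h1 h2 => by
    rw [E_zero_coadH hb (by omega)]
    exact mul_ne_zero (weight_ne_zero hb r) (hX.2 r h1 h2)⟩

theorem hessReg_cas {X : Mat n} (hX : X ∈ hessReg n) (r : Fin ((n + 1) / 2)) :
    r.1 ≠ 0 → E 0 r.1 X ≠ 0 := hessGen_cas (hessReg_subset_hessGen hX) r

end Orbits

/-! ### Normal forms -/

section NormalForm

variable {n : ℕ}

/-- The normal forms of regular Hessenberg matrices: a diagonal whose second half vanishes and
an antidiagonal below it. -/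
noncomputable def nf (D σ : Fin n → ℝ) : Mat n := Matrix.of fun i j =>
  if i < j then eps n i j else if i = j then (if 2 * i.1 < n then D i else 0)
    else if i.1 + j.1 + 1 = n then σ j else 0

theorem nf_mem_hess (D σ : Fin n → ℝ) : nf D σ ∈ hess n := fun i j h => by
  rw [nf, Matrix.of_apply, if_pos h]

theorem nf_diag (D σ : Fin n → ℝ) (i : Fin n) :
    nf D σ i i = if 2 * i.1 < n then D i else 0 := by
  rw [nf, Matrix.of_apply, if_neg (lt_irrefl i), if_pos rfl]

theorem nf_low (D σ : Fin n → ℝ) {i j : Fin n} (h : j < i) :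
    nf D σ i j = if i.1 + j.1 + 1 = n then σ j else 0 := by
  rw [nf, Matrix.of_apply, if_neg (not_lt.2 h.le), if_neg (ne_of_gt h)]

/-- The superdiagonal ones of the normal form meet entries of `b` below its diagonal, so in this
range column `j` of the normal form acts as `D j e_j + σ j e_{rev j}`, without the terms whose
half-range condition fails. -/
theorem mul_nf_apply {b : Mat n} (hb : UT b) (D σ : Fin n → ℝ) {i j : Fin n} (hij : j ≤ i) :
    (b * nf D σ) i j = (if i = j then b j j * (if 2 * j.1 < n then D j else 0) else 0) +
      if 2 * j.1 + 1 < n then b i j.rev * σ j else 0 := by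
  have hrev := Fin.val_rev j
  rw [Matrix.mul_apply]
  have hterm : ∀ k, b i k * nf D σ k j =
      (if k = j then (if i = j then b j j * (if 2 * j.1 < n then D j else 0) else 0) else 0) +
        if k = j.rev then (if 2 * j.1 + 1 < n then b i j.rev * σ j else 0) else 0 := by
    intro k
    rcases lt_trichotomy k j with h | h | h
    · rw [hb i k (lt_of_lt_of_le h hij), zero_mul, if_neg (ne_of_lt h), zero_add]
      split_ifs with h1 h2
      · rw [← h1, hb i k (lt_of_lt_of_le h hij), zero_mul]
      · rfl
      · rfl
    · subst h
      rw [nf_diag, if_pos rfl]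
      have h2 : (if k = k.rev then (if 2 * k.1 + 1 < n then b i k.rev * σ k else 0) else 0) = 0 :=
          by
        split_ifs with h1 h2
        · have := Fin.ext_iff.1 h1; omega
        · rfl
        · rfl
      rw [h2, add_zero]
      by_cases h3 : i = k
      · rw [if_pos h3, h3]
      · rw [if_neg h3, hb i k (lt_of_le_of_ne hij (Ne.symm h3)), zero_mul]
    · rw [nf_low D σ h, if_neg (ne_of_gt h), zero_add]
      have hlt := Fin.lt_def.1 h
      by_cases h1 : k = j.rev
      · have h2 := Fin.ext_iff.1 h1
        rw [if_pos h1, if_pos (by omega), if_pos (by omega), h1]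
      · have h2 : k.1 ≠ (j.rev).1 := fun hh => h1 (Fin.ext hh)
        rw [if_neg h1, if_neg (by omega), mul_zero]
  rw [Finset.sum_congr rfl fun k _ => hterm k, Finset.sum_add_distrib, Finset.sum_ite_eq',
    Finset.sum_ite_eq', if_pos (Finset.mem_univ _), if_pos (Finset.mem_univ _)]

theorem corner_solve {r : ℕ} (h : 2 * r ≤ n) {X : Mat n} (hX : E 0 r X ≠ 0) (t : Fin n → ℝ) :
    ∃ x : Fin n → ℝ, (∀ k : Fin n, r ≤ k.1 → x k = 0) ∧
      ∀ i : Fin n, n ≤ i.1 + r → X.mulVec x i = t i := by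
  have hu := isUnit_iff_ne_zero.2 (corner_det_ne_zero h hX)
  set y := (corner h X)⁻¹.mulVec fun a => t (hiIx h a) with hy
  refine ⟨fun k => if hk : k.1 < r then y ⟨k.1, hk⟩ else 0, fun k hk => dif_neg (not_lt.2 hk),
    fun i hi => ?_⟩
  have h1 : (corner h X).mulVec y = fun a => t (hiIx h a) := by
    rw [hy, Matrix.mulVec_mulVec, Matrix.mul_nonsing_inv _ hu, Matrix.one_mulVec]
  have h2 : hiIx h ⟨i.1 - (n - r), by have := i.2; omega⟩ = i :=
    Fin.ext (by simp only [hiIx]; omega)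
  have h3 := congrFun h1 ⟨i.1 - (n - r), by have := i.2; omega⟩
  rw [h2] at h3
  rw [← h3, Matrix.mulVec, Matrix.mulVec, dotProduct, dotProduct]
  symm
  refine Fintype.sum_of_injective (loIx h)
    (fun a b hab => Fin.ext (by simpa [loIx, Fin.ext_iff] using hab)) _ _ ?_ ?_
  · intro k hk
    have : ¬ k.1 < r := fun hlt => hk ⟨⟨k.1, hlt⟩, rfl⟩
    rw [dif_neg this, mul_zero]
  · intro a
    rw [corner, Matrix.submatrix_apply, h2, dif_pos (show (loIx h a).1 < r from a.2)]
    rfl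

theorem corner_injective {r : ℕ} (h : 2 * r ≤ n) {X : Mat n} (hX : E 0 r X ≠ 0) {x : Fin n → ℝ}
    (hx : ∀ k : Fin n, r ≤ k.1 → x k = 0) (h0 : ∀ i : Fin n, n ≤ i.1 + r → X.mulVec x i = 0) :
    x = 0 := by
  have hc := corner_det_ne_zero h hX
  have h1 : (corner h X).mulVec (fun a => x (loIx h a)) = 0 := by
    funext a
    rw [Pi.zero_apply, ← h0 (hiIx h a) (by simp only [hiIx]; omega), Matrix.mulVec, Matrix.mulVec,
      dotProduct, dotProduct]
    refine Fintype.sum_of_injective (loIx h)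
      (fun a b hab => Fin.ext (by simpa [loIx, Fin.ext_iff] using hab)) _ _ ?_ ?_
    · intro k hk
      rw [hx k, mul_zero]
      by_contra hlt
      exact hk ⟨⟨k.1, not_le.1 hlt⟩, rfl⟩
    · intro b; rfl
  have h2 := Matrix.eq_zero_of_mulVec_eq_zero hc h1
  funext k
  by_cases hk : k.1 < r
  · exact congrFun h2 ⟨k.1, hk⟩
  · exact hx k (not_lt.1 hk)

theorem hessReg_E_ne_zero {X : Mat n} (hX : X ∈ hessReg n) {r : ℕ} (h : 2 * r ≤ n) :
    E 0 r X ≠ 0 := by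
  rcases Nat.eq_zero_or_pos r with rfl | h0
  · rw [E_zero_index_eq, Nat.sub_zero, coeff_charpoly_top]
    simp
  · exact hX.2 r h0 (by omega)

/-- Reduction to the normal form by upper triangular matrices. -/
theorem exists_coadH_eq_nf {X : Mat n} (hX : X ∈ hessReg n) : ∃ ρ : Fin n → ℝ,
    (∀ j : Fin n, 2 * j.1 + 1 < n → ρ j ≠ 0) ∧ ∀ σ : Fin n → ℝ, (∀ j, σ j ≠ 0) →
      ∃ (D : Fin n → ℝ) (b : GL (Fin n) ℝ), IsUpper b ∧
        (∀ j : Fin n, 2 * j.1 < n → (b : Mat n) j j = 1) ∧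
        (∀ j : Fin n, 2 * j.1 + 1 < n → (b : Mat n) j.rev j.rev = ρ j / σ j) ∧
        coadH b X = nf D σ := by
  -- First-half columns of `b`: column `j` of `b * nf` vanishes below row `rev j`, so `X v` must
  -- vanish in the last `j` rows. The entries of `v` before `j` are found by inverting the corner of
  -- size `j`.
  have hv : ∀ j : Fin n, ∃ v : Fin n → ℝ, 2 * j.1 < n → (∀ k, j < k → v k = 0) ∧ v j = 1 ∧
      ∀ i : Fin n, n ≤ i.1 + j.1 → X.mulVec v i = 0 := by
    intro j
    by_cases hj : 2 * j.1 < n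
    · obtain ⟨x, hx1, hx2⟩ := corner_solve hj.le (hessReg_E_ne_zero hX hj.le)
        (fun i => - X.mulVec (Pi.single j 1) i)
      refine ⟨x + Pi.single j 1, fun _ => ⟨fun k hk => ?_, ?_, fun i hi => ?_⟩⟩
      · rw [Pi.add_apply, hx1 k (Fin.lt_def.1 hk).le, Pi.single_eq_of_ne (ne_of_gt hk), add_zero]
      · rw [Pi.add_apply, hx1 j le_rfl, Pi.single_eq_same, zero_add]
      · rw [Matrix.mulVec_add, Pi.add_apply, hx2 i hi, neg_add_cancel]
    · exact ⟨0, fun h => absurd h hj⟩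
  choose v hv using hv
  -- `ρ j` is the entry of `X v_j` on the antidiagonal. If it vanished, the invertible corner of
  -- size `j + 1` would annihilate `v_j`, whose entry `j` is `1`.
  refine ⟨fun j => X.mulVec (v j) j.rev, fun j hj h0 => ?_, fun σ hσ => ?_⟩
  · obtain ⟨h1, h2, h3⟩ := hv j (by omega)
    have h4 : v j = 0 := corner_injective (r := j.1 + 1) (by omega)
      (hessReg_E_ne_zero hX (by omega)) (fun k hk => h1 k (Fin.lt_def.2 (by omega)))
      (fun i hi => by
        by_cases hi' : n ≤ i.1 + j.1
        · exact h3 i hi'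
        · have : i = j.rev := Fin.ext (by rw [Fin.val_rev]; omega)
          rw [this]; exact h0)
    rw [h4] at h2
    exact zero_ne_one h2
  -- Column `rev j` of `b`: matching column `j` of `X b` and `b * nf` forces its entries below row
  -- `j`. The remaining `j + 1` entries make the last `j + 1` rows of `X w` vanish, as the zero
  -- second half of the diagonal demands.
  have hw : ∀ j : Fin n, ∃ w : Fin n → ℝ, 2 * j.1 + 1 < n →
      (∀ k, j < k → w k = X.mulVec (v j) k / σ j) ∧
      ∀ i : Fin n, n ≤ i.1 + (j.1 + 1) → X.mulVec w i = 0 := by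
    intro j
    by_cases hj : 2 * j.1 + 1 < n
    · set u : Fin n → ℝ := fun k => if j < k then X.mulVec (v j) k / σ j else 0 with hu
      obtain ⟨x, hx1, hx2⟩ := corner_solve (r := j.1 + 1) (by omega)
        (hessReg_E_ne_zero hX (by omega)) (fun i => - X.mulVec u i)
      refine ⟨x + u, fun _ => ⟨fun k hk => ?_, fun i hi => ?_⟩⟩
      · rw [Pi.add_apply, hx1 k (by have := Fin.lt_def.1 hk; omega), zero_add, hu]
        exact if_pos hk
      · rw [Matrix.mulVec_add, Pi.add_apply, hx2 i hi, neg_add_cancel]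
    · exact ⟨0, fun h => absurd h hj⟩
  choose w hw using hw
  set b : Mat n := Matrix.of fun i j => if 2 * j.1 < n then v j i else w j.rev i with hb
  have hbv : ∀ i j : Fin n, 2 * j.1 < n → b i j = v j i := fun i j hj => by
    rw [hb, Matrix.of_apply, if_pos hj]
  have hbw : ∀ i j : Fin n, 2 * j.1 + 1 < n → b i j.rev = w j i := fun i j hj => by
    rw [hb, Matrix.of_apply, if_neg (by rw [Fin.val_rev]; omega), Fin.rev_rev]
  have hrevlt : ∀ j : Fin n, 2 * j.1 + 1 < n → j < j.rev := fun j hj =>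
    Fin.lt_def.2 (by rw [Fin.val_rev]; omega)
  have hcases : ∀ j : Fin n, 2 * j.1 < n ∨ ∃ i : Fin n, 2 * i.1 + 1 < n ∧ j = i.rev := fun j => by
    rcases lt_or_ge (2 * j.1) n with h | h
    · exact Or.inl h
    · exact Or.inr ⟨j.rev, by have := j.2; rw [Fin.val_rev]; omega, (Fin.rev_rev j).symm⟩
  have hut : UT b := by
    intro i j hij
    rcases hcases j with hj | ⟨j, hj, rfl⟩
    · rw [hbv i j hj]
      exact (hv j hj).1 i hij
    · have h1 := Fin.lt_def.1 hij
      rw [Fin.val_rev] at h1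
      rw [hbw i j hj, (hw j hj).1 i (lt_trans (hrevlt j hj) hij),
        (hv j (by omega)).2.2 i (by omega), zero_div]
  have hd1 : ∀ j : Fin n, 2 * j.1 < n → b j j = 1 := fun j hj => by
    rw [hbv j j hj]; exact (hv j hj).2.1
  have hd2 : ∀ j : Fin n, 2 * j.1 + 1 < n → b j.rev j.rev = X.mulVec (v j) j.rev / σ j :=
    fun j hj => by rw [hbw _ j hj, (hw j hj).1 _ (hrevlt j hj)]
  have hρ : ∀ j : Fin n, 2 * j.1 + 1 < n → X.mulVec (v j) j.rev ≠ 0 := by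
    intro j hj h0
    obtain ⟨h1, h2, h3⟩ := hv j (by omega)
    have h4 : v j = 0 := corner_injective (r := j.1 + 1) (by omega)
      (hessReg_E_ne_zero hX (by omega)) (fun k hk => h1 k (Fin.lt_def.2 (by omega)))
      (fun i hi => by
        by_cases hi' : n ≤ i.1 + j.1
        · exact h3 i hi'
        · have : i = j.rev := Fin.ext (by rw [Fin.val_rev]; omega)
          rw [this]; exact h0)
    rw [h4] at h2
    exact zero_ne_one h2
  have hdet : b.det ≠ 0 := by
    rw [hut.det]
    refine Finset.prod_ne_zero_iff.2 fun j _ => ?_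
    rcases hcases j with hj | ⟨j, hj, rfl⟩
    · rw [hd1 j hj]; exact one_ne_zero
    · rw [hd2 j hj]; exact div_ne_zero (hρ j hj) (hσ j)
  have hXb : ∀ i j : Fin n, (X * b) i j = X.mulVec (fun k => b k j) i := fun i j => rfl
  set D : Fin n → ℝ := fun j => (X * b) j j - if 2 * j.1 + 1 < n then b j j.rev * σ j else 0 with hD
  refine ⟨D, Matrix.GeneralLinearGroup.mkOfDetNeZero b hdet, hut, hd1, hd2, ?_⟩
  refine coadH_eq_of_sut (b := Matrix.GeneralLinearGroup.mkOfDetNeZero b hdet) hut (nf_mem_hess _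
    _) fun i j hij => ?_
  change (X * b - b * nf D σ) i j = 0
  rw [Matrix.sub_apply, mul_nf_apply hut D σ hij, sub_eq_zero]
  by_cases hj : 2 * j.1 < n
  · have hcol : (fun k => b k j) = v j := funext fun k => hbv k j hj
    rcases eq_or_lt_of_le hij with rfl | hlt
    · rw [if_pos rfl, if_pos hj, hd1 j hj, one_mul, hD]
      simp
    · rw [if_neg (ne_of_gt hlt), zero_add, hXb, hcol]
      split_ifs with hj2
      · rw [hbw i j hj2, (hw j hj2).1 i hlt, div_mul_cancel₀ _ (hσ j)]
      · exact (hv j hj).2.2 i (by have := Fin.lt_def.1 hlt; omega)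
  · obtain ⟨k, hk, hjk⟩ : ∃ k : Fin n, 2 * k.1 + 1 < n ∧ j = k.rev :=
      (hcases j).resolve_left hj
    have hcol : (fun a => b a j) = w k := funext fun a => by rw [hjk, hbw a k hk]
    have hkv : j.1 = n - (k.1 + 1) := by rw [hjk, Fin.val_rev]
    rw [if_neg hj, mul_zero, ite_self, if_neg (by omega), zero_add, hXb, hcol]
    exact (hw k hk).2 i (by have := Fin.le_def.1 hij; have := k.2; omega)

/-- The corner of a normal form is antidiagonal with entries `σ`. The factor `e` is common to all
normal forms, so ratios and signs can be compared. -/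
theorem exists_E_zero_nf {r : ℕ} (h : 2 * r ≤ n) : ∃ e : ℝ, e ≠ 0 ∧ ∀ D σ : Fin n → ℝ,
    E 0 r (nf D σ) = e * ∏ i : Fin n with i.1 < r, σ i := by
  obtain ⟨s, hs0, hs, -⟩ := exists_E_eq h
  refine ⟨s * (Equiv.Perm.sign (Fin.revPerm : Equiv.Perm (Fin r)) : ℤ), mul_ne_zero hs0 ?_,
    fun D σ => ?_⟩
  · rcases Int.units_eq_one_or (Equiv.Perm.sign (Fin.revPerm : Equiv.Perm (Fin r))) with h1 | h1 <;>
      simp [h1]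
  have h1 : corner h (nf D σ) =
      (Matrix.diagonal fun a => σ (loIx h a)).submatrix (Fin.revPerm : Equiv.Perm (Fin r)) id := by
    ext a c
    have ha := a.2
    have hc := c.2
    rw [corner, Matrix.submatrix_apply, nf_low D σ
      (Fin.lt_def.2 (by simp only [hiIx, loIx]; omega)),
      Matrix.submatrix_apply, id, Fin.revPerm_apply, Matrix.diagonal_apply]
    have h2 : (hiIx h a).1 + (loIx h c).1 + 1 = n ↔ a.rev = c := by
      rw [Fin.ext_iff, Fin.val_rev]
      simp only [hiIx, loIx]
      omega
    simp only [h2]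
    split_ifs with h3
    · rw [h3]
    · rfl
  rw [hs, h1, Matrix.det_permute, Matrix.det_diagonal, mul_assoc]
  congr 2
  refine Finset.prod_bij (fun a _ => loIx h a) (fun a _ => by simp [loIx])
    (fun a _ c _ hac => Fin.ext (by simpa [loIx, Fin.ext_iff] using hac)) (fun i hi => ?_)
    (fun _ _ => rfl)
  exact ⟨⟨i.1, (Finset.mem_filter.1 hi).2⟩, Finset.mem_univ _, rfl⟩

theorem nf_mem_hessReg (D : Fin n → ℝ) {σ : Fin n → ℝ} (hσ : ∀ j, σ j ≠ 0) : nf D σ ∈ hessReg n :=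
  ⟨nf_mem_hess D σ, fun r _ h2 => by
    obtain ⟨e, he, hE⟩ := exists_E_zero_nf (n := n) (r := r) (by omega)
    rw [hE]
    exact mul_ne_zero he (Finset.prod_ne_zero_iff.2 fun i _ => hσ i)⟩

/-- The middle rows of a normal form vanish in the first `r` columns, so the Schur complement is the
middle block. Its trace is a tail sum of `D`, and these sums determine `D` successively. -/
theorem cas_nf (r : Fin ((n + 1) / 2)) (D : Fin n → ℝ) {σ : Fin n → ℝ} (hσ : ∀ j, σ j ≠ 0) :
    cas r (nf D σ) = (if r.1 = 0 then 1 else -1) *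
      ∑ k : Fin n with r.1 ≤ k.1, if 2 * k.1 < n then D k else 0 := by
  have hr := two_mul_lt_of_fin r
  by_cases h : r.1 = 0
  · rw [if_pos h, one_mul, h, cas, if_pos h, Matrix.trace]
    simp only [Nat.zero_le, Finset.filter_true, Matrix.diag_apply, nf_diag]
  · rw [if_neg h, cas, if_neg h, I_one_eq hr (hessReg_E_ne_zero (nf_mem_hessReg D hσ) hr.le), schur]
    have h0 : (nf D σ).submatrix (midIx hr.le) (loIx hr.le) = 0 := by
      ext a c
      have ha := a.2
      have hc := c.2
      rw [Matrix.submatrix_apply, nf_low D σ (Fin.lt_def.2 (by simp only [midIx, loIx]; omega)),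
        if_neg (by simp only [midIx, loIx]; omega), Matrix.zero_apply]
    rw [h0, Matrix.zero_mul, Matrix.zero_mul, sub_zero, neg_one_mul, neg_inj, Matrix.trace]
    simp only [Matrix.diag_apply, Matrix.submatrix_apply, nf_diag]
    rw [Finset.sum_filter]
    refine Fintype.sum_of_injective (midIx hr.le) (fun a c hac => ?_) _ _ (fun k hk => ?_)
      (fun a => ?_)
    · have := Fin.ext_iff.1 hac
      simp only [midIx] at this
      exact Fin.ext (by omega)
    · split_ifs with h1 h2
      · exact absurd ⟨⟨k.1 - r.1, by omega⟩, Fin.ext (by simp only [midIx]; omega)⟩ hk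
      · rfl
      · rfl
    · rw [if_pos (show r.1 ≤ (midIx hr.le a).1 by simp [midIx])]

theorem nf_congr {D D' σ σ' : Fin n → ℝ} (hD : ∀ k : Fin n, 2 * k.1 < n → D k = D' k)
    (hσ : ∀ k : Fin n, 2 * k.1 + 1 < n → σ k = σ' k) : nf D σ = nf D' σ' := by
  refine hess_ext (nf_mem_hess _ _) (nf_mem_hess _ _) fun i j hij => ?_
  rcases eq_or_lt_of_le hij with rfl | hlt
  · rw [nf_diag, nf_diag]
    split_ifs with h
    · exact hD j h
    · rfl
  · rw [nf_low _ _ hlt, nf_low _ _ hlt]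
    split_ifs with h
    · exact hσ j (by have := Fin.lt_def.1 hlt; omega)
    · rfl

theorem diag_eq_of_cas_nf {D D' σ σ' : Fin n → ℝ} (hσ : ∀ j, σ j ≠ 0) (hσ' : ∀ j, σ' j ≠ 0)
    (h : ∀ r : Fin ((n + 1) / 2), cas r (nf D σ) = cas r (nf D' σ')) (k : Fin n)
    (hk : 2 * k.1 < n) : D k = D' k := by
  have hT : ∀ r : ℕ, (∑ k : Fin n with r ≤ k.1, if 2 * k.1 < n then D k else 0) =
      ∑ k : Fin n with r ≤ k.1, if 2 * k.1 < n then D' k else 0 := by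
    intro r
    by_cases hr : r < (n + 1) / 2
    · have h1 := h ⟨r, hr⟩
      rw [cas_nf _ _ hσ, cas_nf _ _ hσ'] at h1
      exact mul_left_cancel₀ (by split_ifs <;> norm_num) h1
    · refine Finset.sum_congr rfl fun k hk => ?_
      have := (Finset.mem_filter.1 hk).2
      rw [if_neg (by omega), if_neg (by omega)]
  have hsplit : ∀ D : Fin n → ℝ, (∑ i : Fin n with k.1 ≤ i.1, if 2 * i.1 < n then D i else 0) =
      D k + ∑ i : Fin n with k.1 + 1 ≤ i.1, if 2 * i.1 < n then D i else 0 := by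
    intro D
    have h1 : (Finset.univ.filter fun i : Fin n => k.1 ≤ i.1) =
        insert k (Finset.univ.filter fun i : Fin n => k.1 + 1 ≤ i.1) := by
      ext i
      simp only [Finset.mem_filter, Finset.mem_univ, true_and, Finset.mem_insert, Fin.ext_iff]
      omega
    rw [h1, Finset.sum_insert (by simp), if_pos hk]
  have h1 := hT k.1
  rw [hsplit D, hsplit D', hT (k.1 + 1)] at h1
  exact add_right_cancel h1

/-- Two points of a level set have normal forms with `σ = 1`; the Casimirs give them the same `D`,
so the normal forms coincide. -/
theorem levelSet_eq_upper_orbit {X : Mat n} (hX : X ∈ hessReg n) :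
    levelSet X = {Y | ∃ b : GL (Fin n) ℝ, IsUpper b ∧ Y = coadH b X} := by
  ext Y
  constructor
  · rintro ⟨hY, hcas⟩
    obtain ⟨ρ, -, h1⟩ := exists_coadH_eq_nf hX
    obtain ⟨ρ', -, h2⟩ := exists_coadH_eq_nf hY
    obtain ⟨D, a, ha, -, -, hXa⟩ := h1 (fun _ => 1) (fun _ => one_ne_zero)
    obtain ⟨D', b, hb, -, -, hYb⟩ := h2 (fun _ => 1) (fun _ => one_ne_zero)
    have hD : ∀ k : Fin n, 2 * k.1 < n → D k = D' k :=
      diag_eq_of_cas_nf (fun _ => one_ne_zero) (fun _ => one_ne_zero) fun r => by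
        rw [← hXa, ← hYb, cas_coadH ha r (hessReg_cas hX r), cas_coadH hb r (hessReg_cas hY r),
          hcas r]
    have heq : coadH a X = coadH b Y := by
      rw [hXa, hYb, nf_congr hD fun _ _ => rfl]
    exact ⟨a * b⁻¹, ha.mul hb.inv, eq_coadH_of_coadH_eq ha hb hY.1 heq⟩
  · rintro ⟨b, hb, rfl⟩
    exact ⟨coadH_mem_hessReg hb hX, fun r => cas_coadH hb r (hessReg_cas hX r)⟩

theorem exists_borel_coadH_eq_nf {X : Mat n} (hX : X ∈ hessReg n) : ∃ (D σ : Fin n → ℝ)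
    (b : GL (Fin n) ℝ), (∀ j, σ j = 1 ∨ σ j = -1) ∧ IsBorel b ∧ coadH b X = nf D σ := by
  obtain ⟨ρ, hρ, h1⟩ := exists_coadH_eq_nf hX
  -- The second half of the diagonal of `b` consists of the quotients `ρ j / σ j`, so this choice of
  -- signs puts `b` in the identity component.
  set σ : Fin n → ℝ := fun j => if 0 < ρ j then 1 else -1 with hσ
  have hσ1 : ∀ j, σ j = 1 ∨ σ j = -1 := fun j => by
    simp only [hσ]; split_ifs <;> simp
  have hσ0 : ∀ j, σ j ≠ 0 := fun j => by
    rcases hσ1 j with h | h <;> rw [h] <;> norm_num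
  obtain ⟨D, b, hb, hd1, hd2, hXb⟩ := h1 σ hσ0
  refine ⟨D, σ, b, hσ1, ⟨hb, fun j => ?_⟩, hXb⟩
  rcases lt_or_ge (2 * j.1) n with h | h
  · rw [hd1 j h]; exact one_pos
  · have hlt : 2 * j.rev.1 + 1 < n := by have := j.2; rw [Fin.val_rev]; omega
    have h2 := hd2 j.rev hlt
    rw [Fin.rev_rev] at h2
    rw [h2]
    simp only [hσ]
    split_ifs with h3
    · simpa using h3
    · rw [div_neg, div_one, Left.neg_pos_iff]
      exact lt_of_le_of_ne (not_lt.1 h3) (hρ _ hlt)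

/-- The `B`-orbit of a regular point is cut out by the Casimirs and the signs of the `E_{0,r}`. -/
theorem mem_orbitB_iff {X Y : Mat n} (hX : X ∈ hessReg n) : Y ∈ orbitB X ↔
    Y ∈ levelSet X ∧ ∀ r, 1 ≤ r → r ≤ n / 2 → 0 < E 0 r X * E 0 r Y := by
  constructor
  · rintro ⟨b, hb, rfl⟩
    refine ⟨⟨coadH_mem_hessReg hb.1 hX, fun r => cas_coadH hb.1 r (hessReg_cas hX r)⟩,
      fun r h1 h2 => ?_⟩
    rw [E_zero_coadH hb.1 (by omega), mul_left_comm]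
    exact mul_pos (weight_pos hb r) (mul_self_pos.2 (hX.2 r h1 h2))
  · rintro ⟨⟨hY, hcas⟩, hsign⟩
    obtain ⟨D, σ, a, hσ, ha, hXa⟩ := exists_borel_coadH_eq_nf hX
    obtain ⟨D', σ', b, hσ', hb, hYb⟩ := exists_borel_coadH_eq_nf hY
    have hσ0 : ∀ j, σ j ≠ 0 := fun j => by
      rcases hσ j with h | h <;> rw [h] <;> norm_num
    have hσ0' : ∀ j, σ' j ≠ 0 := fun j => by
      rcases hσ' j with h | h <;> rw [h] <;> norm_num
    have hD : ∀ k : Fin n, 2 * k.1 < n → D k = D' k :=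
      diag_eq_of_cas_nf hσ0 hσ0' fun r => by
        rw [← hXa, ← hYb, cas_coadH ha.1 r (hessReg_cas hX r),
          cas_coadH hb.1 r (hessReg_cas hY r), hcas r]
    -- The sign of `E_{0,r}` survives passage to the normal form, where it is that of a product of
    -- the first `r` entries of `σ`. Comparing consecutive products identifies the single signs.
    have hprod : ∀ r, 2 * r ≤ n → 0 < ∏ i : Fin n with i.1 < r, σ i * σ' i := by
      intro r hr
      rcases Nat.eq_zero_or_pos r with rfl | h0
      · simp
      obtain ⟨e, he, hE⟩ := exists_E_zero_nf hr
      have h1 := hE D σ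
      have h2 := hE D' σ'
      rw [← hXa, E_zero_coadH ha.1 hr] at h1
      rw [← hYb, E_zero_coadH hb.1 hr] at h2
      have h3 := mul_pos (mul_pos (weight_pos ha r) (weight_pos hb r)) (hsign r h0 (by omega))
      rw [mul_mul_mul_comm, h1, h2, mul_mul_mul_comm, ← Finset.prod_mul_distrib] at h3
      exact (pos_iff_pos_of_mul_pos h3).1 (mul_self_pos.2 he)
    have hs : ∀ k : Fin n, 2 * k.1 + 1 < n → σ k = σ' k := by
      intro k hk
      have h1 := hprod k.1 (by omega)
      have h2 := hprod (k.1 + 1) (by omega)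
      have h3 : (Finset.univ.filter fun i : Fin n => i.1 < k.1 + 1) =
          insert k (Finset.univ.filter fun i : Fin n => i.1 < k.1) := by
        ext i
        simp only [Finset.mem_filter, Finset.mem_univ, true_and, Finset.mem_insert, Fin.ext_iff]
        omega
      rw [h3, Finset.prod_insert (by simp)] at h2
      have h4 := (pos_iff_pos_of_mul_pos h2).2 h1
      rcases hσ k with h5 | h5 <;> rcases hσ' k with h6 | h6 <;> rw [h5, h6] at h4 ⊢ <;>
        norm_num at h4
    have heq : coadH a X = coadH b Y := by
      rw [hXa, hYb, nf_congr hD hs]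
    exact ⟨a * b⁻¹, ha.mul hb.inv, eq_coadH_of_coadH_eq ha.1 hb.1 hY.1 heq⟩

end NormalForm


/-! ### Zariski open subsets of `ℋ` -/

section Zariski

variable {n : ℕ}

/-- The equation of `genericUpTo n K`. -/
noncomputable def genPoly (n K : ℕ) : MvPolynomial (Fin n × Fin n) ℝ :=
  ∏ r ∈ Finset.Icc 1 K, EPoly n 0 r

theorem evalAt_genPoly (K : ℕ) (X : Mat n) :
    evalAt (genPoly n K) X = ∏ r ∈ Finset.Icc 1 K, E 0 r X := by
  rw [genPoly, evalAt, map_prod]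
  exact Finset.prod_congr rfl fun r _ => (E_eq_evalAt 0 r X).symm

theorem genericUpTo_eq (K : ℕ) :
    genericUpTo n K = {X | X ∈ hess n ∧ evalAt (genPoly n K) X ≠ 0} := by
  ext X
  simp only [genericUpTo, Set.mem_ofPred_eq, evalAt_genPoly, Finset.prod_ne_zero_iff,
    Finset.mem_Icc, and_imp]

theorem nf_one_mem_hessReg (n : ℕ) : nf (0 : Fin n → ℝ) 1 ∈ hessReg n :=
  nf_mem_hessReg 0 fun _ => one_ne_zero

theorem line_mem_hess {X Y : Mat n} (hX : X ∈ hess n) (hY : Y ∈ hess n) (t : ℝ) :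
    X + t • (Y - X) ∈ hess n := fun i j hij => by
  rw [Matrix.add_apply, Matrix.smul_apply, Matrix.sub_apply, hX i j hij, hY i j hij, sub_self,
    smul_zero, add_zero]

/-- Along a line through a point of a Zariski open set, all but finitely many points lie in the
set. -/
theorem eventually_evalAt_line_ne_zero (d : MvPolynomial (Fin n × Fin n) ℝ) (X : Mat n) {Y : Mat n}
    (hY : evalAt d Y ≠ 0) : ∀ᶠ t : ℝ in nhdsWithin 0 {0}ᶜ, evalAt d (X + t • (Y - X)) ≠ 0 := by
  set p : Polynomial ℝ := MvPolynomial.aeval (fun ij : Fin n × Fin n =>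
    Polynomial.C (X ij.1 ij.2) + Polynomial.X * Polynomial.C ((Y - X) ij.1 ij.2)) d with hp
  have hev : ∀ t : ℝ, p.eval t = evalAt d (X + t • (Y - X)) := by
    intro t
    have h : (Polynomial.aeval t).comp (MvPolynomial.aeval (fun ij : Fin n × Fin n =>
        Polynomial.C (X ij.1 ij.2) + Polynomial.X * Polynomial.C ((Y - X) ij.1 ij.2))) =
        (MvPolynomial.aeval fun ij : Fin n × Fin n => (X + t • (Y - X)) ij.1 ij.2 :
          MvPolynomial (Fin n × Fin n) ℝ →ₐ[ℝ] ℝ) := by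
      ext ij
      simp
    have h2 := DFunLike.congr_fun h d
    rw [AlgHom.comp_apply, Polynomial.coe_aeval_eq_eval] at h2
    rw [hp, h2, evalAt, MvPolynomial.aeval_eq_eval]
  have hp0 : p ≠ 0 := fun h0 => hY (by
    have := hev 1
    rw [h0, Polynomial.eval_zero, one_smul, add_sub_cancel] at this
    exact this.symm)
  have hfin : {t : ℝ | p.eval t = 0}.Finite := by
    refine (p.roots.toFinset.finite_toSet).subset fun t ht => ?_
    simp only [Finset.mem_coe, Multiset.mem_toFinset, Polynomial.mem_roots hp0]
    exact ht
  rw [eventually_nhdsWithin_iff]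
  filter_upwards [(hfin.subset (Set.sdiff_subset (t := {0}))).isClosed.compl_mem_nhds
    (x := (0 : ℝ)) (by simp)] with t ht ht0 h
  exact ht ⟨by rw [Set.mem_ofPred_eq, hev, h], ht0⟩

end Zariski

/-! ### The rank of the bracket on `ℋ` -/

section Rank

variable {n : ℕ}

/-- The upper triangular matrices. -/
def utSub (n : ℕ) : Submodule ℝ (Mat n) where
  carrier := {A | UT A}
  add_mem' ha hb := UT.add ha hb
  zero_mem' := fun _ _ _ => rfl
  smul_mem' c _ ha := UT.smul c ha

theorem diffH_mem_utSub (f : Mat n → ℝ) (X : Mat n) : diffH f X ∈ utSub n := entryProj_le_ut _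

/-- Upper triangular matrices as functions on the set of the positions. -/
def utEquiv (n : ℕ) : utSub n ≃ₗ[ℝ] ({ij : Fin n × Fin n // ij.1 ≤ ij.2} → ℝ) where
  toFun A ij := A.1 ij.1.1 ij.1.2
  map_add' _ _ := rfl
  map_smul' _ _ := rfl
  invFun f := ⟨Matrix.of fun i j => if h : i ≤ j then f ⟨(i, j), h⟩ else 0, fun i j hij => by
    rw [Matrix.of_apply, dif_neg (not_le.2 hij)]⟩
  left_inv A := by
    ext i j
    simp only [Matrix.of_apply]
    split_ifs with h
    · rfl
    · exact (A.2 i j (not_le.1 h)).symm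
  right_inv f := by
    funext ij
    simp only [Matrix.of_apply, dif_pos ij.2]

theorem card_upper (n : ℕ) :
    Fintype.card {ij : Fin n × Fin n // ij.1 ≤ ij.2} = n * (n + 1) / 2 := by
  have h1 : Fintype.card {ij : Fin n × Fin n // ij.1 ≤ ij.2} =
      ∑ j : Fin n, (j.1 + 1) := by
    rw [Fintype.card_subtype, Finset.card_filter, Fintype.sum_prod_type_right]
    refine Finset.sum_congr rfl fun j _ => ?_
    rw [← Finset.card_filter]
    exact (congrArg Finset.card (Finset.ext fun i => by simp)).trans (Fin.card_Iic j)
  rw [h1, Fin.sum_univ_eq_sum_range (fun i => i + 1) n, Finset.sum_add_distrib,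
    Finset.sum_range_id, Finset.sum_const, Finset.card_range, smul_eq_mul, mul_one]
  rcases n with _ | k
  · rfl
  · have h2 := Nat.even_mul_succ_self k
    obtain ⟨q, hq⟩ := h2
    have e1 : (k + 1) * (k + 1 - 1) = 2 * q := by rw [Nat.add_sub_cancel, Nat.mul_comm]; omega
    have e2 : (k + 1) * (k + 1 + 1) = 2 * (q + (k + 1)) := by nlinarith
    rw [e1, e2, Nat.mul_div_cancel_left _ two_pos, Nat.mul_div_cancel_left _ two_pos]

theorem finrank_utSub (n : ℕ) : Module.finrank ℝ (utSub n) = n * (n + 1) / 2 := by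
  rw [(utEquiv n).finrank_eq, Module.finrank_fintype_fun_eq_card, card_upper]

/-- The Poisson tensor at `X`. -/
noncomputable def hamLin (X : Mat n) : utSub n →ₗ[ℝ] Mat n :=
  entryProjₗ (fun i j => j ≤ i) ∘ₗ
    (LinearMap.mulRight ℝ X - LinearMap.mulLeft ℝ X) ∘ₗ (utSub n).subtype

theorem hamLin_apply (X : Mat n) (Y : utSub n) :
    hamLin X Y = entryProj (fun i j => j ≤ i) (Y.1 * X - X * Y.1) := rfl

theorem hamVec_eq_hamLin (h : Mat n → ℝ) (X : Mat n) :
    hamVec h X = hamLin X ⟨diffH h X, diffH_mem_utSub h X⟩ := rfl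

theorem hamLin_eq_zero_iff {X : Mat n} {Y : utSub n} :
    hamLin X Y = 0 ↔ SUT (Y.1 * X - X * Y.1) := by
  rw [hamLin_apply]
  constructor
  · intro h i j hij
    have h1 := congrFun (congrFun h i) j
    rwa [entryProj_of (S := fun i j : Fin n => j ≤ i) hij] at h1
  · intro h
    ext i j
    by_cases hij : j ≤ i
    · rw [entryProj_of (S := fun i j : Fin n => j ≤ i) hij, h i j hij, Matrix.zero_apply]
    · rw [entryProj_of_not (S := fun i j : Fin n => j ≤ i) hij, Matrix.zero_apply]

theorem diffH_trLin {Y : Mat n} (hY : UT Y) (X : Mat n) : diffH (trLin Y) X = Y := by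
  rw [diffH, grad_trLin]
  exact entryProj_eq_self fun i j h => hY i j (not_le.1 h)

theorem charSpace_eq_range (X : Mat n) : charSpace X = LinearMap.range (hamLin X) := by
  refine le_antisymm (Submodule.span_le.2 ?_) ?_
  · rintro _ ⟨h, -, rfl⟩
    exact ⟨_, (hamVec_eq_hamLin h X).symm⟩
  · rintro _ ⟨Y, rfl⟩
    refine Submodule.subset_span ⟨trLin Y.1, (trLin Y.1).differentiableAt, ?_⟩
    rw [hamVec_eq_hamLin]
    congr 1
    exact Subtype.ext (diffH_trLin Y.2 X).symm

theorem finrank_charSpace_add_ker (X : Mat n) :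
    Module.finrank ℝ (charSpace X) + Module.finrank ℝ (LinearMap.ker (hamLin X)) =
      n * (n + 1) / 2 := by
  rw [charSpace_eq_range, (hamLin X).finrank_range_add_finrank_ker, finrank_utSub]

theorem bracketH_eq_trace_hamLin (f g : Mat n → ℝ) (X : Mat n) :
    bracketH f g X = (diffH f X * hamLin X ⟨diffH g X, diffH_mem_utSub g X⟩).trace := by
  rw [bracketH, bracket_eq_trace, hamLin_apply]
  have h : entryProj (· ≤ ·) (diffH f X) = diffH f X :=
    entryProj_eq_self fun i j h => entryProj_le_ut _ i j (not_le.1 h)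
  change (diffH f X * (diffH g X * X - X * diffH g X)).trace = _
  rw [← trace_entryProj_mul (· ≤ ·), h]

/-- The trace pairs `𝔟₊` and `𝔟₋` perfectly, and linear functions realize every element of `𝔟₊` as a
differential. -/
theorem hamLin_diffH_eq_zero {f : Mat n → ℝ} {X : Mat n}
    (h : ∀ g : Mat n → ℝ, DifferentiableAt ℝ g X → bracketH f g X = 0) :
    hamLin X ⟨diffH f X, diffH_mem_utSub f X⟩ = 0 := by
  refine ext_trace fun V => ?_
  have h1 := h (trLin (entryProj (· ≤ ·) V)) (trLin _).differentiableAt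
  rw [bracketH, bracket_antisymm, neg_eq_zero] at h1
  change bracketH _ _ X = 0 at h1
  rw [bracketH_eq_trace_hamLin, diffH_trLin (entryProj_le_ut V)] at h1
  rw [Matrix.zero_mul, Matrix.trace_zero, Matrix.trace_mul_comm, ← h1, trace_entryProj_mul]
  congr 2
  refine (entryProj_eq_self fun i j hij => ?_).symm
  rw [hamLin_apply, entryProj_of_not (S := fun i j : Fin n => j ≤ i) hij]

theorem hamLin_diffH_cas (r : Fin ((n + 1) / 2)) {X : Mat n} (hX : X ∈ hess n)
    (hE : E 0 r.1 X ≠ 0) :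
    hamLin X ⟨diffH (cas r) X, diffH_mem_utSub (cas r) X⟩ = 0 :=
  hamLin_diffH_eq_zero ((isCasimirOn_cas r X ⟨hX, hE⟩).2)

theorem nf_mul_apply {b : Mat n} (hb : UT b) (D σ : Fin n → ℝ) {i j : Fin n} (hij : j ≤ i) :
    (nf D σ * b) i j = (if i = j then b j j * (if 2 * j.1 < n then D j else 0) else 0) +
      if 2 * i.rev.1 + 1 < n then σ i.rev * b i.rev j else 0 := by
  have hrev := Fin.val_rev i
  rw [Matrix.mul_apply]
  have hterm : ∀ k, nf D σ i k * b k j =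
      (if k = i then (if i = j then b j j * (if 2 * j.1 < n then D j else 0) else 0) else 0) +
        if k = i.rev then (if 2 * i.rev.1 + 1 < n then σ i.rev * b i.rev j else 0) else 0 := by
    intro k
    rcases lt_trichotomy i k with h | h | h
    · rw [hb k j (lt_of_le_of_lt hij h), mul_zero, if_neg (ne_of_gt h), zero_add]
      split_ifs with h1 h2
      · rw [← h1, hb k j (lt_of_le_of_lt hij h), mul_zero]
      · rfl
      · rfl
    · subst h
      rw [nf_diag, if_pos rfl]
      have h2 : (if i = i.rev then (if 2 * i.rev.1 + 1 < n then σ i.rev * b i.rev j else 0) else 0)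
          = 0 := by
        split_ifs with h1 h2
        · have := Fin.ext_iff.1 h1; omega
        · rfl
        · rfl
      rw [h2, add_zero]
      by_cases h3 : i = j
      · rw [if_pos h3, h3, mul_comm]
      · rw [if_neg h3, hb i j (lt_of_le_of_ne hij (Ne.symm h3)), mul_zero]
    · rw [nf_low D σ h, if_neg (ne_of_lt h), zero_add]
      have hlt := Fin.lt_def.1 h
      have hi := i.2
      by_cases h1 : k = i.rev
      · have h2 := Fin.ext_iff.1 h1
        rw [if_pos h1, if_pos (by omega), if_pos (by omega), h1]
      · have h2 : k.1 ≠ (i.rev).1 := fun hh => h1 (Fin.ext hh)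
        rw [if_neg h1, if_neg (by omega), zero_mul]
  rw [Finset.sum_congr rfl fun k _ => hterm k, Finset.sum_add_distrib, Finset.sum_ite_eq',
    Finset.sum_ite_eq', if_pos (Finset.mem_univ _), if_pos (Finset.mem_univ _)]

/-- The diagonal contributions cancel, and the antidiagonal relates the entries of `Y` at `(i, rev
j)` and `(rev i, j)`. The reflection `(a, b) ↦ (rev a, rev b)` carries the strict upper triangle to
the lower one, where `Y` vanishes, and the second half of the diagonal to the first; where one side
of the relation is absent the entry is zero outright. -/
theorem eq_zero_of_sut_comm_nf {Y : Mat n} (hY : UT Y) {D σ : Fin n → ℝ} (hσ : ∀ j, σ j ≠ 0)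
    (h : SUT (Y * nf D σ - nf D σ * Y)) (hd : ∀ j : Fin n, 2 * j.1 < n → Y j j = 0) : Y = 0 := by
  have heq : ∀ i j : Fin n, j ≤ i → (if 2 * j.1 + 1 < n then Y i j.rev * σ j else 0) =
      if 2 * i.rev.1 + 1 < n then σ i.rev * Y i.rev j else 0 := fun i j hij => by
    have h1 := h i j hij
    rw [Matrix.sub_apply, mul_nf_apply hY D σ hij, nf_mul_apply hY D σ hij, sub_eq_zero] at h1
    exact add_left_cancel h1
  ext a b
  rw [Matrix.zero_apply]
  have hra := Fin.val_rev a
  have hrb := Fin.val_rev b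
  have ha := a.2
  have hb := b.2
  rcases lt_or_ge b a with hba | hab
  · exact hY a b hba
  have hab' := Fin.le_def.1 hab
  by_cases h2b : 2 * b.1 < n
  · rcases eq_or_lt_of_le hab with rfl | hlt
    · exact hd a h2b
    have hlt' := Fin.lt_def.1 hlt
    have h1 := heq a.rev b (Fin.le_def.2 (by omega))
    rw [Fin.rev_rev, if_pos (show 2 * a.1 + 1 < n by omega),
      hY a.rev b.rev (Fin.lt_def.2 (by omega)), zero_mul, ite_self] at h1
    exact (mul_eq_zero.1 h1.symm).resolve_left (hσ a)
  rcases le_or_gt n (a.1 + b.1 + 1) with hle | hgt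
  · have h1 := heq a b.rev (Fin.le_def.2 (by omega))
    rw [Fin.rev_rev, if_pos (by omega)] at h1
    have h0 : Y a.rev b.rev = 0 := by
      rcases eq_or_lt_of_le hab with rfl | hlt
      · exact hd _ (by omega)
      · exact hY _ _ (Fin.lt_def.2 (by have := Fin.lt_def.1 hlt; omega))
    rw [h0, mul_zero, ite_self] at h1
    exact (mul_eq_zero.1 h1).resolve_right (hσ _)
  · have h1 := heq a.rev b (Fin.le_def.2 (by omega))
    rw [Fin.rev_rev, if_neg (show ¬ 2 * b.1 + 1 < n by omega), if_pos (by omega)] at h1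
    exact (mul_eq_zero.1 h1.symm).resolve_left (hσ a)

/-- On the kernel of the Poisson tensor at a regular point, the first half of the diagonal is a
system of coordinates. -/
theorem eq_zero_of_sut_comm {X Y : Mat n} (hX : X ∈ hessReg n) (hY : UT Y)
    (h : SUT (Y * X - X * Y)) (hd : ∀ j : Fin n, 2 * j.1 < n → Y j j = 0) : Y = 0 := by
  obtain ⟨ρ, -, hρ⟩ := exists_coadH_eq_nf hX
  obtain ⟨D, b, hb, -, -, hXb⟩ := hρ (fun _ => 1) (fun _ => one_ne_zero)
  have hS := sut_of_coadH hb X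
  rw [hXb] at hS
  set Z := nf D fun _ => (1 : ℝ)
  have hdet := gl_det_ne_zero b
  have hu := isUnit_iff_ne_zero.2 hdet
  have hb' : UT (b : Mat n) := hb
  have hbi := hb'.inv hdet
  have hm := Matrix.mul_nonsing_inv _ hu
  have hY' : UT ((b : Mat n)⁻¹ * Y * (b : Mat n)) := (hbi.mul hY).mul hb'
  have key : (b : Mat n)⁻¹ * Y * (b : Mat n) = 0 := by
    refine eq_zero_of_sut_comm_nf (σ := fun _ => 1) hY' (fun _ => one_ne_zero) (D := D) ?_ ?_
    · have h1 : SUT ((b : Mat n)⁻¹ * (Y * X - X * Y) * (b : Mat n)) := (hbi.mul_sut h).mul_ut hb'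
      have h2 := (hbi.mul hY).mul_sut hS
      have h3 := (hbi.mul_sut hS).mul_ut hY'
      convert (h1.sub h2).add h3 using 1
      have e1 : (b : Mat n)⁻¹ * X * (b : Mat n) * ((b : Mat n)⁻¹ * Y * (b : Mat n)) =
          (b : Mat n)⁻¹ * X * Y * (b : Mat n) := by
        calc _ = (b : Mat n)⁻¹ * X * ((b : Mat n) * (b : Mat n)⁻¹) * Y * (b : Mat n) := by
              noncomm_ring
          _ = _ := by rw [hm, Matrix.mul_one]
      have e2 : (b : Mat n)⁻¹ * ((b : Mat n) * Z) = Z := by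
        rw [← Matrix.mul_assoc, Matrix.nonsing_inv_mul _ hu, Matrix.one_mul]
      have e3 : (b : Mat n)⁻¹ * (X * (b : Mat n) - (b : Mat n) * Z) * ((b : Mat n)⁻¹ * Y * (b : Mat
          n)) =
          (b : Mat n)⁻¹ * X * Y * (b : Mat n) - Z * ((b : Mat n)⁻¹ * Y * (b : Mat n)) := by
        rw [Matrix.mul_sub, e2, Matrix.sub_mul, ← e1, Matrix.mul_assoc (b : Mat n)⁻¹ X]
      rw [e3]
      noncomm_ring
    · intro j hj
      rw [UT.mul_apply_self (hbi.mul hY) hb', UT.mul_apply_self hbi hY, hd j hj]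
      simp
  calc Y = ((b : Mat n) * (b : Mat n)⁻¹) * Y * ((b : Mat n) * (b : Mat n)⁻¹) := by
        rw [hm, Matrix.one_mul, Matrix.mul_one]
    _ = (b : Mat n) * ((b : Mat n)⁻¹ * Y * (b : Mat n)) * (b : Mat n)⁻¹ := by noncomm_ring
    _ = 0 := by rw [key, Matrix.mul_zero, Matrix.zero_mul]

theorem finrank_ker_le {X : Mat n} (hX : X ∈ hessReg n) :
    Module.finrank ℝ (LinearMap.ker (hamLin X)) ≤ (n + 1) / 2 := by
  let L : LinearMap.ker (hamLin X) →ₗ[ℝ] (Fin ((n + 1) / 2) → ℝ) :=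
    { toFun := fun Y r => Y.1.1 ⟨r.1, by have := two_mul_lt_of_fin r; omega⟩
        ⟨r.1, by have := two_mul_lt_of_fin r; omega⟩
      map_add' := fun _ _ => rfl
      map_smul' := fun _ _ => rfl }
  have hL : Function.Injective L := by
    intro Y Y' h
    have h1 := (hamLin_eq_zero_iff.1 Y.2).sub (hamLin_eq_zero_iff.1 Y'.2)
    refine Subtype.ext (Subtype.ext (sub_eq_zero.1 ?_))
    refine eq_zero_of_sut_comm hX (UT.sub Y.1.2 Y'.1.2) ?_ fun j hj => ?_
    · convert h1 using 1
      noncomm_ring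
    · rw [Matrix.sub_apply, sub_eq_zero]
      exact congrFun h ⟨j.1, by omega⟩
  have := LinearMap.finrank_le_finrank_of_injective hL
  rwa [Module.finrank_fintype_fun_eq_card, Fintype.card_fin] at this

/-- The differentials of the Casimirs, as elements of the kernel of the Poisson tensor. -/
theorem linearIndependent_cas_ker {X : Mat n} (hX : X ∈ hessReg n) :
    LinearIndependent ℝ (fun r : Fin ((n + 1) / 2) =>
      (⟨⟨diffH (cas r) X, diffH_mem_utSub _ X⟩, hamLin_diffH_cas r hX.1
        (hessReg_E_ne_zero hX (two_mul_lt_of_fin r).le)⟩ : LinearMap.ker (hamLin X))) := by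
  refine LinearIndependent.of_comp ((utSub n).subtype ∘ₗ (LinearMap.ker (hamLin X)).subtype) ?_
  exact linearIndependent_diffH_cas (hessReg_subset_hessGen hX)

theorem finrank_ker {X : Mat n} (hX : X ∈ hessReg n) :
    Module.finrank ℝ (LinearMap.ker (hamLin X)) = (n + 1) / 2 := by
  refine le_antisymm (finrank_ker_le hX) ?_
  have := (linearIndependent_cas_ker hX).fintype_card_le_finrank
  rwa [Fintype.card_fin] at this

theorem finrank_charSpace {X : Mat n} (hX : X ∈ hessReg n) :
    Module.finrank ℝ (charSpace X) + (n + 1) / 2 = n * (n + 1) / 2 := by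
  rw [← finrank_ker hX, finrank_charSpace_add_ker]

theorem mem_span_of_finrank_ker {M W ι : Type*} [AddCommGroup M] [Module ℝ M] [FiniteDimensional ℝ
    M]
    [AddCommGroup W] [Module ℝ W] [Fintype ι] {p : Submodule ℝ M} (f : p →ₗ[ℝ] W) {v : ι →
      LinearMap.ker f}
    (hv : LinearIndependent ℝ v) (hc : Fintype.card ι = Module.finrank ℝ (LinearMap.ker f)) {y : p}
    (hy : f y = 0) : (y : M) ∈ Submodule.span ℝ (Set.range fun i => ((v i : p) : M)) := by
  have h2 : (⟨y, hy⟩ : LinearMap.ker f) ∈ (⊤ : Submodule ℝ (LinearMap.ker f)) := Submodule.mem_top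
  rw [← hv.span_eq_top_of_card_eq_finrank' hc] at h2
  have h3 := Submodule.mem_map_of_mem (f := p.subtype ∘ₗ (LinearMap.ker f).subtype) h2
  rw [Submodule.map_span, ← Set.range_comp] at h3
  exact h3

/-- The kernel of the Poisson tensor at a regular point is spanned by the Casimirs. -/
theorem mem_span_cas_of_hamLin_eq_zero {X : Mat n} (hX : X ∈ hessReg n) {Y : utSub n}
    (hY : hamLin X Y = 0) :
    Y.1 ∈ Submodule.span ℝ (Set.range fun r : Fin ((n + 1) / 2) => diffH (cas r) X) := by
  exact mem_span_of_finrank_ker (hamLin X) (linearIndependent_cas_ker hX)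
    (by rw [Fintype.card_fin, finrank_ker hX]) hY

theorem continuous_hamLin_line (X V : Mat n) (Y : utSub n) :
    Continuous fun t : ℝ => hamLin (X + t • V) Y := by
  have h : (fun t : ℝ => hamLin (X + t • V) Y) = fun t : ℝ => hamLin X Y + t • hamLin V Y := by
    funext t
    simp only [hamLin_apply, ← entryProjₗ_apply, ← map_smul, ← map_add]
    congr 1
    rw [Matrix.mul_add, Matrix.add_mul, Matrix.mul_smul, Matrix.smul_mul, smul_sub]
    abel
  rw [h]
  exact continuous_const.add (continuous_id.smul continuous_const)

theorem eventually_line_mem_hessReg {X Y : Mat n} (hX : X ∈ hess n) (hY : Y ∈ hessReg n) :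
    ∀ᶠ t : ℝ in nhdsWithin 0 {0}ᶜ, X + t • (Y - X) ∈ hessReg n := by
  have hY' := hY
  rw [hessReg, genericUpTo_eq] at hY' ⊢
  filter_upwards [eventually_evalAt_line_ne_zero _ X hY'.2] with t ht
  exact ⟨line_mem_hess hX hY.1 t, ht⟩

/-- Lower semicontinuity of the rank: independent Hamiltonian vectors at `Y` stay independent nearby
on a line that enters `𝒳`, where the rank is constant. -/
theorem finrank_charSpace_le {X Y : Mat n} (hX : X ∈ hessReg n) (hY : Y ∈ hess n) :
    Module.finrank ℝ (charSpace Y) ≤ Module.finrank ℝ (charSpace X) := by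
  rw [charSpace_eq_range Y]
  set k := Module.finrank ℝ (LinearMap.range (hamLin Y)) with hk
  let B := Module.finBasis ℝ (LinearMap.range (hamLin Y))
  choose Z hZ using fun i => (B i).2
  have hli : LinearIndependent ℝ fun i => hamLin (Y + (0 : ℝ) • (X - Y)) (Z i) := by
    have : (fun i => hamLin (Y + (0 : ℝ) • (X - Y)) (Z i)) =
        (LinearMap.range (hamLin Y)).subtype ∘ B := by
      funext i
      rw [zero_smul, add_zero, hZ]
      rfl
    rw [this]
    exact B.linearIndependent.map' _ (Submodule.ker_subtype _)
  have hcont : Continuous fun (t : ℝ) (i : Fin k) => hamLin (Y + t • (X - Y)) (Z i) :=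
    continuous_pi fun i => continuous_hamLin_line Y (X - Y) (Z i)
  have hev : ∀ᶠ t : ℝ in nhds 0,
      LinearIndependent ℝ fun i : Fin k => hamLin (Y + t • (X - Y)) (Z i) :=
    (isOpen_setOfPred_linearIndependent.preimage hcont).mem_nhds hli
  obtain ⟨t, ht1, ht2⟩ := ((hev.filter_mono nhdsWithin_le_nhds).and
    (eventually_line_mem_hessReg hY hX)).exists
  have h1 : k ≤ Module.finrank ℝ (LinearMap.range (hamLin (Y + t • (X - Y)))) := by
    have h2 : LinearIndependent ℝ fun i : Fin k =>
        (⟨hamLin (Y + t • (X - Y)) (Z i), ⟨Z i, rfl⟩⟩ :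
          LinearMap.range (hamLin (Y + t • (X - Y)))) :=
      LinearIndependent.of_comp (Submodule.subtype _) ht1
    have := h2.fintype_card_le_finrank
    rwa [Fintype.card_fin] at this
  rw [← charSpace_eq_range] at h1
  have h2 := finrank_charSpace ht2
  have h3 := finrank_charSpace hX
  omega

end Rank


/-! ### Completeness of the Casimirs -/

section Completeness

variable {n : ℕ}

theorem diffH_apply (f : Mat n → ℝ) (X : Mat n) {i j : Fin n} (h : i ≤ j) :
    diffH f X i j = fderiv ℝ f X (Matrix.single j i 1) := entryProj_of (S := (· ≤ ·)) h _

theorem tendsto_diffH_line {f : Mat n → ℝ} {X : Mat n} (hf : ContDiffAt ℝ 1 f X) (V : Mat n)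
    (i j : Fin n) :
    Filter.Tendsto (fun t : ℝ => diffH f (X + t • V) i j) (nhds 0) (nhds (diffH f X i j)) := by
  rcases le_or_gt i j with h | h
  · simp only [diffH_apply f _ h]
    have h1 : ContinuousAt (fderiv ℝ f) X := hf.continuousAt_fderiv one_ne_zero
    have h2 : ContinuousAt (fun Z => fderiv ℝ f Z (Matrix.single j i 1)) X :=
      h1.clm_apply continuousAt_const
    have h3 : Filter.Tendsto (fun t : ℝ => X + t • V) (nhds 0) (nhds X) := by
      have h4 : Continuous fun t : ℝ => X + t • V :=
        continuous_const.add (continuous_id.smul continuous_const)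
      have h5 := h4.tendsto 0
      rwa [zero_smul, add_zero] at h5
    exact Filter.Tendsto.comp h2 h3
  · have h1 : ∀ Z : Mat n, diffH f Z i j = 0 := fun Z => entryProj_le_ut _ i j h
    simp only [h1]
    exact tendsto_const_nhds

theorem contDiffAt_I (m : ℕ) {r : ℕ} {X : Mat n} (hX : E 0 r X ≠ 0) :
    ContDiffAt ℝ 1 (I m r : Mat n → ℝ) X := by
  have h1 : ContDiffAt ℝ 1 (E m r : Mat n → ℝ) X := by
    rw [E_eq_evalAt_fun]; exact (evalAt_contDiff _).contDiffAt
  have h2 : ContDiffAt ℝ 1 (E 0 r : Mat n → ℝ) X := by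
    rw [E_eq_evalAt_fun]; exact (evalAt_contDiff _).contDiffAt
  exact h1.div h2 hX

theorem contDiffAt_cas (r : Fin ((n + 1) / 2)) {X : Mat n} (hX : r.1 ≠ 0 → E 0 r.1 X ≠ 0) :
    ContDiffAt ℝ 1 (cas r) X := by
  by_cases h : r.1 = 0
  · rw [cas_of_eq_zero h, trace_pow_eq_evalAt_fun]
    exact (evalAt_contDiff _).contDiffAt
  · rw [cas_of_ne_zero h]
    exact contDiffAt_I 1 (hX h)

/-- The coefficients of a combination of differentials of Casimirs are read off its diagonal. -/
theorem exists_diag_leftInverse (n : ℕ) : ∃ L : (Fin n → ℝ) →ₗ[ℝ] (Fin ((n + 1) / 2) → ℝ),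
    ∀ X ∈ hessGen n, ∀ A ∈ Submodule.span ℝ (Set.range fun r : Fin ((n + 1) / 2) =>
      diffH (cas r) X), A = ∑ r, L (fun k => A k k) r • diffH (cas r) X := by
  set M : Matrix (Fin n) (Fin ((n + 1) / 2)) ℝ := Matrix.of fun k r =>
    if r.1 = 0 then 1 else if r.1 ≤ k.1 ∧ k.1 + r.1 < n then (-1 : ℝ) else 0 with hM
  have hker : LinearMap.ker M.mulVecLin = ⊥ := by
    rw [LinearMap.ker_eq_bot']
    intro c hc
    refine cas_diag_matrix_injective c fun k => ?_
    have h1 := congrFun hc k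
    rw [Matrix.mulVecLin_apply, Matrix.mulVec, dotProduct] at h1
    refine Eq.trans (Finset.sum_congr rfl fun r _ => ?_) h1
    rw [hM, Matrix.of_apply, mul_comm]
  obtain ⟨L, hL⟩ := LinearMap.exists_leftInverse_of_injective _ hker
  refine ⟨L, fun X hX A hA => ?_⟩
  obtain ⟨c, rfl⟩ := (Submodule.mem_span_range_iff_exists_fun ℝ).1 hA
  have h1 : (fun k => (∑ r, c r • diffH (cas r) X) k k) = M.mulVecLin c := by
    funext k
    rw [Matrix.mulVecLin_apply, Matrix.mulVec, dotProduct, Matrix.sum_apply]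
    refine Finset.sum_congr rfl fun r _ => ?_
    rw [Matrix.smul_apply, diffH_cas r (hessGen_cas hX r), grad_cas_diag r (hessGen_cas hX r), hM,
      Matrix.of_apply, smul_eq_mul, mul_comm]
  rw [h1, ← LinearMap.comp_apply, hL, LinearMap.id_apply]

/-- For even `n`, `ℋ_gen` may contain points with `E_{0,n/2} = 0`, to which the kernel computation
does not apply. They are approached along a line inside `𝒳`: the coefficients are a fixed linear
function of the diagonal, so the `C¹` condition carries the relation to the limit. -/
theorem diffH_mem_span_of_isCasimirOn {U : Set (Mat n)} {F : Mat n → ℝ} (hU : IsOpen U)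
    (hF : ContDiffOn ℝ 1 F U) (hcas : IsCasimirOn (· ≤ ·) (U ∩ hessGen n) F) {X : Mat n}
    (hX : X ∈ U ∩ hessGen n) : diffH F X ∈
      Submodule.span ℝ (Set.range fun r : Fin ((n + 1) / 2) => diffH (cas r) X) := by
  obtain ⟨L, hL⟩ := exists_diag_leftInverse n
  suffices h : diffH F X = ∑ r, L (fun k => diffH F X k k) r • diffH (cas r) X by
    rw [h]
    exact Submodule.sum_mem _ fun r _ => Submodule.smul_mem _ _ (Submodule.subset_span ⟨r, rfl⟩)
  set V : Mat n := nf 0 1 - X with hV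
  have hFX : ContDiffAt ℝ 1 F X := hF.contDiffAt (hU.mem_nhds hX.1)
  have hev : ∀ᶠ t : ℝ in nhdsWithin 0 {0}ᶜ, diffH F (X + t • V) =
      ∑ r, L (fun k => diffH F (X + t • V) k k) r • diffH (cas r) (X + t • V) := by
    have h1 : ∀ᶠ t : ℝ in nhds 0, X + t • V ∈ U := by
      have h4 : Continuous fun t : ℝ => X + t • V :=
        continuous_const.add (continuous_id.smul continuous_const)
      refine (hU.preimage h4).mem_nhds ?_
      change X + (0 : ℝ) • V ∈ U
      rw [zero_smul, add_zero]
      exact hX.1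
    filter_upwards [h1.filter_mono nhdsWithin_le_nhds,
      eventually_line_mem_hessReg hX.2.1 (nf_one_mem_hessReg n)] with t ht1 ht2
    have ht3 := hessReg_subset_hessGen ht2
    exact hL _ ht3 _ (mem_span_cas_of_hamLin_eq_zero ht2 (hamLin_diffH_eq_zero
      (hcas _ ⟨ht1, ht3⟩).2))
  ext i j
  refine tendsto_nhds_unique_of_eventuallyEq
    ((tendsto_diffH_line hFX V i j).mono_left nhdsWithin_le_nhds) (b :=
      (∑ r, L (fun k => diffH F X k k) r • diffH (cas r) X) i j) (l := nhdsWithin 0 {0}ᶜ)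
    (g := fun t => (∑ r, L (fun k => diffH F (X + t • V) k k) r • diffH (cas r) (X + t • V)) i j)
    ?_ (hev.mono fun t ht => congrFun (congrFun ht i) j)
  simp only [Matrix.sum_apply, Matrix.smul_apply, smul_eq_mul]
  refine tendsto_finsetSum _ fun r _ => Filter.Tendsto.mul ?_
    ((tendsto_diffH_line (contDiffAt_cas r (hessGen_cas hX.2 r)) V i j).mono_left
      nhdsWithin_le_nhds)
  have hc : Continuous fun d : Fin n → ℝ => L d r :=
    (continuous_apply r).comp L.continuous_of_finiteDimensional
  refine (hc.tendsto _).comp (tendsto_pi_nhds.2 fun k => ?_)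
  exact (tendsto_diffH_line hFX V k k).mono_left nhdsWithin_le_nhds

end Completeness


/-! ### Orbits are connected components of level sets -/

section Components

variable {n : ℕ}

theorem coadH_eq (b : GL (Fin n) ℝ) (X : Mat n) : coadH b X =
    eps n + entryProjₗ (fun i j => j ≤ i) ((b : Mat n)⁻¹ * (X - eps n) * (b : Mat n)) := by
  rw [coadH, coad, Matrix.coe_units_inv]
  rfl

/-- The curve that a curve of matrices traces out in `ℋ`. -/
noncomputable def coadCurve (p : ℝ → Mat n) (X : Mat n) (t : ℝ) : Mat n :=
  eps n + entryProjₗ (fun i j => j ≤ i) ((p t)⁻¹ * (X - eps n) * p t)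

theorem hasDerivAt_coadCurve {p : ℝ → Mat n} {p' : Mat n} {t : ℝ} (X : Mat n)
    (hp : HasDerivAt p p' t) (hdet : (p t).det ≠ 0) : HasDerivAt (coadCurve p X)
      (entryProjₗ (fun i j => j ≤ i) (((p t)⁻¹ * (X - eps n) * p t) * ((p t)⁻¹ * p') -
        ((p t)⁻¹ * p') * ((p t)⁻¹ * (X - eps n) * p t))) t := by
  have h1 := hasDerivAt_matrix_conj (X - eps n) hp hdet
  rw [hasDerivAt_matrix] at h1 ⊢
  intro i j
  by_cases hij : j ≤ i
  · refine ((h1 i j).const_add (eps n i j)).congr_deriv ?_ |>.congr_of_eventuallyEq ?_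
    · exact (entryProj_of (S := fun i j : Fin n => j ≤ i) hij _).symm
    · refine Filter.Eventually.of_forall fun s => ?_
      change eps n i j + entryProj (fun i j => j ≤ i) _ i j = _
      rw [entryProj_of (S := fun i j : Fin n => j ≤ i) hij]
  · refine ((hasDerivAt_const t (eps n i j)).congr_deriv ?_).congr_of_eventuallyEq ?_
    · exact (entryProj_of_not (S := fun i j : Fin n => j ≤ i) hij _).symm
    · refine Filter.Eventually.of_forall fun s => ?_
      change eps n i j + entryProj (fun i j => j ≤ i) _ i j = _
      rw [entryProj_of_not (S := fun i j : Fin n => j ≤ i) hij, add_zero]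

theorem IsBorel.segment {b : GL (Fin n) ℝ} (hb : IsBorel b) {t : ℝ} (ht : t ∈ Set.Icc (0 : ℝ) 1) :
    UT (1 + t • ((b : Mat n) - 1)) ∧ ∀ i, 0 < (1 + t • ((b : Mat n) - 1)) i i := by
  refine ⟨UT.one.add (UT.smul t (UT.sub hb.1 UT.one)), fun i => ?_⟩
  rw [Matrix.add_apply, Matrix.smul_apply, Matrix.sub_apply, Matrix.one_apply_eq, smul_eq_mul]
  have h1 := hb.2 i
  have h2 : (1 : ℝ) + t * ((b : Mat n) i i - 1) = (1 - t) + t * (b : Mat n) i i := by ring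
  rw [h2]
  rcases eq_or_lt_of_le ht.1 with h0 | h0
  · rw [← h0]; simp
  · have := mul_pos h0 h1
    have := ht.2
    linarith

theorem UT.det_ne_zero {A : Mat n} (hA : UT A) (h : ∀ i, A i i ≠ 0) : A.det ≠ 0 := by
  rw [hA.det]
  exact Finset.prod_ne_zero_iff.2 fun i _ => h i

theorem mem_orbitB_self {X : Mat n} (hX : X ∈ hess n) : X ∈ orbitB X :=
  ⟨1, ⟨fun i j h => UT.one i j h, fun i => by simp⟩, (coadH_one hX).symm⟩

theorem mem_orbitB_trans {X Y Z : Mat n} (h1 : Y ∈ orbitB X) (h2 : Z ∈ orbitB Y) :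
    Z ∈ orbitB X := by
  obtain ⟨a, ha, rfl⟩ := h1
  obtain ⟨b, hb, rfl⟩ := h2
  exact ⟨a * b, ha.mul hb, (coadH_mul ha.1 hb.1 X).symm⟩

theorem mem_orbitB_symm {X Y : Mat n} (hX : X ∈ hess n) (h : Y ∈ orbitB X) : X ∈ orbitB Y := by
  obtain ⟨a, ha, rfl⟩ := h
  refine ⟨a⁻¹, ha.inv, ?_⟩
  rw [← coadH_mul ha.1 ha.1.inv, mul_inv_cancel, coadH_one hX]

theorem isPreconnected_orbitB {X : Mat n} (hX : X ∈ hess n) : IsPreconnected (orbitB X) := by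
  refine isPreconnected_of_forall X fun Y hY => ?_
  obtain ⟨b, hb, rfl⟩ := hY
  set p : ℝ → Mat n := fun t => 1 + t • ((b : Mat n) - 1) with hp
  have hdet : ∀ t ∈ Set.Icc (0 : ℝ) 1, (p t).det ≠ 0 := fun t ht =>
    (hb.segment ht).1.det_ne_zero fun i => ((hb.segment ht).2 i).ne'
  refine ⟨coadCurve p X '' Set.Icc 0 1, ?_, ⟨0, ⟨le_rfl, zero_le_one⟩, ?_⟩,
    ⟨1, ⟨zero_le_one, le_rfl⟩, ?_⟩, ?_⟩
  · rintro _ ⟨t, ht, rfl⟩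
    obtain ⟨g, hg⟩ : ∃ g : GL (Fin n) ℝ, (g : Mat n) = p t :=
      ⟨Matrix.GeneralLinearGroup.mkOfDetNeZero (p t) (hdet t ht), rfl⟩
    have h1 := hb.segment ht
    refine ⟨g, ⟨?_, fun i => ?_⟩, ?_⟩
    · rw [IsUpper, hg]; exact h1.1
    · rw [hg]; exact h1.2 i
    · rw [coadH_eq, hg, coadCurve]
  · have h1 := coadH_eq 1 X
    rw [coadH_one hX] at h1
    rw [coadCurve, hp]
    simp only [zero_smul, add_zero]
    exact h1.symm
  · rw [coadH_eq, coadCurve, hp]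
    simp only [one_smul, add_sub_cancel]
  · refine isPreconnected_Icc.image _ fun t ht => ?_
    exact (hasDerivAt_coadCurve X (hasDerivAt_one_add_smul _ t)
      (hdet t ht)).continuousAt.continuousWithinAt

/-- The orbit is connected because segments from `1` stay in `B`. Conversely `E_{0,r}` has no zero
on the level set, so it keeps its sign on a connected part, and the signs and Casimirs characterize
the orbit. -/
theorem orbitB_eq_connectedComponentIn {X : Mat n} (hX : X ∈ hessReg n) :
    orbitB X = connectedComponentIn (levelSet X) X := by
  have hXL : X ∈ levelSet X := ⟨hX, fun _ => rfl⟩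
  refine Set.Subset.antisymm ?_ fun Y hY => ?_
  · exact (isPreconnected_orbitB hX.1).subset_connectedComponentIn (mem_orbitB_self hX.1)
      fun Y hY => ((mem_orbitB_iff hX).1 hY).1
  · have hsub := connectedComponentIn_subset (levelSet X) X
    refine (mem_orbitB_iff hX).2 ⟨hsub hY, fun r h1 h2 => ?_⟩
    have hne : ∀ Z ∈ connectedComponentIn (levelSet X) X, E 0 r X * E 0 r Z ≠ 0 := fun Z hZ =>
      mul_ne_zero (hX.2 r h1 h2) ((hsub hZ).1.2 r h1 h2)
    by_contra hneg
    have hpos : 0 < E 0 r X * E 0 r X := mul_self_pos.2 (hX.2 r h1 h2)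
    have hcont : ContinuousOn (fun Z : Mat n => E 0 r X * E 0 r Z)
        (connectedComponentIn (levelSet X) X) :=
      (continuous_const.mul (E_continuous 0 r)).continuousOn
    obtain ⟨Z, hZ, hZ0⟩ := isPreconnected_connectedComponentIn.intermediate_value hY
      (mem_connectedComponentIn hXL) hcont ⟨not_lt.1 hneg, hpos.le⟩
    exact hne Z hZ hZ0

end Components

/-! ### Symplectic leaves -/

section Leaves

variable {n : ℕ}

theorem fderiv_E_zero_congr {r : ℕ} (h : 2 * r ≤ n) (X : Mat n) {V W : Mat n}
    (hVW : ∀ i j : Fin n, j ≤ i → V i j = W i j) :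
    fderiv ℝ (E 0 r : Mat n → ℝ) X V = fderiv ℝ (E 0 r : Mat n → ℝ) X W := by
  refine fderiv_eq_of_line (E_differentiable 0 r X) ?_
  refine hasDerivAt_congr (hasDerivAt_comp_line (E_differentiable 0 r X) W) (fun s => ?_) rfl
  refine E_zero_congr_low h fun i j hij => ?_
  rw [Matrix.add_apply, Matrix.add_apply, Matrix.smul_apply, Matrix.smul_apply, hVW i j hij]

theorem hamVec_low (h : Mat n → ℝ) (X : Mat n) (i j : Fin n) (hij : j ≤ i) :
    hamVec h X i j = (-(X * diffH h X - diffH h X * X)) i j := by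
  rw [hamVec, entryProj_of (S := fun i j : Fin n => j ≤ i) hij, neg_sub]

theorem ut_diffH (h : Mat n → ℝ) (X : Mat n) : UT (diffH h X) := entryProj_le_ut _

theorem fderiv_E_zero_hamVec {r : ℕ} (hr : 2 * r ≤ n) (h : Mat n → ℝ) (X : Mat n) :
    fderiv ℝ (E 0 r : Mat n → ℝ) X (hamVec h X) =
      -((∑ i : Fin n with i.1 < r, diffH h X i i) - ∑ i : Fin n with n ≤ i.1 + r, diffH h X i i) *
        E 0 r X := by
  rw [fderiv_E_zero_congr hr X (hamVec_low h X), map_neg,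
    fderiv_E_comm 0 ((ut_diffH h X).inParAlg r), neg_mul]

theorem fderiv_cas_hamVec (r : Fin ((n + 1) / 2)) (h : Mat n → ℝ) {X : Mat n}
    (hX : r.1 ≠ 0 → E 0 r.1 X ≠ 0) : fderiv ℝ (cas r) X (hamVec h X) = 0 := by
  have hS : SUT (hamVec h X - -(X * diffH h X - diffH h X * X)) := fun i j hij => by
    rw [Matrix.sub_apply, hamVec_low h X i j hij, sub_self]
  have h1 : fderiv ℝ (cas r) X (hamVec h X - -(X * diffH h X - diffH h X * X)) = 0 := by
    rw [fderiv_eq_trace, Matrix.trace]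
    exact Finset.sum_eq_zero fun i _ => (ut_grad_cas r hX).mul_sut hS i i le_rfl
  rw [map_sub, map_neg, (parInvariantAt_cas r hX).comm _ ((ut_diffH h X).inParAlg _), neg_zero,
    sub_zero] at h1
  exact h1

theorem continuousOn_diffH {h : Mat n → ℝ} (hh : ContDiff ℝ ∞ h) {γ : ℝ → Mat n} {s : Set ℝ}
    (hγ : ContinuousOn γ s) (i : Fin n) : ContinuousOn (fun t => diffH h (γ t) i i) s := by
  simp only [diffH_apply h _ le_rfl]
  have h1 : Continuous (fderiv ℝ h) := hh.continuous_fderiv (by simp)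
  have h2 : Continuous fun Z => fderiv ℝ h Z (Matrix.single i i 1) := h1.clm_apply continuous_const
  exact h2.comp_continuousOn hγ

/-- Along a Hamiltonian curve `E_{0,r}` solves a scalar linear equation, so it changes by a positive
factor. In particular the Casimirs remain defined, and then constant. -/
theorem HamStep.exists_factor {X Y : Mat n} (h : HamStep X Y) :
    (∀ r, 2 * r ≤ n → ∃ e : ℝ, 0 < e ∧ E 0 r Y = e * E 0 r X) ∧
      (X ∈ hessReg n → ∀ r, cas r Y = cas r X) ∧ X ∈ hess n ∧ Y ∈ hess n := by
  obtain ⟨h, γ, hh, h0, h1, hγ⟩ := h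
  have hcont : ContinuousOn γ (Set.Icc 0 1) := fun t ht => (hγ t ht).2.continuousWithinAt
  have hE : ∀ r, 2 * r ≤ n → ∃ e : ℝ → ℝ, (∀ t, 0 < e t) ∧
      ∀ t ∈ Set.Icc (0 : ℝ) 1, E 0 r (γ t) = e t * E 0 r (γ 0) := by
    intro r hr
    obtain ⟨e, he, hF⟩ := exists_factor_of_linear_ode (zero_le_one (α := ℝ))
      (c := fun t => -((∑ i : Fin n with i.1 < r, diffH h (γ t) i i) -
        ∑ i : Fin n with n ≤ i.1 + r, diffH h (γ t) i i))
      (((continuousOn_finsetSum _ fun i _ => continuousOn_diffH hh hcont i).sub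
        (continuousOn_finsetSum _ fun i _ => continuousOn_diffH hh hcont i)).neg)
    refine ⟨e, he, hF _ fun t ht => ?_⟩
    have := comp_hasDerivWithinAt (E_differentiable 0 r (γ t)) (hγ t ht).2
    rwa [fderiv_E_zero_hamVec hr] at this
  have mem0 : (0 : ℝ) ∈ Set.Icc (0 : ℝ) 1 := ⟨le_rfl, zero_le_one⟩
  have mem1 : (1 : ℝ) ∈ Set.Icc (0 : ℝ) 1 := ⟨zero_le_one, le_rfl⟩
  refine ⟨fun r hr => ?_, fun hX r => ?_, h0 ▸ (hγ 0 mem0).1, h1 ▸ (hγ 1 mem1).1⟩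
  · obtain ⟨e, he, hF⟩ := hE r hr
    exact ⟨e 1, he 1, by rw [← h0, ← h1, hF 1 mem1]⟩
  · rw [← h0, ← h1]
    refine eq_of_hasDerivWithinAt_zero (F := fun t => cas r (γ t)) (fun t ht => ?_) mem1
    have hne : r.1 ≠ 0 → E 0 r.1 (γ t) ≠ 0 := fun hr0 => by
      obtain ⟨e, he, hF⟩ := hE r.1 (two_mul_lt_of_fin r).le
      rw [hF t ht, h0]
      exact mul_ne_zero (he t).ne' (hessReg_cas hX r hr0)
    have := comp_hasDerivWithinAt (parInvariantAt_cas r hne).differentiableAt (hγ t ht).2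
    rwa [fderiv_cas_hamVec r h hne] at this

theorem HamStep.mem_orbitB {X Y : Mat n} (h : HamStep X Y) :
    (X ∈ hessReg n ↔ Y ∈ hessReg n) ∧ (X ∈ hessReg n → Y ∈ orbitB X) := by
  obtain ⟨hE, hc, hX, hY⟩ := h.exists_factor
  have key : X ∈ hessReg n → Y ∈ hessReg n := fun hX' => ⟨hY, fun r h1 h2 => by
    obtain ⟨e, he, heq⟩ := hE r (by omega)
    rw [heq]
    exact mul_ne_zero he.ne' (hX'.2 r h1 h2)⟩
  refine ⟨⟨key, fun hY' => ⟨hX, fun r h1 h2 h0 => ?_⟩⟩, fun hX' => ?_⟩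
  · obtain ⟨e, he, heq⟩ := hE r (by omega)
    exact hY'.2 r h1 h2 (by rw [heq, h0, mul_zero])
  · refine (mem_orbitB_iff hX').2 ⟨⟨key hX', hc hX'⟩, fun r h1 h2 => ?_⟩
    obtain ⟨e, he, heq⟩ := hE r (by omega)
    rw [heq, mul_left_comm]
    exact mul_pos he (mul_self_pos.2 (hX'.2 r h1 h2))

theorem sympLeaf_subset_orbitB {X : Mat n} (hX : X ∈ hessReg n) : sympLeaf X ⊆ orbitB X := by
  intro Y hY
  have key : ∀ A B : Mat n, Relation.EqvGen HamStep A B →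
      (A ∈ hessReg n ↔ B ∈ hessReg n) ∧ (A ∈ hessReg n → B ∈ orbitB A) := by
    intro A B h
    induction h with
    | rel A B h => exact h.mem_orbitB
    | refl A => exact ⟨Iff.rfl, fun h => mem_orbitB_self h.1⟩
    | symm A B _ ih =>
      exact ⟨ih.1.symm, fun h => mem_orbitB_symm (ih.1.2 h).1 (ih.2 (ih.1.2 h))⟩
    | trans A B C _ _ ih1 ih2 =>
      exact ⟨ih1.1.trans ih2.1, fun h => mem_orbitB_trans (ih1.2 h) (ih2.2 (ih1.1.1 h))⟩
  exact (key X Y hY).2 hX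

/-- The coadjoint action of a one-parameter group is a Hamiltonian flow. -/
theorem hamStep_of_oneParam {p : ℝ → Mat n} {Z : Mat n} (hZ : UT Z) (hp0 : p 0 = 1)
    (hdet : ∀ t, (p t).det ≠ 0) (hp : ∀ t, HasDerivAt p (p t * Z) t)
    {b : GL (Fin n) ℝ} (hb : (b : Mat n) = p 1) {X : Mat n} (hX : X ∈ hess n) :
    HamStep X (coadH b X) := by
  -- The velocity of `p⁻¹ X p` is a commutator with `Z` on the right, while `hamVec` puts the
  -- differential on the left; hence the sign.
  refine ⟨trLin (-Z), coadCurve p X, (trLin (-Z)).contDiff, ?_, ?_, fun t _ => ⟨?_, ?_⟩⟩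
  · have h1 := coadH_eq 1 X
    rw [coadH_one hX] at h1
    rw [coadCurve, hp0]
    exact h1.symm
  · rw [coadH_eq, hb]
    rfl
  · intro i j hij
    change eps n i j + entryProj (fun i j => j ≤ i) _ i j = _
    rw [entryProj_of_not (S := fun i j : Fin n => j ≤ i) (not_le.2 hij), add_zero]
  · have h1 := hasDerivAt_coadCurve X (hp t) (hdet t)
    refine (h1.congr_deriv ?_).hasDerivWithinAt
    have hu := isUnit_iff_ne_zero.2 (hdet t)
    rw [← Matrix.mul_assoc (p t)⁻¹, Matrix.nonsing_inv_mul _ hu, Matrix.one_mul]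
    set W := (p t)⁻¹ * (X - eps n) * p t with hW
    -- The curve and the unprojected conjugate differ by a strictly upper matrix, whose commutator
    -- with `Z` is strictly upper again and lost in the projection.
    have hS : SUT (coadCurve p X t - W) := fun i j hij => by
      change eps n i j + entryProj (fun i j => j ≤ i) W i j - W i j = 0
      rw [entryProj_of (S := fun i j : Fin n => j ≤ i) hij, eps_sut i j hij, zero_add, sub_self]
    have hd : diffH (trLin (-Z)) (coadCurve p X t) = -Z :=
      diffH_trLin (fun i j hij => by rw [Matrix.neg_apply, hZ i j hij, neg_zero]) _
    ext i j
    rw [hamVec, hd, entryProjₗ_apply]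
    by_cases hij : j ≤ i
    · rw [entryProj_of (S := fun i j : Fin n => j ≤ i) hij,
        entryProj_of (S := fun i j : Fin n => j ≤ i) hij]
      have h2 := ((hS.mul_ut hZ).sub (hZ.mul_sut hS)) i j hij
      have h3 : -Z * coadCurve p X t - coadCurve p X t * -Z = (W * Z - Z * W) +
          ((coadCurve p X t - W) * Z - Z * (coadCurve p X t - W)) := by noncomm_ring
      rw [h3, Matrix.add_apply, h2, add_zero]
    · rw [entryProj_of_not (S := fun i j : Fin n => j ≤ i) hij,
        entryProj_of_not (S := fun i j : Fin n => j ≤ i) hij]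

theorem coadH_mem_sympLeaf_mul {a b : GL (Fin n) ℝ} (ha : IsUpper a) (hb : IsUpper b)
    (h1 : ∀ X ∈ hess n, coadH a X ∈ sympLeaf X) (h2 : ∀ X ∈ hess n, coadH b X ∈ sympLeaf X) :
    ∀ X ∈ hess n, coadH (a * b) X ∈ sympLeaf X := fun X hX => by
  rw [coadH_mul ha hb]
  exact (h1 X hX).trans _ _ _ (h2 _ (coadH_mem_hess a X))

/-- Induction on the number of columns that may differ from those of `1`. The last such column is
split off as `1 + Z` with `Z² = 0`, so that `1 + tZ` is a one-parameter group. -/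
theorem coadH_mem_sympLeaf_of_unipotent (k : ℕ) : ∀ u : GL (Fin n) ℝ, IsUnipotentUpper u →
    (∀ i j : Fin n, k ≤ j.1 → (u : Mat n) i j = (1 : Mat n) i j) →
      ∀ X ∈ hess n, coadH u X ∈ sympLeaf X := by
  induction k with
  | zero =>
    intro u _ h X hX
    have : u = 1 := Units.ext (Matrix.ext fun i j => h i j (Nat.zero_le _))
    rw [this, coadH_one hX]
    exact Relation.EqvGen.refl X
  | succ k ih =>
    intro u hu h
    set Z : Mat n := Matrix.of fun i j => if j.1 = k ∧ i < j then (u : Mat n) i j else 0 with hZ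
    have hZs : SUT Z := fun i j hij => by
      rw [hZ, Matrix.of_apply, if_neg fun h => absurd h.2 (not_lt.2 hij)]
    have hZZ : Z * Z = 0 := by
      ext i j
      rw [Matrix.mul_apply, Matrix.zero_apply]
      refine Finset.sum_eq_zero fun l _ => ?_
      simp only [hZ, Matrix.of_apply]
      split_ifs with h1 h2
      · have := Fin.lt_def.1 h2.2
        omega
      all_goals simp
    have hut : ∀ t : ℝ, UT (1 + t • Z) := fun t => UT.one.add (hZs.ut.smul t)
    have hdet : ∀ t : ℝ, (1 + t • Z).det ≠ 0 := fun t => (hut t).det_ne_zero fun i => by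
      rw [Matrix.add_apply, Matrix.smul_apply, hZs i i le_rfl, smul_zero, add_zero,
        Matrix.one_apply_eq]
      exact one_ne_zero
    set a : GL (Fin n) ℝ := Matrix.GeneralLinearGroup.mkOfDetNeZero _ (hdet 1) with ha
    have hav : (a : Mat n) = 1 + (1 : ℝ) • Z := rfl
    have haU : IsUnipotentUpper a := ⟨hut 1, fun i => by
      rw [hav, Matrix.add_apply, Matrix.smul_apply, hZs i i le_rfl, smul_zero, add_zero,
        Matrix.one_apply_eq]⟩
    have hRa : ∀ X ∈ hess n, coadH a X ∈ sympLeaf X := fun X hX =>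
      Relation.EqvGen.rel _ _ (hamStep_of_oneParam (p := fun t => 1 + t • Z) hZs.ut (by simp)
        hdet (fun t => (hasDerivAt_one_add_smul Z t).congr_deriv (by
          rw [Matrix.add_mul, Matrix.one_mul, Matrix.smul_mul, hZZ, smul_zero, add_zero])) hav hX)
    have hcol : ∀ i j : Fin n, k ≤ j.1 → (u : Mat n) i j = (a : Mat n) i j := by
      intro i j hj
      rw [hav, one_smul, Matrix.add_apply, hZ, Matrix.of_apply]
      rcases eq_or_lt_of_le hj with hk | hk
      · rcases lt_trichotomy i j with hij | hij | hij
        · rw [if_pos ⟨hk.symm, hij⟩, Matrix.one_apply_ne (ne_of_lt hij), zero_add]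
        · rw [hij, hu.2, if_neg (by simp), Matrix.one_apply_eq, add_zero]
        · rw [hu.1 i j hij, Matrix.one_apply_ne (ne_of_gt hij), if_neg fun h => lt_asymm h.2 hij,
            add_zero]
      · rw [h i j hk, if_neg (by omega), add_zero]
    have hu' : IsUnipotentUpper (a⁻¹ * u) := ⟨haU.1.inv.mul hu.1, fun i => by
      have h1 := UT.mul_apply_self haU.1 haU.1.inv i
      rw [← Units.val_mul, mul_inv_cancel, Units.val_one, Matrix.one_apply_eq, haU.2 i,
        one_mul] at h1
      rw [Units.val_mul, UT.mul_apply_self haU.1.inv hu.1, hu.2, ← h1, one_mul]⟩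
    have hRu := ih (a⁻¹ * u) hu' fun i j hj => by
      have h1 : ((a⁻¹ * a : GL (Fin n) ℝ) : Mat n) i j = (1 : Mat n) i j := by
        rw [inv_mul_cancel, Units.val_one]
      rw [← h1, Units.val_mul, Units.val_mul, Matrix.mul_apply, Matrix.mul_apply]
      exact Finset.sum_congr rfl fun l _ => by rw [hcol l j hj]
    have := coadH_mem_sympLeaf_mul haU.1 hu'.1 hRa hRu
    rwa [mul_inv_cancel_left] at this

/-- `b` is a positive diagonal matrix times a unipotent one; the diagonal factor is the time-one
value of an exponential of logarithms. -/
theorem coadH_mem_sympLeaf {b : GL (Fin n) ℝ} (hb : IsBorel b) :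
    ∀ X ∈ hess n, coadH b X ∈ sympLeaf X := by
  set l : Fin n → ℝ := fun i => Real.log ((b : Mat n) i i) with hl
  set p : ℝ → Mat n := fun t => Matrix.diagonal fun i => Real.exp (t * l i) with hp
  have hut : ∀ t, UT (p t) := fun t i j hij => Matrix.diagonal_apply_ne _ (ne_of_gt hij)
  have hdet : ∀ t, (p t).det ≠ 0 := fun t => (hut t).det_ne_zero fun i => by
    exact (Matrix.diagonal_apply_eq _ i).trans_ne (Real.exp_pos _).ne'
  have hder : ∀ t, HasDerivAt p (p t * Matrix.diagonal l) t := fun t => by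
    rw [hasDerivAt_matrix]
    intro i j
    rw [hp, Matrix.diagonal_mul_diagonal]
    by_cases hij : i = j
    · subst hij
      simp only [Matrix.diagonal_apply_eq]
      have h1 : HasDerivAt (fun s : ℝ => s * l i) (l i) t := by
        simpa using (hasDerivAt_id t).mul_const (l i)
      exact h1.exp
    · simp only [Matrix.diagonal_apply_ne _ hij]
      exact hasDerivAt_const _ _
  set d : GL (Fin n) ℝ := Matrix.GeneralLinearGroup.mkOfDetNeZero (p 1) (hdet 1) with hd
  have hdv : ∀ i, (d : Mat n) i i = (b : Mat n) i i := fun i => by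
    change Matrix.diagonal (fun i => Real.exp (1 * l i)) i i = _
    rw [Matrix.diagonal_apply_eq, one_mul, hl, Real.exp_log (hb.2 i)]
  have hdU : IsUpper d := hut 1
  have hRd : ∀ X ∈ hess n, coadH d X ∈ sympLeaf X := fun X hX =>
    Relation.EqvGen.rel _ _ (hamStep_of_oneParam
      (fun i j hij => Matrix.diagonal_apply_ne _ (ne_of_gt hij)) (by simp [hp]) hdet hder rfl hX)
  have hu : IsUnipotentUpper (d⁻¹ * b) := ⟨hdU.inv.mul hb.1, fun i => by
    have h1 := UT.mul_apply_self hdU hdU.inv i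
    rw [← Units.val_mul, mul_inv_cancel, Units.val_one, Matrix.one_apply_eq, hdv i] at h1
    rw [Units.val_mul, UT.mul_apply_self hdU.inv hb.1, mul_comm, ← h1]⟩
  have hRu := coadH_mem_sympLeaf_of_unipotent n (d⁻¹ * b) hu fun i j hj =>
    absurd j.2 (not_lt.2 hj)
  have := coadH_mem_sympLeaf_mul hdU hu.1 hRd hRu
  rwa [mul_inv_cancel_left] at this

theorem sympLeaf_eq_orbitB {X : Mat n} (hX : X ∈ hessReg n) : sympLeaf X = orbitB X := by
  refine Set.Subset.antisymm (sympLeaf_subset_orbitB hX) ?_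
  rintro _ ⟨b, hb, rfl⟩
  exact coadH_mem_sympLeaf hb X hX.1

end Leaves


/-! ### Gradients of the family at a special point -/

section Seed

variable {n : ℕ}

/-- Each factor `A` moves at most one column to the right, along a superdiagonal of ones; so column
`p` is the last one reached in the first row. -/
theorem pow_apply_zero {A : Mat n} (hA : A ∈ hess n) {z : Fin n} (hz : z.1 = 0) (p : ℕ)
    (a : Fin n) (ha : p ≤ a.1) : (A ^ p) z a = if a.1 = p then 1 else 0 := by
  induction p generalizing a with
  | zero =>
    rw [pow_zero, Matrix.one_apply]
    refine if_congr ?_ rfl rfl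
    rw [Fin.ext_iff, hz, eq_comm]
  | succ p ih =>
    have hlt := a.2
    rw [pow_succ, Matrix.mul_apply, Finset.sum_eq_single (⟨a.1 - 1, by omega⟩ : Fin n)]
    · rw [ih _ (by simp only; omega), hA _ _ (Fin.lt_def.2 (by simp only; omega)), eps,
        Matrix.of_apply, if_pos (show a.1 - 1 + 1 = a.1 by omega), mul_one]
      refine if_congr ?_ rfl rfl
      simp only
      omega
    · intro b _ hb
      have hb' : b.1 ≠ a.1 - 1 := fun h => hb (Fin.ext h)
      rcases lt_or_ge b a with h | h
      · have := Fin.lt_def.1 h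
        rw [hA b a h, eps, Matrix.of_apply, if_neg (by omega), mul_zero]
      · have := Fin.le_def.1 h
        rw [ih b (by omega), if_neg (by omega), zero_mul]
    · simp

/-- Changing one entry changes the characteristic polynomial by a multiple of an entry of the
adjugate. -/
theorem charpoly_add_smul_single {N : ℕ} (A : Matrix (Fin N) (Fin N) ℝ) (a z : Fin N) (t : ℝ) :
    (A + t • Matrix.single a z (1 : ℝ)).charpoly =
      A.charpoly - Polynomial.C t * A.charmatrix.adjugate z a := by
  have h1 : (A + t • Matrix.single a z (1 : ℝ)).charmatrix = A.charmatrix.updateRow a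
      (A.charmatrix a + (-Polynomial.C t) • (Pi.single z 1 : Fin N → Polynomial ℝ)) := by
    ext1 i j
    rw [Matrix.updateRow_apply]
    split_ifs with h
    · subst h
      rw [Pi.add_apply, Pi.smul_apply, Matrix.charmatrix_apply, Matrix.charmatrix_apply,
        Matrix.add_apply, Matrix.smul_apply, Pi.single_apply, Matrix.single_apply]
      by_cases hz : z = j
      · simp [hz]; ring
      · simp [hz, Ne.symm hz]
    · rw [Matrix.charmatrix_apply, Matrix.charmatrix_apply, Matrix.add_apply, Matrix.smul_apply,
        Matrix.single_apply_of_row_ne (Ne.symm h), smul_zero, add_zero]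
  rw [Matrix.charpoly, h1, Matrix.det_updateRow_add, Matrix.updateRow_eq_self,
    Matrix.det_updateRow_smul, ← Matrix.adjugate_apply, Matrix.charpoly]
  ring

/-- The coefficients of the adjugate are combinations of powers of `A`; at the columns considered
only the highest power, with coefficient `1`, can reach from the first row. -/
theorem coeff_adjugate_charmatrix_hess {N : ℕ} {A : Mat N} (hA : A ∈ hess N) {z : Fin N}
    (hz : z.1 = 0) (q : ℕ) (a : Fin N) (ha : q ≤ a.1) :
    (A.charmatrix.adjugate z a).coeff (N - (q + 1)) = if a.1 = q then 1 else 0 := by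
  have h0 := a.2
  have h1 := congrFun (congrFun (coeffMat_adjugate_eq A (N - (q + 1))) z) a
  rw [coeffMat, Matrix.map_apply] at h1
  rw [h1, Matrix.sum_apply, Finset.sum_eq_single N]
  · rw [Matrix.smul_apply, coeff_charpoly_top, one_smul, pow_apply_zero hA hz _ _ (by omega)]
    refine if_congr ?_ rfl rfl
    omega
  · intro j hj hjN
    have hj' := Finset.mem_Icc.1 hj
    rw [Matrix.smul_apply, pow_apply_zero hA hz _ _ (by omega), if_neg (by omega), smul_zero]
  · intro h
    exact absurd (Finset.mem_Icc.2 ⟨by omega, le_rfl⟩) h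

/-- The point at which the differentials of the family are in triangular position. -/
noncomputable def seed (n : ℕ) : Mat n := nf 0 1

theorem seed_mem_hessReg (n : ℕ) : seed n ∈ hessReg n := nf_one_mem_hessReg n

theorem seed_low {i j : Fin n} (h : j ≤ i) :
    seed n i j = if i.1 + j.1 + 1 = n ∧ i ≠ j then 1 else 0 := by
  rcases eq_or_lt_of_le h with rfl | hlt
  · rw [seed, nf_diag]
    simp
  · rw [seed, nf_low _ _ hlt]
    simp [ne_of_gt hlt]

/-- The seed is self-similar, which reduces the gradient of `I_{m,r}` to the case of a full
characteristic polynomial. -/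
theorem seed_mid {r : ℕ} (h : 2 * r ≤ n) :
    (seed n).submatrix (midIx h) (midIx h) = seed (n - 2 * r) := by
  have hle : ∀ i j, midIx (r := r) h i ≤ midIx h j ↔ i ≤ j := fun i j => by
    simp only [Fin.le_def, midIx]; omega
  ext i j
  rw [Matrix.submatrix_apply]
  rcases le_or_gt j i with hij | hij
  · rw [seed_low ((hle j i).2 hij), seed_low hij]
    refine if_congr (and_congr ?_ ?_) rfl rfl
    · simp only [midIx]; omega
    · simp only [midIx, ne_eq, Fin.ext_iff]; omega
  · rw [(seed_mem_hessReg n).1 _ _ (lt_of_not_ge fun hh => absurd ((hle j i).1 hh) (not_le.2 hij)),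
      (seed_mem_hessReg _).1 _ _ hij, eps, eps, Matrix.of_apply, Matrix.of_apply]
    refine if_congr ?_ rfl rfl
    simp only [midIx]; omega

theorem schur_eq_of_hi_mid_eq_zero {r : ℕ} (h : 2 * r ≤ n) {X : Mat n}
    (hX : X.submatrix (hiIx h) (midIx h) = 0) : schur h X = X.submatrix (midIx h) (midIx h) := by
  rw [schur, hX, Matrix.mul_zero, sub_zero]

theorem seed_hi_mid {r : ℕ} (h : 2 * r ≤ n) (i : Fin r) (j : Fin (n - 2 * r)) :
    seed n (hiIx h i) (midIx h j) = 0 := by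
  have hi := i.2
  have hj := j.2
  rw [seed_low (Fin.le_def.2 (by simp only [hiIx, midIx]; omega)), if_neg]
  simp only [hiIx, midIx]
  omega

theorem seed_E_ne_zero {r : ℕ} (h : 2 * r ≤ n) : E 0 r (seed n) ≠ 0 :=
  hessReg_E_ne_zero (seed_mem_hessReg n) h

/-- The varied entry `(j, i)` is in column `i < r`. The block of last rows and middle columns is
zero and stays so, and thus the Schur complement remains the unchanged middle block. -/
theorem grad_I_seed_of_lt (m : ℕ) {r : ℕ} (h : 2 * r ≤ n) {i j : Fin n} (hi : i.1 < r) :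
    grad (I m r) (seed n) i j = 0 := by
  have hE := seed_E_ne_zero h
  refine grad_eq_zero_of_line (I_differentiableAt hE) ?_
  have hcont : Filter.Tendsto (fun t : ℝ => E 0 r (seed n + t • Matrix.single j i (1 : ℝ)))
      (nhds 0) (nhds (E 0 r (seed n))) := by
    have h1 := (hasDerivAt_comp_line (E_differentiable 0 r (seed n))
      (Matrix.single j i 1)).continuousAt.tendsto
    rwa [zero_smul, add_zero] at h1
  filter_upwards [hcont.eventually_ne hE] with t ht
  have hcol : ∀ a b, (seed n + t • Matrix.single j i (1 : ℝ)) a (midIx h b) =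
      seed n a (midIx h b) := fun a b => line_apply_of_ne _ t (by
    rintro ⟨-, hb⟩
    have := Fin.ext_iff.1 hb
    simp only [midIx] at this
    omega)
  rw [I_eq_coeff h ht, I_eq_coeff h hE, schur_eq_of_hi_mid_eq_zero h, schur_eq_of_hi_mid_eq_zero h]
  · congr 2
    ext a b
    exact hcol _ b
  · ext a b
    exact seed_hi_mid h a b
  · ext a b
    exact (hcol _ b).trans (seed_hi_mid h a b)

/-- Here the varied entry lies in the first column of the middle block, itself a seed, so the
derivative is minus a coefficient of an adjugate entry in its first row. -/
theorem grad_I_seed {q r : ℕ} (h : 2 * r < n) {i j : Fin n} (hi : i.1 = r) (hj1 : r + q ≤ j.1)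
    (hj2 : j.1 + r < n) :
    grad (I (q + 1) r) (seed n) i j = if j.1 = r + q then -1 else 0 := by
  have hE := seed_E_ne_zero h.le
  rw [grad, Matrix.of_apply]
  refine fderiv_eq_of_line (I_differentiableAt hE) ?_
  set z : Fin (n - 2 * r) := ⟨0, by omega⟩ with hz
  set a : Fin (n - 2 * r) := ⟨j.1 - r, by omega⟩ with ha
  have hzi : midIx h.le z = i := Fin.ext (by simp only [midIx, hz]; omega)
  have haj : midIx h.le a = j := Fin.ext (by simp only [midIx, ha]; omega)
  have hmid_inj : Function.Injective (midIx h.le) := fun b c hbc => by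
    have := Fin.ext_iff.1 hbc
    simp only [midIx] at this
    exact Fin.ext (by omega)
  have key : ∀ t : ℝ, I (q + 1) r (seed n + t • Matrix.single j i (1 : ℝ)) =
      I (q + 1) r (seed n) - t * ((seed (n - 2 * r)).charmatrix.adjugate z a).coeff
        (n - 2 * r - (q + 1)) := by
    intro t
    have hEt : E 0 r (seed n + t • Matrix.single j i (1 : ℝ)) = E 0 r (seed n) :=
      E_zero_congr h.le fun b c hb hc => line_apply_of_ne _ t (by
        rintro ⟨rfl, rfl⟩
        omega)
    have hhi : (seed n + t • Matrix.single j i (1 : ℝ)).submatrix (hiIx h.le) (midIx h.le) = 0 := by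
      ext b c
      rw [Matrix.submatrix_apply, line_apply_of_ne, seed_hi_mid, Matrix.zero_apply]
      rintro ⟨hb, -⟩
      have := Fin.ext_iff.1 hb
      simp only [hiIx] at this
      omega
    have hmm : (seed n + t • Matrix.single j i (1 : ℝ)).submatrix (midIx h.le) (midIx h.le) =
        seed (n - 2 * r) + t • Matrix.single a z (1 : ℝ) := by
      rw [← seed_mid h.le]
      ext b c
      simp only [Matrix.submatrix_apply, Matrix.add_apply, Matrix.smul_apply, Matrix.single_apply,
        ← hzi, ← haj, hmid_inj.eq_iff]
    rw [I_eq_coeff h.le (hEt ▸ hE), I_eq_coeff h.le hE, schur_eq_of_hi_mid_eq_zero h.le hhi, hmm,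
      schur_eq_of_hi_mid_eq_zero h.le (by ext b c; exact seed_hi_mid h.le b c), seed_mid h.le,
      charpoly_add_smul_single, Polynomial.coeff_sub, Polynomial.coeff_C_mul]
  have hd := ((hasDerivAt_id (0 : ℝ)).mul_const
    (((seed (n - 2 * r)).charmatrix.adjugate z a).coeff (n - 2 * r - (q + 1)))).const_sub
      (I (q + 1) r (seed n))
  refine hasDerivAt_congr hd key ?_
  rw [coeff_adjugate_charmatrix_hess (seed_mem_hessReg _).1 rfl q a (by simp only [ha]; omega)]
  have : a.1 = q ↔ j.1 = r + q := by simp only [ha]; omega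
  simp only [this]
  split_ifs <;> simp

/-- The position attached to a member of the family. -/
def famPos (k : FamIdx n) : Fin n × Fin n :=
  (⟨k.1.1, by have := k.1.2; omega⟩, ⟨k.1.1 + k.2.1, by have := k.2.2; omega⟩)

theorem famPos_le (k : FamIdx n) : (famPos k).1 ≤ (famPos k).2 :=
  Fin.le_def.2 (Nat.le_add_right _ _)

theorem grad_fam_seed_self (k : FamIdx n) :
    grad (fam k) (seed n) (famPos k).1 (famPos k).2 ≠ 0 := by
  have h2 := k.1.2
  have h3 := k.2.2
  by_cases h : k.1.1 = 0
  · rw [fam_of_eq_zero h, grad_trace_pow, Matrix.smul_apply, Nat.add_sub_cancel,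
      pow_apply_zero (seed_mem_hessReg n).1 h _ _ (by simp only [famPos]; omega),
      if_pos (by simp only [famPos]; omega), smul_eq_mul, mul_one]
    exact Nat.cast_ne_zero.2 (Nat.succ_ne_zero _)
  · rw [fam_of_ne_zero h, grad_I_seed (r := k.1.1) (i := (famPos k).1) (j := (famPos k).2) (by
      omega) rfl
      le_rfl (by change k.1.1 + k.2.1 + k.1.1 < n; omega),
      if_pos (show (famPos k).2.1 = k.1.1 + k.2.1 from rfl)]
    norm_num

theorem grad_fam_seed_eq_zero {k l : FamIdx n}
    (hkl : l.1.1 < k.1.1 ∨ (l.1.1 = k.1.1 ∧ k.2.1 < l.2.1)) :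
    grad (fam k) (seed n) (famPos l).1 (famPos l).2 = 0 := by
  have h2 := k.1.2
  have h3 := l.2.2
  by_cases h : k.1.1 = 0
  · have hl : l.1.1 = 0 := by omega
    rw [fam_of_eq_zero h, grad_trace_pow, Matrix.smul_apply, Nat.add_sub_cancel,
      pow_apply_zero (seed_mem_hessReg n).1 hl _ _ (by simp only [famPos]; omega),
      if_neg (by simp only [famPos]; omega), smul_zero]
  · rw [fam_of_ne_zero h]
    rcases hkl with hlt | ⟨heq, hlt⟩
    · exact grad_I_seed_of_lt _ (by omega) hlt
    · rw [grad_I_seed (i := (famPos l).1) (j := (famPos l).2) (by omega) heq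
        (by change k.1.1 + k.2.1 ≤ l.1.1 + l.2.1; omega)
        (by change l.1.1 + l.2.1 + k.1.1 < n; omega),
        if_neg (by change ¬ (l.1.1 + l.2.1 = k.1.1 + k.2.1); omega)]

end Seed

/-! ### Generic independence of the family -/

section Independence

variable {n : ℕ}

/-- The gradient of `fam k`, up to a nonvanishing factor, as a matrix of polynomials. -/
noncomputable def famGradPoly (k : FamIdx n) (i j : Fin n) : MvPolynomial (Fin n × Fin n) ℝ :=
  if k.1.1 = 0 then MvPolynomial.pderiv (j, i) (trPoly n (k.2.1 + 1)) else
    EPoly n 0 k.1.1 * MvPolynomial.pderiv (j, i) (EPoly n (k.2.1 + 1) k.1.1) -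
      EPoly n (k.2.1 + 1) k.1.1 * MvPolynomial.pderiv (j, i) (EPoly n 0 k.1.1)

theorem exists_evalAt_famGradPoly (k : FamIdx n) {X : Mat n} (hX : X ∈ hessGen n) :
    ∃ s : ℝ, s ≠ 0 ∧ ∀ i j, grad (fam k) X i j = s * evalAt (famGradPoly k i j) X := by
  by_cases h : k.1.1 = 0
  · refine ⟨1, one_ne_zero, fun i j => ?_⟩
    rw [fam_of_eq_zero h, trace_pow_eq_evalAt_fun, grad_evalAt_apply, famGradPoly, if_pos h,
      one_mul]
  · have hE := hessGen_E_ne_zero hX k.1.2 h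
    refine ⟨(E 0 k.1.1 X ^ 2)⁻¹, inv_ne_zero (pow_ne_zero _ hE), fun i j => ?_⟩
    rw [fam_of_ne_zero h, famGradPoly, if_neg h, evalAt_sub, evalAt_mul, evalAt_mul, grad,
      Matrix.of_apply]
    refine fderiv_eq_of_line (I_differentiableAt hE) ?_
    have h1 := hasDerivAt_comp_line (E_differentiable (k.2.1 + 1) k.1.1 X) (Matrix.single j i 1)
    have h2 := hasDerivAt_comp_line (E_differentiable 0 k.1.1 X) (Matrix.single j i 1)
    have h3 := h1.div h2 (by rw [zero_smul, add_zero]; exact hE)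
    refine hasDerivAt_congr h3 (fun _ => rfl) ?_
    rw [zero_smul, add_zero, E_eq_evalAt_fun, E_eq_evalAt_fun, fderiv_evalAt, fderiv_evalAt,
      div_eq_inv_mul]
    ring

/-- The determinant of the family in the positions `famPos`. -/
noncomputable def famDet (n : ℕ) : MvPolynomial (Fin n × Fin n) ℝ :=
  (Matrix.of fun k l : FamIdx n => famGradPoly k (famPos l).1 (famPos l).2).det

theorem evalAt_famDet (X : Mat n) : evalAt (famDet n) X =
    (Matrix.of fun k l : FamIdx n => evalAt (famGradPoly k (famPos l).1 (famPos l).2) X).det := by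
  rw [famDet, evalAt, RingHom.map_det]
  rfl

theorem evalAt_famDet_seed : evalAt (famDet n) (seed n) ≠ 0 := by
  rw [evalAt_famDet]
  intro h0
  obtain ⟨c, hc, h⟩ := Matrix.exists_vecMul_eq_zero_iff.2 h0
  refine hc ?_
  have hS : ∀ k : FamIdx n, ∃ s : ℝ, s ≠ 0 ∧ ∀ i j,
      grad (fam k) (seed n) i j = s * evalAt (famGradPoly k i j) (seed n) := fun k =>
    exists_evalAt_famGradPoly k (hessReg_subset_hessGen (seed_mem_hessReg n))
  -- The measure orders the indices by increasing `r`, then decreasing `m`. In column `l` of the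
  -- minor only `l` itself and earlier indices contribute, by `grad_fam_seed_eq_zero`.
  have main : ∀ (N : ℕ) (k : FamIdx n), k.1.1 * (n + 1) + (n - k.2.1) = N → c k = 0 := by
    intro N
    induction N using Nat.strong_induction_on with
    | _ N ih =>
      intro l hl
      have h1 := congrFun h l
      rw [Matrix.vecMul, dotProduct, Finset.sum_eq_single l] at h1
      · obtain ⟨s, -, hs⟩ := hS l
        have h2 := grad_fam_seed_self l
        rw [hs] at h2
        exact (mul_eq_zero.1 h1).resolve_right (mul_ne_zero_iff.1 h2).2
      · intro k _ hkl
        by_cases hk : l.1.1 < k.1.1 ∨ (l.1.1 = k.1.1 ∧ k.2.1 < l.2.1)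
        · obtain ⟨s, hs0, hs⟩ := hS k
          have h2 := grad_fam_seed_eq_zero hk
          rw [hs] at h2
          rw [Matrix.of_apply, (mul_eq_zero.1 h2).resolve_left hs0, mul_zero]
        · have hk1 := k.2.2
          have hl1 := l.2.2
          rw [ih (k.1.1 * (n + 1) + (n - k.2.1)) ?_ k rfl, zero_mul]
          rcases lt_or_eq_of_le (not_lt.1 (not_or.1 hk).1) with hlt | heq
          · have : (k.1.1 + 1) * (n + 1) ≤ l.1.1 * (n + 1) := Nat.mul_le_mul_right _ hlt
            rw [Nat.succ_mul] at this
            omega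
          · have hne : k.2.1 ≠ l.2.1 := by
              intro h5
              apply hkl
              obtain ⟨⟨k1, hk1⟩, k2, hk2⟩ := k
              obtain ⟨⟨l1, hl1⟩, l2, hl2⟩ := l
              simp only at heq h5
              subst heq h5
              rfl
            have : k.1.1 * (n + 1) = l.1.1 * (n + 1) := by rw [heq]
            omega
      · simp
  funext k
  exact main _ k rfl

theorem linearIndependent_diffH_fam {X : Mat n} (hX : X ∈ hessGen n)
    (hd : evalAt (famDet n) X ≠ 0) :
    LinearIndependent ℝ (fun k : FamIdx n => diffH (fam k) X) := by
  rw [Fintype.linearIndependent_iff]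
  intro c hc
  choose s hs0 hs using fun k : FamIdx n => exists_evalAt_famGradPoly k hX
  rw [evalAt_famDet] at hd
  have h1 : (fun k => c k * s k) = 0 := by
    refine Matrix.eq_zero_of_vecMul_eq_zero hd ?_
    funext l
    have h2 := congrFun (congrFun hc (famPos l).1) (famPos l).2
    rw [Matrix.sum_apply] at h2
    refine Eq.trans (Finset.sum_congr rfl fun k _ => ?_) h2
    rw [Matrix.smul_apply, diffH, entryProj_of (S := (· ≤ ·)) (famPos_le l), hs, smul_eq_mul,
      ← mul_assoc]
    rfl
  intro k
  exact (mul_eq_zero.1 (congrFun h1 k)).resolve_right (hs0 k)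

/-- The size of the family is half of the dimension of `𝔟₊` plus the generic corank. Dropping `r =
0` passes from `n + 2` to `n`. -/
theorem two_mul_card_famIdx (n : ℕ) :
    2 * Fintype.card (FamIdx n) = n * (n + 1) / 2 + (n + 1) / 2 := by
  have h1 : Fintype.card (FamIdx n) = ∑ r ∈ Finset.range ((n + 1) / 2), (n - 2 * r) := by
    rw [Fintype.card_sigma, ← Fin.sum_univ_eq_sum_range (fun r => n - 2 * r)]
    simp
  rw [h1]
  clear h1
  induction n using Nat.twoStepInduction with
  | zero => rfl
  | one => rfl
  | more n ih _ =>
    have e1 : (n + 2 + 1) / 2 = (n + 1) / 2 + 1 := by omega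
    have e2 : (n + 2) * (n + 2 + 1) / 2 = n * (n + 1) / 2 + (2 * n + 3) := by
      rw [← Nat.add_mul_div_left _ _ two_pos]
      congr 1
      ring
    have e3 : ∀ r, n + 2 - 2 * (r + 1) = n - 2 * r := fun r => by omega
    rw [e1, e2, Finset.sum_range_succ', Finset.sum_congr rfl fun r _ => e3 r, mul_add, ih]
    omega

end Independence


/-! ### Maximality of the family -/

section Maximality

variable {n : ℕ}

/-- An isotropic independent family of half the dimension plus half the dimension of the radical
spans its own orthogonal. -/
theorem span_eq_orthogonal {V ι : Type*} [AddCommGroup V] [Module ℝ V] [FiniteDimensional ℝ V]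
    [Fintype ι] {B : LinearMap.BilinForm ℝ V} {v : ι → V}
    (hv : LinearIndependent ℝ v) (h0 : ∀ k l, B (v k) (v l) = 0)
    (hc : Module.finrank ℝ V + Module.finrank ℝ (LinearMap.ker B) ≤ 2 * Fintype.card ι) :
    Submodule.span ℝ (Set.range v) = B.orthogonal (Submodule.span ℝ (Set.range v)) := by
  have hle : Submodule.span ℝ (Set.range v) ≤ B.orthogonal (Submodule.span ℝ (Set.range v)) := by
    refine Submodule.span_le.2 ?_
    rintro _ ⟨l, rfl⟩
    rw [SetLike.mem_coe, LinearMap.BilinForm.mem_orthogonal_iff]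
    intro w hw
    have h1 : Submodule.span ℝ (Set.range v) ≤ LinearMap.ker (B.flip (v l)) := by
      refine Submodule.span_le.2 ?_
      rintro _ ⟨k, rfl⟩
      exact h0 k l
    exact h1 hw
  refine Submodule.eq_of_le_of_finrank_le hle ?_
  have h1 := LinearMap.BilinForm.finrank_add_finrank_orthogonal' (B := B)
    (Submodule.span ℝ (Set.range v))
  have h2 : Module.finrank ℝ (Submodule.span ℝ (Set.range v) ⊓ LinearMap.ker B : Submodule ℝ V) ≤
      Module.finrank ℝ (LinearMap.ker B) := Submodule.finrank_mono inf_le_right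
  rw [finrank_span_eq_card hv] at h1 ⊢
  omega

/-- The Poisson tensor at `X` as a bilinear form. -/
noncomputable def poissonForm (X : Mat n) : LinearMap.BilinForm ℝ (utSub n) :=
  LinearMap.mk₂ ℝ (fun Y Z : utSub n => (Y.1 * hamLin X Z).trace)
    (fun Y Y' Z => by rw [Submodule.coe_add, Matrix.add_mul, Matrix.trace_add])
    (fun c Y Z => by rw [Submodule.coe_smul, Matrix.smul_mul, Matrix.trace_smul])
    (fun Y Z Z' => by rw [map_add, Matrix.mul_add, Matrix.trace_add])
    (fun c Y Z => by rw [map_smul, Matrix.mul_smul, Matrix.trace_smul])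

theorem poissonForm_apply (X : Mat n) (Y Z : utSub n) :
    poissonForm X Y Z = (Y.1 * hamLin X Z).trace := rfl

theorem poissonForm_diffH (f g : Mat n → ℝ) (X : Mat n) :
    poissonForm X ⟨diffH f X, diffH_mem_utSub f X⟩ ⟨diffH g X, diffH_mem_utSub g X⟩ =
      bracketH f g X := (bracketH_eq_trace_hamLin f g X).symm

theorem poissonForm_swap (X : Mat n) (Y Z : utSub n) : poissonForm X Y Z = - poissonForm X Z Y := by
  have hd : ∀ Y : utSub n, (⟨diffH (trLin Y.1) X, diffH_mem_utSub _ X⟩ : utSub n) = Y := fun Y =>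
    Subtype.ext (diffH_trLin Y.2 X)
  have h1 := poissonForm_diffH (trLin Y.1) (trLin Z.1) X
  have h2 := poissonForm_diffH (trLin Z.1) (trLin Y.1) X
  rw [hd, hd] at h1 h2
  rw [h1, h2]
  exact bracket_antisymm _ _ _ _

theorem ker_poissonForm (X : Mat n) : LinearMap.ker (poissonForm X) = LinearMap.ker (hamLin X) := by
  ext Y
  rw [LinearMap.mem_ker, LinearMap.mem_ker]
  constructor
  · intro h
    have hd : diffH (trLin Y.1) X = Y.1 := diffH_trLin Y.2 X
    have h1 := hamLin_diffH_eq_zero (f := trLin Y.1) (X := X) fun g _ => by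
      have h2 : (⟨diffH (trLin Y.1) X, diffH_mem_utSub _ X⟩ : utSub n) = Y := Subtype.ext hd
      rw [← poissonForm_diffH, h2, h, LinearMap.zero_apply]
    have h2 : (⟨diffH (trLin Y.1) X, diffH_mem_utSub _ X⟩ : utSub n) = Y := Subtype.ext hd
    rwa [h2] at h1
  · intro h
    refine LinearMap.ext fun Z => ?_
    rw [poissonForm_swap, poissonForm_apply, h, Matrix.mul_zero, Matrix.trace_zero, neg_zero,
      LinearMap.zero_apply]

/-- The differential of `fam k` as an upper triangular matrix. -/
noncomputable def famDiff (X : Mat n) (k : FamIdx n) : utSub n :=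
  ⟨diffH (fam k) X, diffH_mem_utSub (fam k) X⟩

theorem linearIndependent_famDiff {X : Mat n}
    (h : LinearIndependent ℝ (fun k : FamIdx n => diffH (fam k) X)) :
    LinearIndependent ℝ (famDiff X) := LinearIndependent.of_comp (utSub n).subtype h

theorem span_famDiff {X : Mat n} (hX : X ∈ hessReg n)
    (h : LinearIndependent ℝ (fun k : FamIdx n => diffH (fam k) X)) :
    Submodule.span ℝ (Set.range (famDiff X)) =
      (poissonForm X).orthogonal (Submodule.span ℝ (Set.range (famDiff X))) := by
  refine span_eq_orthogonal (linearIndependent_famDiff h) (fun k l => ?_) ?_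
  · rw [famDiff, famDiff, poissonForm_diffH]
    exact bracket_fam_eq_zero k l (hessReg_subset_hessGen hX)
  · rw [ker_poissonForm, finrank_ker hX, finrank_utSub, two_mul_card_famIdx]

theorem mem_span_famDiff {X : Mat n} (hX : X ∈ hessReg n)
    (h : LinearIndependent ℝ (fun k : FamIdx n => diffH (fam k) X)) {Y : utSub n}
    (hY : ∀ k, poissonForm X (famDiff X k) Y = 0) : Y ∈ Submodule.span ℝ (Set.range (famDiff X)) :=
      by
  rw [span_famDiff hX h, LinearMap.BilinForm.mem_orthogonal_iff]
  intro w hw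
  have h1 : Submodule.span ℝ (Set.range (famDiff X)) ≤ LinearMap.ker ((poissonForm X).flip Y) := by
    refine Submodule.span_le.2 ?_
    rintro _ ⟨k, rfl⟩
    exact hY k
  exact h1 hw

theorem diffH_mem_span_fam {X : Mat n} (hX : X ∈ hessReg n)
    (h : LinearIndependent ℝ (fun k : FamIdx n => diffH (fam k) X)) {F : Mat n → ℝ}
    (hF : ∀ k : FamIdx n, bracketH F (fam k) X = 0) :
    diffH F X ∈ Submodule.span ℝ (Set.range fun k : FamIdx n => diffH (fam k) X) := by
  have h1 := mem_span_famDiff hX h (Y := ⟨diffH F X, diffH_mem_utSub F X⟩) fun k => by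
    rw [poissonForm_swap, famDiff, poissonForm_diffH, hF, neg_zero]
  have h2 := Submodule.mem_map_of_mem (f := (utSub n).subtype) h1
  rw [Submodule.map_span, ← Set.range_comp] at h2
  exact h2

theorem finrank_map_of_ker_le {V W : Type*} [AddCommGroup V] [Module ℝ V] [FiniteDimensional ℝ V]
    [AddCommGroup W] [Module ℝ W] (f : V →ₗ[ℝ] W) {S : Submodule ℝ V} (h : LinearMap.ker f ≤ S) :
    Module.finrank ℝ (S.map f) + Module.finrank ℝ (LinearMap.ker f) = Module.finrank ℝ S := by
  have h1 := (f.domRestrict S).finrank_range_add_finrank_ker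
  rw [LinearMap.range_domRestrict, LinearMap.ker_domRestrict] at h1
  rw [← h1, (Submodule.comapSubtypeEquivOfLe h).finrank_eq]

/-- The kernel of the Poisson tensor is orthogonal to everything, so it lies in the span of the
differentials; the image of the span then loses exactly the corank. -/
theorem two_mul_finrank_span_hamVec {X : Mat n} (hX : X ∈ hessReg n)
    (h : LinearIndependent ℝ (fun k : FamIdx n => diffH (fam k) X)) :
    2 * Module.finrank ℝ (Submodule.span ℝ (Set.range fun k : FamIdx n => hamVec (fam k) X)) =
      Module.finrank ℝ (charSpace X) := by
  have hker : LinearMap.ker (hamLin X) ≤ Submodule.span ℝ (Set.range (famDiff X)) := by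
    intro Y hY
    refine mem_span_famDiff hX h fun k => ?_
    rw [poissonForm_apply, LinearMap.mem_ker.1 hY, Matrix.mul_zero, Matrix.trace_zero]
  have h1 : Submodule.span ℝ (Set.range fun k : FamIdx n => hamVec (fam k) X) =
      (Submodule.span ℝ (Set.range (famDiff X))).map (hamLin X) := by
    rw [Submodule.map_span, ← Set.range_comp]
    rfl
  have h2 := finrank_map_of_ker_le (hamLin X) hker
  rw [← h1, finrank_ker hX, finrank_span_eq_card (linearIndependent_famDiff h)] at h2
  have h3 := two_mul_card_famIdx n
  have h4 := finrank_charSpace hX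
  omega

end Maximality

/-! ### Density in the orbits -/

section Density

variable {n : ℕ}

theorem analyticAt_det {A : ℝ → Mat n} {t : ℝ} (h : ∀ i j, AnalyticAt ℝ (fun s => A s i j) t) :
    AnalyticAt ℝ (fun s => (A s).det) t := by
  simp only [Matrix.det_apply']
  exact Finset.analyticAt_fun_sum _ fun σ _ => analyticAt_const.mul
    (Finset.analyticAt_fun_prod _ fun i _ => h _ _)

theorem analyticAt_mul_apply {A B : ℝ → Mat n} {t : ℝ}
    (hA : ∀ i j, AnalyticAt ℝ (fun s => A s i j) t)
    (hB : ∀ i j, AnalyticAt ℝ (fun s => B s i j) t) (i j : Fin n) :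
    AnalyticAt ℝ (fun s => (A s * B s) i j) t := by
  simp only [Matrix.mul_apply]
  exact Finset.analyticAt_fun_sum _ fun k _ => (hA i k).mul (hB k j)

theorem analyticAt_inv_apply {A : ℝ → Mat n} {t : ℝ}
    (hA : ∀ i j, AnalyticAt ℝ (fun s => A s i j) t) (hdet : (A t).det ≠ 0) (i j : Fin n) :
    AnalyticAt ℝ (fun s => (A s)⁻¹ i j) t := by
  have h1 : ∀ s, (A s)⁻¹ i j = (A s).det⁻¹ * ((A s).updateRow j (Pi.single i 1)).det := fun s => by
    rw [Matrix.inv_def, Matrix.smul_apply, Matrix.adjugate_apply, smul_eq_mul,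
      Ring.inverse_eq_inv']
  simp only [h1]
  refine ((analyticAt_det hA).inv hdet).mul (analyticAt_det fun k l => ?_)
  simp only [Matrix.updateRow_apply]
  split_ifs
  · exact analyticAt_const
  · exact hA k l

theorem analyticAt_evalAt_coadCurve (d : MvPolynomial (Fin n × Fin n) ℝ) {p : ℝ → Mat n} {t : ℝ}
    (X : Mat n) (hp : ∀ i j, AnalyticAt ℝ (fun s => p s i j) t) (hdet : (p t).det ≠ 0) :
    AnalyticAt ℝ (fun s => evalAt d (coadCurve p X s)) t := by
  have h1 : ∀ ij : Fin n × Fin n, AnalyticAt ℝ (fun s => coadCurve p X s ij.1 ij.2) t := by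
    rintro ⟨i, j⟩
    have h2 := analyticAt_mul_apply (analyticAt_mul_apply (analyticAt_inv_apply hp hdet)
      (B := fun _ => X - eps n) fun _ _ => analyticAt_const) hp i j
    by_cases hij : j ≤ i
    · have h3 : ∀ s, coadCurve p X s i j = eps n i j + ((p s)⁻¹ * (X - eps n) * p s) i j :=
        fun s => congrArg (eps n i j + ·) (entryProj_of (S := fun i j : Fin n => j ≤ i) hij _)
      simp only [h3]
      exact analyticAt_const.add h2
    · have h3 : ∀ s, coadCurve p X s i j = eps n i j + 0 :=
        fun s => congrArg (eps n i j + ·) (entryProj_of_not (S := fun i j : Fin n => j ≤ i) hij _)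
      simp only [h3]
      exact analyticAt_const
  have h2 := AnalyticAt.aeval_mvPolynomial (𝕜 := ℝ)
    (f := fun (s : ℝ) (ij : Fin n × Fin n) => coadCurve p X s ij.1 ij.2) h1 d
  simp only [MvPolynomial.aeval_eq_eval] at h2
  exact h2

/-- A Zariski open set that meets a `B`-orbit is dense in it. -/
theorem orbitB_subset_closure (d : MvPolynomial (Fin n × Fin n) ℝ) {X : Mat n} (hX : X ∈ hess n)
    (hd : evalAt d X ≠ 0) : orbitB X ⊆ closure (orbitB X ∩ {Y | evalAt d Y ≠ 0}) := by
  rintro _ ⟨b, hb, rfl⟩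
  set p : ℝ → Mat n := fun t => 1 + t • ((b : Mat n) - 1) with hp
  -- An open convex set of parameters containing `0` and `1` on which the segment stays in `B`.
  -- Being open, it allows approach to `1` along an analytic curve in the orbit.
  set J : Set ℝ := {t | ∀ i, 0 < p t i i} with hJ
  have hpe : ∀ t i j, p t i j = (1 : Mat n) i j + t * ((b : Mat n) - 1) i j := fun t i j => rfl
  have hut : ∀ t, UT (p t) := fun t => UT.one.add (UT.smul t (UT.sub hb.1 UT.one))
  have hdet : ∀ t ∈ J, (p t).det ≠ 0 := fun t ht => (hut t).det_ne_zero fun i => (ht i).ne'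
  have hconv : Convex ℝ J := by
    intro s hs t ht u v hu hv huv i
    have h1 : p (u • s + v • t) i i = u * p s i i + v * p t i i := by
      rw [hpe, hpe, hpe, smul_eq_mul, smul_eq_mul]
      linear_combination (-(1 : Mat n) i i) * huv
    rw [h1]
    rcases eq_or_lt_of_le hu with h0 | h0
    · have hv1 : v = 1 := by rw [← huv, ← h0, zero_add]
      rw [← h0, hv1, zero_mul, one_mul, zero_add]
      exact ht i
    · exact add_pos_of_pos_of_nonneg (mul_pos h0 (hs i)) (mul_nonneg hv (ht i).le)
  have h0J : (0 : ℝ) ∈ J := fun i => by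
    rw [hpe]; simp
  have h1J : (1 : ℝ) ∈ J := fun i => by
    rw [hpe]; simpa using hb.2 i
  have hopen : IsOpen J := by
    rw [hJ, Set.ofPred_forall]
    refine isOpen_iInter_of_finite fun i => isOpen_lt continuous_const ?_
    simp only [hpe]
    fun_prop
  have han : AnalyticOnNhd ℝ (fun s => evalAt d (coadCurve p X s)) J := fun t ht =>
    analyticAt_evalAt_coadCurve d X (fun i j => by
      simp only [hpe]
      exact analyticAt_const.add (analyticAt_id.mul analyticAt_const)) (hdet t ht)
  have hc0 : coadCurve p X 0 = X := by
    have h1 := coadH_eq 1 X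
    rw [coadH_one hX] at h1
    rw [coadCurve, hp]
    simp only [zero_smul, add_zero]
    exact h1.symm
  have hc1 : coadCurve p X 1 = coadH b X := by
    rw [coadH_eq, coadCurve, hp]
    simp only [one_smul, add_sub_cancel]
  have hmem : ∀ t ∈ J, coadCurve p X t ∈ orbitB X := by
    intro t ht
    obtain ⟨g, hg⟩ : ∃ g : GL (Fin n) ℝ, (g : Mat n) = p t :=
      ⟨Matrix.GeneralLinearGroup.mkOfDetNeZero (p t) (hdet t ht), rfl⟩
    refine ⟨g, ⟨?_, fun i => ?_⟩, ?_⟩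
    · rw [IsUpper, hg]; exact hut t
    · rw [hg]; exact ht i
    · rw [coadH_eq, hg, coadCurve]
  have hcont : ContinuousAt (coadCurve p X) 1 :=
    (hasDerivAt_coadCurve X (hasDerivAt_one_add_smul _ 1) (hdet 1 h1J)).continuousAt
  rw [← hc1]
  -- If `d` vanished along the curve near `t = 1`, it would vanish on all of `J`, in particular at
  -- `t = 0`, where the curve is at `X`.
  rcases (han 1 h1J).eventually_eq_zero_or_eventually_ne_zero with h | h
  · have h1 := han.eqOn_zero_of_preconnected_of_eventuallyEq_zero hconv.isPreconnected h1J h h0J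
    refine absurd h1 ?_
    change evalAt d (coadCurve p X 0) ≠ 0
    rwa [hc0]
  · have hev : ∀ᶠ t in nhdsWithin 1 {(1 : ℝ)}ᶜ,
        coadCurve p X t ∈ orbitB X ∩ {Y | evalAt d Y ≠ 0} := by
      filter_upwards [h, nhdsWithin_le_nhds (hopen.mem_nhds h1J)] with t ht1 ht2
      exact ⟨hmem t ht2, ht1⟩
    exact mem_closure_of_tendsto (hcont.tendsto.mono_left nhdsWithin_le_nhds) hev

end Density

/-! ### The family is not invariant -/

section NonInvariance

variable {n : ℕ}

/-- A point of `ℋ_gen` at which `Tr X²` is not infinitesimally invariant. -/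
noncomputable def bumped (n : ℕ) : Mat n := Matrix.of fun i j =>
  if i.1 = 1 ∧ j.1 = 0 then 1 else seed n i j

theorem bumped_mem_hessGen (hn : 2 ≤ n) : bumped n ∈ hessGen n := by
  refine ⟨fun i j hij => ?_, fun r h1 h2 => ?_⟩
  · have := Fin.lt_def.1 hij
    rw [bumped, Matrix.of_apply, if_neg (by omega), (seed_mem_hessReg n).1 i j hij]
  · rw [E_zero_congr (Y := seed n) (by omega) fun i j hi hj => ?_]
    · exact seed_E_ne_zero (by omega)
    · rw [bumped, Matrix.of_apply, if_neg (by omega)]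

theorem bumped_nonneg (i j : Fin n) : 0 ≤ bumped n i j := by
  rw [bumped, Matrix.of_apply]
  split_ifs with h
  · exact zero_le_one
  · rcases le_or_gt j i with hij | hij
    · rw [seed_low hij]; split_ifs <;> norm_num
    · rw [(seed_mem_hessReg n).1 i j hij, eps, Matrix.of_apply]; split_ifs <;> norm_num

theorem bumped_zero_one (hn : 2 ≤ n) : bumped n ⟨0, by omega⟩ ⟨1, by omega⟩ = 1 := by
  rw [(bumped_mem_hessGen hn).1 _ _ (Fin.lt_def.2 Nat.zero_lt_one), eps, Matrix.of_apply,
    if_pos rfl]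

theorem bumped_one_zero (hn : 2 ≤ n) : bumped n ⟨1, by omega⟩ ⟨0, by omega⟩ = 1 := by
  rw [bumped, Matrix.of_apply, if_pos ⟨rfl, rfl⟩]

theorem todaField_bumped_ne_zero (hn : 2 ≤ n) : todaField (bumped n) ≠ 0 := by
  intro h
  have h1 := congrFun (congrFun h ⟨0, by omega⟩) ⟨0, by omega⟩
  rw [todaField, Matrix.sub_apply, Matrix.mul_apply, Matrix.mul_apply, Matrix.zero_apply,
    Finset.sum_eq_single (⟨1, by omega⟩ : Fin n), Finset.sum_eq_zero] at h1
  · rw [entryProj_of (S := fun i j : Fin n => j < i) (Fin.lt_def.2 Nat.zero_lt_one),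
      bumped_zero_one hn, bumped_one_zero hn] at h1
    norm_num at h1
  · intro k _
    rw [entryProj_of_not (S := fun i j : Fin n => j < i) (by
      rw [Fin.lt_def]; exact Nat.not_lt_zero _), zero_mul]
  · intro k _ hk
    have hk' : k.1 ≠ 1 := fun h => hk (Fin.ext h)
    by_cases h0 : k.1 = 0
    · rw [entryProj_of_not (S := fun i j : Fin n => j < i) (by rw [Fin.lt_def]; simp [h0]),
        mul_zero]
    · rw [(bumped_mem_hessGen hn).1 _ _ (Fin.lt_def.2 (Nat.pos_of_ne_zero h0)), eps,
        Matrix.of_apply, if_neg (by simp only; omega), zero_mul]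
  · simp

theorem exists_fam_coadH_ne (hn : 2 ≤ n) : ∃ k : FamIdx n, ∃ b : GL (Fin n) ℝ, IsBorel b ∧
    ∃ X ∈ hessGen n, fam k (coadH b X) ≠ fam k X := by
  -- Conjugation by `diag(1, 2, …, 2)` increases no entry below the diagonal and halves the entry
  -- `(1, 0)`, while the superdiagonal is reset to one. All entries are nonnegative, so `Tr X²`
  -- strictly decreases.
  set w : Fin n → ℝ := fun i => if i.1 = 0 then 1 else 2 with hw
  have hw0 : ∀ i, 0 < w i := fun i => by
    simp only [hw]; split_ifs <;> norm_num
  have hwle : ∀ i j : Fin n, j ≤ i → w j ≤ w i := fun i j hij => by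
    have := Fin.le_def.1 hij
    simp only [hw]; split_ifs <;> first | omega | norm_num
  have hut : UT (Matrix.diagonal w) := fun i j hij => Matrix.diagonal_apply_ne _ (ne_of_gt hij)
  have hdet : (Matrix.diagonal w).det ≠ 0 := hut.det_ne_zero fun i => by
    rw [Matrix.diagonal_apply_eq]; exact (hw0 i).ne'
  set b : GL (Fin n) ℝ := Matrix.GeneralLinearGroup.mkOfDetNeZero _ hdet with hb
  have hbv : (b : Mat n) = Matrix.diagonal w := rfl
  have hbB : IsBorel b := ⟨hut, fun i => by
    rw [hbv, Matrix.diagonal_apply_eq]; exact hw0 i⟩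
  have hlow : ∀ i j : Fin n, j ≤ i → coadH b (bumped n) i j = (w i)⁻¹ * bumped n i j * w j := by
    intro i j hij
    rw [coadH_low hbB.1 _ hij, hbv, Matrix.inv_diagonal, Matrix.mul_diagonal, Matrix.diagonal_mul]
    congr 2
    have hu : IsUnit w := (Pi.isUnit_iff).2 fun i => isUnit_iff_ne_zero.2 (hw0 i).ne'
    have h1 := congrFun (Ring.mul_inverse_cancel w hu) i
    rw [Pi.mul_apply, Pi.one_apply] at h1
    exact eq_inv_of_mul_eq_one_right h1
  have hle : ∀ i j : Fin n, coadH b (bumped n) i j ≤ bumped n i j := by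
    intro i j
    rcases le_or_gt j i with hij | hij
    · rw [hlow i j hij, mul_right_comm]
      refine mul_le_of_le_one_left (bumped_nonneg i j) ?_
      rw [inv_mul_le_iff₀ (hw0 i), mul_one]
      exact hwle i j hij
    · rw [coadH_mem_hess b _ i j hij, (bumped_mem_hessGen hn).1 i j hij]
  have hnn : ∀ i j : Fin n, 0 ≤ coadH b (bumped n) i j := by
    intro i j
    rcases le_or_gt j i with hij | hij
    · rw [hlow i j hij]
      exact mul_nonneg (mul_nonneg (inv_nonneg.2 (hw0 i).le) (bumped_nonneg i j)) (hw0 j).le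
    · rw [coadH_mem_hess b _ i j hij, ← (bumped_mem_hessGen hn).1 i j hij]
      exact bumped_nonneg i j
  have hsq : ∀ A : Mat n, (A ^ 2).trace = ∑ i, ∑ j, A i j * A j i := fun A => by
    rw [pow_two, Matrix.trace]
    rfl
  have hlt : (coadH b (bumped n) ^ 2).trace < (bumped n ^ 2).trace := by
    rw [hsq, hsq]
    have hterm : ∀ i j : Fin n, coadH b (bumped n) i j * coadH b (bumped n) j i ≤
        bumped n i j * bumped n j i := fun i j =>
      mul_le_mul (hle i j) (hle j i) (hnn j i) (bumped_nonneg i j)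
    refine Finset.sum_lt_sum (fun i _ => Finset.sum_le_sum fun j _ => hterm i j)
      ⟨⟨1, by omega⟩, Finset.mem_univ _, Finset.sum_lt_sum (fun j _ => hterm _ j)
        ⟨⟨0, by omega⟩, Finset.mem_univ _, ?_⟩⟩
    rw [hlow _ _ (Fin.le_def.2 zero_le_one), bumped_one_zero hn,
      coadH_mem_hess b _ _ _ (Fin.lt_def.2 Nat.zero_lt_one), eps, Matrix.of_apply, if_pos rfl,
      bumped_zero_one hn]
    simp only [hw]
    norm_num
  refine ⟨⟨⟨0, by omega⟩, ⟨1, by simp only; omega⟩⟩, b, hbB, bumped n, bumped_mem_hessGen hn, ?_⟩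
  rw [fam_of_eq_zero rfl]
  exact hlt.ne

end NonInvariance

end KostantToda

open KostantToda in
theorem proposition3p2 (n : ℕ) (hn : 1 ≤ n) :
    -- Semi-invariance of all `E_{m,r}`, with the common weight `χ_r`.
    (∀ r ≤ n / 2, ∃ χ : P n r →* ℝˣ,
      (∀ p : P n r, ((χ p : ℝˣ) : ℝ) =
        (∏ i : Fin n with i.1 < r, ((p : GL (Fin n) ℝ) : Mat n) i i) /
          (∏ i : Fin n with n ≤ i.1 + r, ((p : GL (Fin n) ℝ) : Mat n) i i)) ∧
      ∀ m ≤ n - 2 * r, IsSemiInvariant r (E m r : Mat n → ℝ) χ) ∧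
    -- (i) Invariance under conjugation.
    (∀ m ≤ n, ∀ (g : GL (Fin n) ℝ) (X : Mat n),
      E m 0 ((g : Mat n) * X * ((g⁻¹ : GL (Fin n) ℝ) : Mat n)) = E m 0 X) ∧
    -- (i) The `E_{m,0}` generate the algebra of polynomial Casimirs on the dual of `gl`.
    (∀ f : MvPolynomial (Fin n × Fin n) ℝ,
      IsCasimirOn (fun _ _ => True) Set.univ (evalAt f) ↔
        f ∈ Algebra.adjoin ℝ {q | ∃ m ≤ n, q = EPoly n m 0}) ∧
    -- (i) So do the `Tr X^m`.
    (Algebra.adjoin ℝ {q | ∃ m ≤ n, q = EPoly n m 0} =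
      Algebra.adjoin ℝ {q | ∃ m, 1 ≤ m ∧ m ≤ n ∧ q = trPoly n m}) ∧
    -- (i) On `ℋ` they are not all Casimirs, but they are in involution.
    (2 ≤ n → ∃ m ≤ n, ¬ IsCasimirOn (· ≤ ·) (hess n) (E m 0 : Mat n → ℝ)) ∧
    (∀ m ≤ n, ∀ m' ≤ n, InInvolutionOn (· ≤ ·) (hess n) (E m 0 : Mat n → ℝ) (E m' 0)) ∧
    -- (i) `Tr X² / 2` is the Hamiltonian of the full Kostant Toda lattice.
    (∀ X ∈ hess n, hamVec (fun Y : Mat n => (Y ^ 2).trace / 2) X = todaField X) ∧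
    -- (ii) The `I_{m,r}` are `P_r`-Casimirs and rational functions on `𝔭_{r-}`.
    (∀ r, 1 ≤ r → r ≤ (n - 1) / 2 → ∀ m ≤ n - 2 * r,
      (∀ p : P n r, ∀ X ∈ dualPar n r, E 0 r X ≠ 0 →
        E 0 r (coad (InPar n r) (tau n r) (p : GL (Fin n) ℝ) X) ≠ 0 ∧
          I m r (coad (InPar n r) (tau n r) (p : GL (Fin n) ℝ) X) = I m r X) ∧
      IsCasimirOn (InPar n r) {X | X ∈ dualPar n r ∧ E 0 r X ≠ 0} (I m r) ∧
      ∃ p q : MvPolynomial {ij : Fin n × Fin n // InPar n r ij.2 ij.1} ℝ, q ≠ 0 ∧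
        ∀ X ∈ dualPar n r,
          E m r X = MvPolynomial.eval (fun ij => X ij.1.1 ij.1.2) p ∧
          E 0 r X = MvPolynomial.eval (fun ij => X ij.1.1 ij.1.2) q) ∧
    -- (ii) `ℋ_gen`, and likewise `𝒳`, is a nonempty Zariski open subset of `ℋ`.
    (∃ d : MvPolynomial (Fin n × Fin n) ℝ,
      (∃ X ∈ hess n, evalAt d X ≠ 0) ∧ hessGen n = {X | X ∈ hess n ∧ evalAt d X ≠ 0}) ∧
    (∃ d : MvPolynomial (Fin n × Fin n) ℝ,
      (∃ X ∈ hess n, evalAt d X ≠ 0) ∧ hessReg n = {X | X ∈ hess n ∧ evalAt d X ≠ 0}) ∧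
    -- (ii) The family is involutive on `ℋ_gen`.
    (∀ k l : FamIdx n, InInvolutionOn (· ≤ ·) (hessGen n) (fam k) (fam l)) ∧
    -- (ii) Maximality and complete integrability on a nonempty Zariski open set.
    (∃ d : MvPolynomial (Fin n × Fin n) ℝ, (∃ X ∈ hess n, evalAt d X ≠ 0) ∧
      ∀ X ∈ hessGen n, evalAt d X ≠ 0 →
        X ∈ hessReg n ∧
        LinearIndependent ℝ (fun k : FamIdx n => diffH (fam k) X) ∧
        (∀ F : Mat n → ℝ, DifferentiableAt ℝ F X →
          (∀ k : FamIdx n, bracketH F (fam k) X = 0) →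
            diffH F X ∈ Submodule.span ℝ (Set.range fun k : FamIdx n => diffH (fam k) X)) ∧
        2 * Module.finrank ℝ
            (Submodule.span ℝ (Set.range fun k : FamIdx n => hamVec (fam k) X)) =
          Module.finrank ℝ (charSpace X) ∧
        orbitB X ⊆ closure (orbitB X ∩ {Y | evalAt d Y ≠ 0})) ∧
    -- (ii) The members of the family are not all `B`-invariant.
    (2 ≤ n → ∃ k : FamIdx n, ∃ b : GL (Fin n) ℝ, IsBorel b ∧
      ∃ X ∈ hessGen n, fam k (coadH b X) ≠ fam k X) ∧
    -- (ii) They are constants of motion of the full Kostant Toda flow, which preserves `ℋ_gen`.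
    (∀ (a b : ℝ) (γ : ℝ → Mat n),
      (∀ t ∈ Set.Icc a b, γ t ∈ hess n ∧
        HasDerivWithinAt γ (todaField (γ t)) (Set.Icc a b) t) →
      γ a ∈ hessGen n →
      ∀ t ∈ Set.Icc a b, γ t ∈ hessGen n ∧ ∀ k : FamIdx n, fam k (γ t) = fam k (γ a)) ∧
    -- (iii) The `E_{0,r}` are invariants of the coadjoint action of `N` on `𝔫₋`.
    (∀ r, 1 ≤ r → r ≤ n / 2 → ∀ u : GL (Fin n) ℝ, IsUnipotentUpper u →
      ∀ L : Mat n, (∀ i j, i ≤ j → L i j = 0) →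
        E 0 r (coad (· < ·) 0 u L) = E 0 r L) ∧
    -- (iv) `Tr X` and the `I_{1,r}` are Casimirs of the bracket on `ℋ`.
    (∀ r : Fin ((n + 1) / 2),
      IsCasimirOn (· ≤ ·) {X | X ∈ hess n ∧ E 0 r.1 X ≠ 0} (cas r)) ∧
    -- (iv) They are independent, and every Casimir depends functionally on them.
    (∀ X ∈ hessGen n, LinearIndependent ℝ (fun r : Fin ((n + 1) / 2) => diffH (cas r) X)) ∧
    (∀ (U : Set (Mat n)) (F : Mat n → ℝ), IsOpen U → ContDiffOn ℝ 1 F U →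
      IsCasimirOn (· ≤ ·) (U ∩ hessGen n) F →
        ∀ X ∈ U ∩ hessGen n, diffH F X ∈
          Submodule.span ℝ (Set.range fun r : Fin ((n + 1) / 2) => diffH (cas r) X)) ∧
    -- (iv) Generic level sets, symplectic leaves of maximal dimension, and coadjoint orbits.
    (∀ X ∈ hessReg n,
      orbitB X = connectedComponentIn (levelSet X) X ∧
      sympLeaf X = orbitB X ∧
      levelSet X = {Y | ∃ b : GL (Fin n) ℝ, IsUpper b ∧ Y = coadH b X} ∧
      Module.finrank ℝ (charSpace X) + (n + 1) / 2 = n * (n + 1) / 2 ∧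
      ∀ Y ∈ hess n, Module.finrank ℝ (charSpace Y) ≤ Module.finrank ℝ (charSpace X)) := by
  have hmem : ∀ {r : ℕ} (p : P n r), InParAlg r ((p : GL (Fin n) ℝ) : Mat n) := fun p => p.2
  have hseed := seed_mem_hessReg n
  refine ⟨fun r _ => ⟨parChar n r, fun p => rfl, fun m _ => isSemiInvariant_E r m⟩,
    fun m _ g X => E_zero_index_conj m g X, isCasimirOn_iff_mem_coeffAlg hn,
    coeffAlg_eq_traceAlg hn, fun h2 => exists_not_isCasimirOn_E_zero hn
      (bumped_mem_hessGen h2).1 (todaField_bumped_ne_zero h2),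
    fun m _ m' _ => inInvolutionOn_E_zero m m', fun X hX => hamVec_half_trace_sq hX,
    fun r h1 h2 m _ => ⟨fun p X _ hE => ?_, isCasimirOn_I m r, ?_⟩,
    ⟨genPoly n ((n - 1) / 2), ?_, genericUpTo_eq _⟩, ⟨genPoly n (n / 2), ?_, genericUpTo_eq _⟩,
    -- The first factor keeps `V` inside `𝒳`, where the corank is known; the second makes the
    -- differentials independent.
    inInvolutionOn_fam, ⟨genPoly n (n / 2) * famDet n, ⟨seed n, hseed.1, ?_⟩, ?_⟩,
    exists_fam_coadH_ne, fun a b γ hγ ha => toda_flow_conserves hγ ha,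
    fun r _ h2 u hu L _ => E_zero_coad_strict (by omega) hu L, isCasimirOn_cas,
    fun X hX => linearIndependent_diffH_cas hX,
    fun U F hU hF hcas X hX => diffH_mem_span_of_isCasimirOn hU hF hcas hX,
    fun X hX => ⟨orbitB_eq_connectedComponentIn hX, sympLeaf_eq_orbitB hX,
      levelSet_eq_upper_orbit hX, finrank_charSpace hX, fun Y hY => finrank_charSpace_le hX hY⟩⟩
  · have hw : loProd r ((p : GL (Fin n) ℝ) : Mat n) / hiProd r ((p : GL (Fin n) ℝ) : Mat n) ≠ 0 :=
      div_ne_zero (loProd_ne_zero (hmem p) (gl_det_ne_zero _))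
        (hiProd_ne_zero (hmem p) (gl_det_ne_zero _))
    rw [I, E_coad 0 (hmem p), E_coad m (hmem p), mul_div_mul_left _ _ hw]
    exact ⟨mul_ne_zero hw hE, rfl⟩
  · exact exists_polynomials_on_dualPar m r
      ⟨seed n, hess_subset_dualPar r hseed.1, seed_E_ne_zero (by omega)⟩
  · have h := hessReg_subset_hessGen hseed
    rw [hessGen, genericUpTo_eq] at h
    exact ⟨seed n, h⟩
  · have h := hseed
    rw [hessReg, genericUpTo_eq] at h
    exact ⟨seed n, h⟩
  · have h := hseed
    rw [hessReg, genericUpTo_eq] at h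
    rw [evalAt_mul]
    exact mul_ne_zero h.2 evalAt_famDet_seed
  · intro X hX hd
    have hd' := hd
    rw [evalAt_mul] at hd'
    have hreg : X ∈ hessReg n := by
      rw [hessReg, genericUpTo_eq]
      exact ⟨hX.1, (mul_ne_zero_iff.1 hd').1⟩
    have hli := linearIndependent_diffH_fam hX (mul_ne_zero_iff.1 hd').2
    exact ⟨hreg, hli, fun F _ hF => diffH_mem_span_fam hreg hli hF,
      two_mul_finrank_span_hamVec hreg hli, orbitB_subset_closure _ hX.1 hd⟩
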